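/- Let $M$ be a connected, paracompact (Hausdorff) smooth two-dimensional spin manifold of signature $\eta$, where $\eta_{ab}=\mathrm{diag}(\pm1,\pm1)$ is any signature, with Dirac matrices $\gamma_a\in M_2(\mathbb C)$, $\gamma_a\gamma_b+\gamma_b\gamma_a=2\eta_{ab}\mathbb I$, $\gamma_{ab}=\gamma_{[a}\gamma_{b]}$. Let $e_a^\mu$ be a smooth spin frame (given in local trivializations of a $\mathrm{Spin}(\eta)$-bundle over $M$), with induced metric $g_{\mu\nu}=e^a_\mu\eta_{ab}e^b_\nu$ and spin connection $\Gamma^{ab}_\mu=e^a_\alpha(\Gamma^\alpha_{\beta\mu}e^{b\beta}+\partial_\mu e^{b\alpha})$, where $\Gamma^\alpha_{\beta\mu}$ is the Levi-Civita connection of $g$. Let $q\in\mathbb R$, let $A_\mu$ be a smooth connection on a $U(1)$-bundle over $M$, and let $\mathbf V$ be a smooth matrix potential, that is, a section of the endomorphisms of the spinor bundle (for instance $\mathbf V=V\mathbb I+\hat V\gamma_0\gamma_1$). On spinor fields let $$D_\mu\psi=\partial_\mu\psi+\tfrac14\Gamma^{ab}_\mu\gamma_{ab}\psi-iqA_\mu\psi,\qquad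 D_a=e_a^\mu D_\mu,\qquad \mathbb D\psi=i\gamma^aD_a\psi-\mathbf V\psi .$$ A second-order symmetry operator is an operator $\mathbb K=\mathbb E^{ab}D_{ab}+\mathbb F^aD_a+\mathbb G$ with smooth matrix-valued (tensorial) coefficients that commutes with $\mathbb D$, where $D_{ab}=\frac12(D_aD_b+D_bD_a)$ is the symmetrized second covariant derivative; it is a first-order symmetry operator if $\mathbb E^{ab}=0$. Call $\mathbb K$ trivial if $\mathbb K=\mathbb K^{(1)}\mathbb D+k\,\mathbb I$ for some first-order symmetry operator $\mathbb K^{(1)}$ and some constant $k\in\mathbb C$, that is, if up to a zero-order symmetry operator it is the product of a first-order symmetry operator with $\mathbb D$. Theorem. If there exists a non-trivial second-order symmetry operator, then $M$ admits a Killing tensor that is not proportional to the metric: a smooth real symmetric tensor field $e^{ab}$ on $M$ with $\nabla^{(c}e^{ab)}=0$ that is not of the form $e^{ab}=\lambda\eta^{ab}$ for any function $\lambda$ on $M$. -/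

import Mathlib

open scoped Manifold ContDiff

noncomputable section

namespace DiracSymmetry

/-- Coordinate space of a two-dimensional manifold. -/
abbrev Coord := EuclideanSpace ℝ (Fin 2)

/-- Values of a two-component spinor field in a gauge. -/
abbrev Spinor := Fin 2 → ℂ

abbrev Mat := Matrix (Fin 2) (Fin 2) ℂ

/-- The coordinate partial derivative `∂_μ f` at `x`. -/
def pd {F : Type*} [NormedAddCommGroup F] [NormedSpace ℝ F] (μ : Fin 2) (f : Coord → F)
    (x : Coord) : F :=
  fderiv ℝ f x (EuclideanSpace.single μ 1)

/-- Smoothness on `U` of a matrix-valued function, entry by entry. -/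
def SmoothMatOn (f : Coord → Mat) (U : Set Coord) : Prop :=
  ∀ r s, ContDiffOn ℝ ∞ (fun x => f x r s) U

/-- A signature `η_ab = diag (η 0, η 1)` with entries `±1`, and Dirac matrices `γ_a` for it:
`γ_a γ_b + γ_b γ_a = 2 η_ab`. Since `η a = ±1`, `η a` is also the diagonal entry of the inverse
`η^{ab}`; a Latin index is raised or lowered by multiplication by `η a`. -/
structure DiracMatrices where
  η : Fin 2 → ℝ
  η_sign : ∀ a, η a = 1 ∨ η a = -1
  /-- `γ_a`, with lower index -/
  γ : Fin 2 → Mat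
  clifford : ∀ a b, γ a * γ b + γ b * γ a = (if a = b then (2 * η a : ℂ) else 0) • (1 : Mat)

namespace DiracMatrices

variable (c : DiracMatrices)

/-- `γ^a = η^{ab} γ_b` -/
def γup (a : Fin 2) : Mat := (c.η a : ℂ) • c.γ a

/-- `γ_ab = γ_[a γ_b]` -/
def γ₂ (a b : Fin 2) : Mat := (1 / 2 : ℂ) • (c.γ a * c.γ b - c.γ b * c.γ a)

/-- Clifford multiplication by the vector `v`. -/
def vec (v : Fin 2 → ℝ) : Mat := ∑ a, (v a : ℂ) • c.γ a

/-- The square `η_ab v^a v^b`. -/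
def sq (v : Fin 2 → ℝ) : ℝ := ∑ a, c.η a * v a ^ 2

/-- `Spin(η)` in the representation given by the Dirac matrices: the products of an even number of
vectors `v` with `η(v, v) = ±1`. (It is closed under inverses as `v⁻¹ = ±v`.) -/
def spin : Submonoid Mat :=
  Submonoid.closure {S | ∃ v w : Fin 2 → ℝ, |c.sq v| = 1 ∧ |c.sq w| = 1 ∧ S = c.vec v * c.vec w}

/-! ### Local geometry of a frame

`e a μ` is the component `e_a^μ` of a frame on an open set of coordinate space. -/

/-- The inverse matrix `e^a_μ` of the frame. -/
def coframe (e : Fin 2 → Fin 2 → Coord → ℝ) (a μ : Fin 2) (x : Coord) : ℝ :=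
  (Matrix.of fun b ν => e b ν x)⁻¹ μ a

/-- The induced metric `g_μν = e^a_μ η_ab e^b_ν`. -/
def metric (e : Fin 2 → Fin 2 → Coord → ℝ) (μ ν : Fin 2) (x : Coord) : ℝ :=
  ∑ a, c.η a * coframe e a μ x * coframe e a ν x

/-- The inverse metric `g^μν = e_a^μ η^{ab} e_b^ν`. -/
def invMetric (e : Fin 2 → Fin 2 → Coord → ℝ) (μ ν : Fin 2) (x : Coord) : ℝ :=
  ∑ a, c.η a * e a μ x * e a ν x

/-- The Christoffel symbols `Γ^α_{βμ}` of the Levi-Civita connection of the induced metric. -/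
def christoffel (e : Fin 2 → Fin 2 → Coord → ℝ) (α β μ : Fin 2) (x : Coord) : ℝ :=
  (1 / 2) * ∑ κ, c.invMetric e α κ x *
    (pd β (c.metric e κ μ) x + pd μ (c.metric e κ β) x - pd κ (c.metric e β μ) x)

/-- The spin connection `Γ^{ab}_μ = e^a_α (Γ^α_{βμ} e^{bβ} + ∂_μ e^{bα})`. -/
def spinConn (e : Fin 2 → Fin 2 → Coord → ℝ) (a b μ : Fin 2) (x : Coord) : ℝ :=
  ∑ α, coframe e a α x *
    (∑ β, c.christoffel e α β μ x * (c.η b * e b β x) + c.η b * pd μ (e b α) x)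

/-- `Γ^a_{bμ}`, the second index of the spin connection being lowered. -/
def spinConnMixed (e : Fin 2 → Fin 2 → Coord → ℝ) (a b μ : Fin 2) (x : Coord) : ℝ :=
  c.spinConn e a b μ x * c.η b

/-- The covariant derivative `D_μ ψ = ∂_μ ψ + (1/4) Γ^{ab}_μ γ_ab ψ - i q A_μ ψ`. -/
def covD (e : Fin 2 → Fin 2 → Coord → ℝ) (q : ℝ) (A : Fin 2 → Coord → ℝ) (μ : Fin 2)
    (ψ : Coord → Spinor) (x : Coord) : Spinor :=
  pd μ ψ x + (1 / 4 : ℂ) • ∑ a, ∑ b, (c.spinConn e a b μ x : ℂ) • (c.γ₂ a b).mulVec (ψ x)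
    - (Complex.I * q * A μ x) • ψ x

/-- `D_a ψ = e_a^μ D_μ ψ` -/
def frameD (e : Fin 2 → Fin 2 → Coord → ℝ) (q : ℝ) (A : Fin 2 → Coord → ℝ) (a : Fin 2)
    (ψ : Coord → Spinor) (x : Coord) : Spinor :=
  ∑ μ, (e a μ x : ℂ) • c.covD e q A μ ψ x

/-- The second covariant derivative `D_a D_b ψ = e_a^μ (D_μ (D_b ψ) - Γ^d_{bμ} D_d ψ)`, in which the
outer derivative also acts on the frame index `b`. -/
def frameDD (e : Fin 2 → Fin 2 → Coord → ℝ) (q : ℝ) (A : Fin 2 → Coord → ℝ) (a b : Fin 2)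
    (ψ : Coord → Spinor) (x : Coord) : Spinor :=
  c.frameD e q A a (c.frameD e q A b ψ) x -
    ∑ μ, ∑ d, ((e a μ x * c.spinConnMixed e d b μ x : ℝ) : ℂ) • c.frameD e q A d ψ x

/-- The symmetrized second covariant derivative `D_ab`. -/
def symDD (e : Fin 2 → Fin 2 → Coord → ℝ) (q : ℝ) (A : Fin 2 → Coord → ℝ) (a b : Fin 2)
    (ψ : Coord → Spinor) (x : Coord) : Spinor :=
  (1 / 2 : ℂ) • (c.frameDD e q A a b ψ x + c.frameDD e q A b a ψ x)

/-- `∇^d t^{ab}` for a tensor with frame components `t^{ab}`, where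
`∇_d t^{ab} = e_d^μ (∂_μ t^{ab} + Γ^a_{kμ} t^{kb} + Γ^b_{kμ} t^{ak})`. -/
def nablaUp (e : Fin 2 → Fin 2 → Coord → ℝ) (t : Fin 2 → Fin 2 → Coord → ℝ) (d a b : Fin 2)
    (x : Coord) : ℝ :=
  c.η d * ∑ μ, e d μ x * (pd μ (t a b) x +
    ∑ k, (c.spinConnMixed e a k μ x * t k b x + c.spinConnMixed e b k μ x * t a k x))

end DiracMatrices

/-- The Jacobian matrix `∂(φ^μ)/∂(ψ^ν)` at `x ∈ M` of the change from coordinates `ψ` to `φ`. -/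
def jacobian {M : Type*} [TopologicalSpace M] (φ ψ : OpenPartialHomeomorph M Coord) (x : M)
    (μ ν : Fin 2) : ℝ :=
  pd ν (fun y => φ (ψ.symm y) μ) (ψ x)

/-- A spin structure with a spin frame on the two-dimensional manifold `M`, described in local
trivializations of the spin bundle `P` over a coordinate cover indexed by `ι`.
`frame i` is the local expression `e_a^μ` of the spin frame `P → L(M)` in the `i`-th trivialization,
and the `Spin(η)`-valued cocycle `S i j` relates the `i`-th trivialization to the `j`-th one. `rot i j x`
is the matrix of the image of `(S i j x)⁻¹` under the covering `Spin(η) → SO(η)`; it is determined by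
`rot_spec`. -/
structure SpinManifold (c : DiracMatrices) (M : Type*) [TopologicalSpace M]
    [ChartedSpace Coord M] (ι : Type*) where
  chart : ι → OpenPartialHomeomorph M Coord
  chart_mem : ∀ i, chart i ∈ IsManifold.maximalAtlas (𝓡 2) ∞ M
  cover : ∀ x, ∃ i, x ∈ (chart i).source
  frame : ι → Fin 2 → Fin 2 → Coord → ℝ
  frame_smooth : ∀ i a μ, ContDiffOn ℝ ∞ (frame i a μ) (chart i).target
  frame_det : ∀ i, ∀ x ∈ (chart i).target, (Matrix.of fun a μ => frame i a μ x).det ≠ 0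
  S : ι → ι → M → Mat
  S_smooth : ∀ i j r s, ContMDiffOn (𝓡 2) 𝓘(ℝ, ℂ) ∞ (fun x => S i j x r s)
    ((chart i).source ∩ (chart j).source)
  S_mem : ∀ i j, ∀ x ∈ (chart i).source ∩ (chart j).source, S i j x ∈ c.spin
  S_cocycle : ∀ i j k, ∀ x ∈ (chart i).source ∩ (chart j).source ∩ (chart k).source,
    S i j x * S j k x = S i k x
  rot : ι → ι → M → Matrix (Fin 2) (Fin 2) ℝ
  /-- `S⁻¹ γ_a S = rot_a^b γ_b` -/
  rot_spec : ∀ i j, ∀ x ∈ (chart i).source ∩ (chart j).source, ∀ a,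
    c.γ a * S i j x = S i j x * ∑ b, (rot i j x a b : ℂ) • c.γ b
  frame_trans : ∀ i j, ∀ x ∈ (chart i).source ∩ (chart j).source, ∀ a μ,
    frame i a μ (chart i x) = ∑ b, rot i j x a b *
      ∑ ν, jacobian (chart i) (chart j) x μ ν * frame j b ν (chart j x)

variable {c : DiracMatrices} {M : Type*} [TopologicalSpace M] [ChartedSpace Coord M] {ι : Type*}

/-- External fields on a spin manifold: a charge `q`, a `U(1)`-bundle with transition functions
`u i j`, a connection on it with local real potentials `A_μ`, and a smooth matrix potential `V`
on the spinor bundle. A spinor field is a family of functions `ψ i` with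
`ψ i = u i j * S i j * ψ j` on overlaps. -/
structure ExternalFields (X : SpinManifold c M ι) where
  q : ℝ
  u : ι → ι → M → Circle
  u_smooth : ∀ i j, ContMDiffOn (𝓡 2) 𝓘(ℝ, ℂ) ∞ (fun x => (u i j x : ℂ))
    ((X.chart i).source ∩ (X.chart j).source)
  u_cocycle : ∀ i j k, ∀ x ∈ (X.chart i).source ∩ (X.chart j).source ∩ (X.chart k).source,
    u i j x * u j k x = u i k x
  A : ι → Fin 2 → Coord → ℝ
  A_smooth : ∀ i μ, ContDiffOn ℝ ∞ (A i μ) (X.chart i).target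
  /-- the gauge transformation law `q A_i = q A_j - i u⁻¹ du`, in the coordinates of `j` -/
  A_trans : ∀ i j, ∀ x ∈ (X.chart i).source ∩ (X.chart j).source, ∀ ν,
    pd ν (fun y => (u i j ((X.chart j).symm y) : ℂ)) (X.chart j x) =
      Complex.I * q * (u i j x : ℂ) *
        (((∑ μ, A i μ (X.chart i x) * jacobian (X.chart i) (X.chart j) x μ ν)
          - A j ν (X.chart j x) : ℝ) : ℂ)
  V : ι → Coord → Mat
  V_smooth : ∀ i, SmoothMatOn (V i) (X.chart i).target
  V_trans : ∀ i j, ∀ x ∈ (X.chart i).source ∩ (X.chart j).source,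
    V i (X.chart i x) * X.S i j x = X.S i j x * V j (X.chart j x)

/-- The Dirac operator `𝔻 ψ = i γ^a D_a ψ - V ψ` in the `i`-th trivialization. -/
def dirac {X : SpinManifold c M ι} (W : ExternalFields X) (i : ι) (ψ : Coord → Spinor)
    (x : Coord) : Spinor :=
  Complex.I • ∑ a, (c.γup a).mulVec (c.frameD (X.frame i) W.q (W.A i) a ψ x)
    - (W.V i x).mulVec (ψ x)

/-- The coefficients `E^{ab}`, `F^a`, `G` of a linear differential operator of order at most two
`E^{ab} D_ab + F^a D_a + G` on spinor fields, in all the trivializations. They are smooth and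
transform as matrix-valued tensors, so that the local operators fit together on `M`. -/
structure DiffOp (X : SpinManifold c M ι) where
  E : ι → Fin 2 → Fin 2 → Coord → Mat
  F : ι → Fin 2 → Coord → Mat
  G : ι → Coord → Mat
  E_smooth : ∀ i a b, SmoothMatOn (E i a b) (X.chart i).target
  F_smooth : ∀ i a, SmoothMatOn (F i a) (X.chart i).target
  G_smooth : ∀ i, SmoothMatOn (G i) (X.chart i).target
  E_trans : ∀ i j, ∀ x ∈ (X.chart i).source ∩ (X.chart j).source, ∀ k l,
    X.S i j x * E j k l (X.chart j x) =
      (∑ a, ∑ b, ((X.rot i j x a k * X.rot i j x b l : ℝ) : ℂ) • E i a b (X.chart i x)) * X.S i j x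
  F_trans : ∀ i j, ∀ x ∈ (X.chart i).source ∩ (X.chart j).source, ∀ k,
    X.S i j x * F j k (X.chart j x) =
      (∑ a, (X.rot i j x a k : ℂ) • F i a (X.chart i x)) * X.S i j x
  G_trans : ∀ i j, ∀ x ∈ (X.chart i).source ∩ (X.chart j).source,
    X.S i j x * G j (X.chart j x) = G i (X.chart i x) * X.S i j x

namespace DiffOp

variable {X : SpinManifold c M ι}

/-- The action of the operator on spinors in the `i`-th trivialization. -/
def act (K : DiffOp X) (W : ExternalFields X) (i : ι) (ψ : Coord → Spinor) (x : Coord) : Spinor :=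
  (∑ a, ∑ b, (K.E i a b x).mulVec (c.symDD (X.frame i) W.q (W.A i) a b ψ x))
    + (∑ a, (K.F i a x).mulVec (c.frameD (X.frame i) W.q (W.A i) a ψ x))
    + (K.G i x).mulVec (ψ x)

/-- `K` is of order at most one: its second-order coefficients vanish. -/
def IsFirstOrder (K : DiffOp X) : Prop :=
  ∀ i a b, ∀ x ∈ (X.chart i).target, K.E i a b x = 0

/-- `K` is a symmetry operator: `K 𝔻 ψ = 𝔻 K ψ` for all smooth local spinor fields `ψ`. (The
operators are local, so this is the same as commutation on global spinor fields.) -/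
def IsSymmetry (K : DiffOp X) (W : ExternalFields X) : Prop :=
  ∀ i, ∀ ψ : Coord → Spinor, ContDiffOn ℝ ∞ ψ (X.chart i).target → ∀ x ∈ (X.chart i).target,
    K.act W i (dirac W i ψ) x = dirac W i (K.act W i ψ) x

/-- `K` is trivial: up to a zero-order symmetry operator, that is, up to a constant multiple of the
identity, it is the product `K₁ 𝔻` of a first-order symmetry operator `K₁` with `𝔻`. -/
def IsTrivial (K : DiffOp X) (W : ExternalFields X) : Prop :=
  ∃ K₁ : DiffOp X, K₁.IsFirstOrder ∧ K₁.IsSymmetry W ∧ ∃ k : ℂ,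
    ∀ i, ∀ ψ : Coord → Spinor, ContDiffOn ℝ ∞ ψ (X.chart i).target → ∀ x ∈ (X.chart i).target,
      K.act W i ψ x = K₁.act W i (dirac W i ψ) x + k • ψ x

end DiffOp

/-- A (real, smooth) Killing tensor of valence two on `M`: a symmetric tensor field `t^{ab}`, given by
its components in the local frames, with `∇^{(d} t^{ab)} = 0`. -/
structure KillingTensor (X : SpinManifold c M ι) where
  t : ι → Fin 2 → Fin 2 → Coord → ℝ
  smooth : ∀ i a b, ContDiffOn ℝ ∞ (t i a b) (X.chart i).target
  symm : ∀ i a b, ∀ x ∈ (X.chart i).target, t i a b x = t i b a x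
  trans : ∀ i j, ∀ x ∈ (X.chart i).source ∩ (X.chart j).source, ∀ k l,
    t j k l (X.chart j x) =
      ∑ a, ∑ b, X.rot i j x a k * X.rot i j x b l * t i a b (X.chart i x)
  killing : ∀ i, ∀ x ∈ (X.chart i).target, ∀ d a b,
    c.nablaUp (X.frame i) (t i) d a b x + c.nablaUp (X.frame i) (t i) a b d x
      + c.nablaUp (X.frame i) (t i) b d a x = 0

/-- `t^{ab} = s η^{ab}` at every point, for some function `s`; in the orthonormal frames `η^{ab}` are
the components of the metric. -/
def KillingTensor.ProportionalToMetric {X : SpinManifold c M ι} (T : KillingTensor X) : Prop :=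
  ∀ i, ∀ x ∈ (X.chart i).target, ∃ s : ℝ, ∀ a b, T.t i a b x = if a = b then s * c.η a else 0

end DiracSymmetry

end

open scoped Manifold ContDiff

noncomputable section

namespace DiracSymmetry

open TopologicalSpace

/-! ### Partial derivatives of smooth functions on coordinate space -/

section PartialDerivatives

variable {F : Type*} [NormedAddCommGroup F] [NormedSpace ℝ F]

/-! The contrapositive is proved: if every Killing tensor is proportional to the metric, then every
second-order symmetry operator K is trivial.

The symbol of K is controlled by commuting the relation [K, 𝔻] = 0 repeatedly with multiplication by
a function f. Put p = [𝔻, f], which is Clifford multiplication by df, B = [K, f] and 2e = [B, f], so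
that e is the symbol of K at df. The Jacobi identity gives [e, 𝔻] + [B, p] = 0 and then [e, p] = 0.
The differential of f is arbitrary at a point, so the second relation is pure algebra in the 2×2
matrices, and it forces the symbol to be e^{ab} p_a p_b plus the product of a^c p_c with the
Clifford element of p (`symbol_second_order`). In the first relation, the traces of the zero-order
part against 1 and against p lose the potential and all lower coefficients of K. What remains is the
Killing equation for a^c and for e^{ab} (`symbol_equations`, `op₂_vector_equation`).

If all Killing tensors are multiples of the metric, there is no nonzero Killing vector w either: w ⊗
w is a Killing tensor of rank at most one, while the metric has rank two. Complex fields are treated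
through the real parts of w and of -i w. Hence a = 0 and e^{ab} = l η^{ab}, and the Killing equation
makes l constant. The symbol of 𝔻² is -η^{ab}, so K + l 𝔻² is a symmetry operator of order one. The
same argument one order lower gives it the symbol w^a + t i γ^a with w a Killing vector, hence zero,
and t constant. Then K + l 𝔻² - t 𝔻 is multiplication by a matrix that commutes with 𝔻. It commutes
with the Dirac matrices, so it is a scalar, and a scalar commuting with 𝔻 is a constant k. Therefore
K = (t - l 𝔻) 𝔻 + k.

The local computations take place in `DiracCalc`, where operators form a ring over a commutative
algebra with two derivations and every claim becomes a noncommutative ring identity; `LocalData.dc`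
is the instance given by smooth functions. Globally, l, t and k must agree between trivializations.
They are read off by traces, which conjugation by the spin cocycle does not change. The trace giving
k contains the scalar curvature and a divergence, whose independence of the frame is proved through
`FrameChange`. Connectedness of M then turns local constants into global ones. -/

theorem pd_congr {U : Set Coord} (hU : IsOpen U) {f g : Coord → F} (h : ∀ y ∈ U, f y = g y)
    (μ : Fin 2) {x : Coord} (hx : x ∈ U) : pd μ f x = pd μ g x := by
  have : f =ᶠ[nhds x] g := Filter.mem_of_superset (hU.mem_nhds hx) h
  rw [pd, pd, this.fderiv_eq]

theorem differentiableAt_of_smoothOn {U : Set Coord} (hU : IsOpen U) {f : Coord → F}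
    (hf : ContDiffOn ℝ ∞ f U) {x : Coord} (hx : x ∈ U) : DifferentiableAt ℝ f x :=
  (hf.contDiffAt (hU.mem_nhds hx)).differentiableAt (by simp)

theorem smoothOn_pd {U : Set Coord} (hU : IsOpen U) {f : Coord → F}
    (hf : ContDiffOn ℝ ∞ f U) (μ : Fin 2) : ContDiffOn ℝ ∞ (pd μ f) U :=
  (hf.fderiv_of_isOpen hU (by simp)).clm_apply contDiffOn_const

theorem pd_comm {U : Set Coord} (hU : IsOpen U) {f : Coord → F}
    (hf : ContDiffOn ℝ ∞ f U) (μ ν : Fin 2) {x : Coord} (hx : x ∈ U) :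
    pd μ (pd ν f) x = pd ν (pd μ f) x := by
  have h1 := hf.contDiffAt (hU.mem_nhds hx)
  have hd : DifferentiableAt ℝ (fderiv ℝ f) x :=
    differentiableAt_of_smoothOn hU (hf.fderiv_of_isOpen hU (by simp)) hx
  have hs : IsSymmSndFDerivAt ℝ f x := h1.isSymmSndFDerivAt (by
    rw [minSmoothness_of_isRCLikeNormedField]; exact WithTop.coe_le_coe.2 le_top)
  have key : ∀ v w : Coord, fderiv ℝ (fun y => fderiv ℝ f y v) x w
      = fderiv ℝ (fderiv ℝ f) x w v := by
    intro v w
    rw [fderiv_clm_apply hd (differentiableAt_const v)]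
    simp
  unfold pd
  rw [key, key]
  exact hs _ _

theorem pd_const (μ : Fin 2) (a : F) (x : Coord) : pd μ (fun _ => a) x = 0 := by
  simp [pd]

theorem pd_add {f g : Coord → F} {x : Coord} (hf : DifferentiableAt ℝ f x)
    (hg : DifferentiableAt ℝ g x) (μ : Fin 2) :
    pd μ (fun y => f y + g y) x = pd μ f x + pd μ g x := by
  simp [pd, fderiv_fun_add hf hg]

theorem pd_mul {𝔸 : Type*} [NormedCommRing 𝔸] [NormedAlgebra ℝ 𝔸] {f g : Coord → 𝔸} {x : Coord}
    (hf : DifferentiableAt ℝ f x) (hg : DifferentiableAt ℝ g x) (μ : Fin 2) :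
    pd μ (fun y => f y * g y) x = f x * pd μ g x + g x * pd μ f x := by
  simp [pd, fderiv_fun_mul hf hg]

theorem pd_clm {G : Type*} [NormedAddCommGroup G] [NormedSpace ℝ G] (L : F →L[ℝ] G)
    {f : Coord → F} {x : Coord} (hf : DifferentiableAt ℝ f x) (μ : Fin 2) :
    pd μ (fun y => L (f y)) x = L (pd μ f x) := by
  have := (L.hasFDerivAt.comp x hf.hasFDerivAt).fderiv
  simp only [pd]
  rw [show (fun y => L (f y)) = (L ∘ f) from rfl, this]
  rfl

theorem pd_ofReal {f : Coord → ℝ} {x : Coord} (hf : DifferentiableAt ℝ f x) (μ : Fin 2) :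
    pd μ (fun y => (f y : ℂ)) x = ((pd μ f x : ℝ) : ℂ) :=
  pd_clm Complex.ofRealCLM hf μ

theorem pd_apply {f : Coord → Spinor} {x : Coord} (hf : DifferentiableAt ℝ f x) (μ r : Fin 2) :
    pd μ f x r = pd μ (fun y => f y r) x :=
  (pd_clm (ContinuousLinearMap.proj (R := ℝ) (φ := fun _ : Fin 2 => ℂ) r) hf μ).symm

theorem smoothOn_ofReal {U : Set Coord} {f : Coord → ℝ} (hf : ContDiffOn ℝ ∞ f U) :
    ContDiffOn ℝ ∞ (fun y => (f y : ℂ)) U :=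
  Complex.ofRealCLM.contDiff.comp_contDiffOn hf

end PartialDerivatives

/-! ### The algebra of smooth functions and its derivations -/

/-- The algebra of smooth complex functions on an open subset of the coordinate space. -/
def Sm (U : Opens Coord) : Subalgebra ℂ (U → ℂ) where
  carrier := {f | ∃ F : Coord → ℂ, ContDiffOn ℝ ∞ F U ∧ ∀ y : U, F y = f y}
  mul_mem' := by
    rintro f g ⟨F, hF, h⟩ ⟨G, hG, h'⟩
    exact ⟨fun y => F y * G y, hF.mul hG, fun y => by simp [h, h']⟩
  add_mem' := by
    rintro f g ⟨F, hF, h⟩ ⟨G, hG, h'⟩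
    exact ⟨fun y => F y + G y, hF.add hG, fun y => by simp [h, h']⟩
  algebraMap_mem' := fun r => ⟨fun _ => r, contDiffOn_const, fun _ => rfl⟩

namespace Sm

variable {U : Opens Coord}

/-- The element of `Sm U` given by a function smooth on `U`. -/
def mk (F : Coord → ℂ) (hF : ContDiffOn ℝ ∞ F U) : Sm U := ⟨fun y => F y, F, hF, fun _ => rfl⟩

/-- A function on the coordinate space extending an element of `Sm U`. -/
def lift (f : Sm U) : Coord → ℂ := Classical.choose f.2

theorem lift_smooth (f : Sm U) : ContDiffOn ℝ ∞ (lift f) U := (Classical.choose_spec f.2).1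

theorem lift_apply (f : Sm U) (y : U) : (lift f) y = (f : U → ℂ) y := (Classical.choose_spec f.2).2 y

theorem mk_lift (f : Sm U) : mk (lift f) (lift_smooth f) = f :=
  Subtype.ext (funext fun y => lift_apply f y)

theorem mk_congr {F G : Coord → ℂ} (hF : ContDiffOn ℝ ∞ F U) (hG : ContDiffOn ℝ ∞ G U)
    (h : ∀ y ∈ U, F y = G y) : mk F hF = mk G hG :=
  Subtype.ext (funext fun y => h y y.2)

theorem exists_mk (f : Sm U) : ∃ F, ∃ hF : ContDiffOn ℝ ∞ F U, f = mk F hF :=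
  ⟨lift f, (lift_smooth f), (mk_lift f).symm⟩

theorem mk_add {F G : Coord → ℂ} (hF : ContDiffOn ℝ ∞ F U) (hG : ContDiffOn ℝ ∞ G U) :
    mk F hF + mk G hG = mk (fun y => F y + G y) (hF.add hG) := rfl

theorem smul_mk {G : Coord → ℂ} (a : ℂ) (hG : ContDiffOn ℝ ∞ G U) :
    a • mk G hG = mk (fun y => a * G y) (contDiffOn_const.mul hG) := rfl

/-- Evaluation at a point of `U`. -/
def ev (y : U) : Sm U →ₐ[ℂ] ℂ := (Pi.evalAlgHom ℂ (fun _ : U => ℂ) y).comp (Sm U).val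

theorem ev_mk (F : Coord → ℂ) (hF : ContDiffOn ℝ ∞ F U) (y : U) : ev y (mk F hF) = F y := rfl

theorem eq_of_ev {f g : Sm U} (h : ∀ y, ev y f = ev y g) : f = g :=
  Subtype.ext (funext h)

/-- The partial derivative as a derivation of `Sm U`. -/
def pdS (μ : Fin 2) : Derivation ℂ (Sm U) (Sm U) where
  toFun f := mk (pd μ (lift f)) (smoothOn_pd U.2 (lift_smooth f) μ)
  map_add' f g := by
    rw [mk_add]
    refine mk_congr _ _ fun y hy => ?_
    rw [← pd_add (differentiableAt_of_smoothOn U.2 (lift_smooth f) hy)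
      (differentiableAt_of_smoothOn U.2 (lift_smooth g) hy)]
    refine pd_congr U.2 (fun z hz => ?_) μ hy
    rw [lift_apply _ ⟨z, hz⟩, lift_apply _ ⟨z, hz⟩, lift_apply _ ⟨z, hz⟩]
    rfl
  map_smul' a g := by
    rw [RingHom.id_apply, smul_mk]
    refine mk_congr _ _ fun y hy => ?_
    have h := pd_mul (differentiableAt_const (x := y) a)
      (differentiableAt_of_smoothOn U.2 (lift_smooth g) hy) μ
    rw [pd_const, mul_zero, add_zero] at h
    rw [← h]
    refine pd_congr U.2 (fun z hz => ?_) μ hy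
    rw [lift_apply _ ⟨z, hz⟩, lift_apply _ ⟨z, hz⟩]
    rfl
  map_one_eq_zero' := by
    refine Subtype.ext (funext fun y => ?_)
    refine (pd_congr U.2 (g := fun _ => (1 : ℂ)) (fun z hz => ?_) μ y.2).trans (pd_const _ _ _)
    exact lift_apply _ ⟨z, hz⟩
  leibniz' f g := by
    refine Subtype.ext (funext fun y => ?_)
    have h := pd_mul (differentiableAt_of_smoothOn U.2 (lift_smooth f) y.2)
      (differentiableAt_of_smoothOn U.2 (lift_smooth g) y.2) μ
    rw [lift_apply _ y, lift_apply _ y] at h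
    refine Eq.trans ?_ h
    refine pd_congr U.2 (fun z hz => ?_) μ y.2
    rw [lift_apply _ ⟨z, hz⟩, lift_apply _ ⟨z, hz⟩, lift_apply _ ⟨z, hz⟩]
    rfl

theorem pdS_mk (μ : Fin 2) (F : Coord → ℂ) (hF : ContDiffOn ℝ ∞ F U) :
    pdS μ (mk F hF) = mk (pd μ F) (smoothOn_pd U.2 hF μ) :=
  mk_congr (smoothOn_pd U.2 (lift_smooth _) μ) _
    fun _ hy => pd_congr U.2 (fun z hz => lift_apply _ ⟨z, hz⟩) μ hy

theorem pdS_comm (μ ν : Fin 2) (f : Sm U) : pdS μ (pdS ν f) = pdS ν (pdS μ f) := by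
  obtain ⟨F, hF, rfl⟩ := exists_mk f
  simp only [pdS_mk]
  exact mk_congr _ _ fun y hy => pd_comm U.2 hF μ ν hy

end Sm

end DiracSymmetry

/-! ### Algebraic model of the Dirac operator -/

namespace DiracSymmetry

/-- Algebraic data of a Dirac operator `∑ P_c D_c - V`, `D_c = δ_c + om_c P_0 P_1 + τ_c`, over a
commutative algebra with two derivations. -/
structure DiracCalc (S : Type*) [CommRing S] [Algebra ℂ S] where
  δ : Fin 2 → Derivation ℂ S S
  C : Fin 2 → S
  comm : ∀ f, δ 0 (δ 1 f) - δ 1 (δ 0 f) = C 0 * δ 0 f + C 1 * δ 1 f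
  κ : Fin 2 → S
  κ_sq : ∀ a, κ a * κ a = 1
  δ_κ : ∀ c a, δ c (κ a) = 0
  P : Fin 2 → Matrix (Fin 2) (Fin 2) S
  P_sq : ∀ a, P a * P a = κ a • (1 : Matrix (Fin 2) (Fin 2) S)
  P_anti : P 1 * P 0 = - (P 0 * P 1)
  δ_P : ∀ c a r s, δ c (P a r s) = 0
  τ : Fin 2 → S
  V : Matrix (Fin 2) (Fin 2) S

namespace DiracCalc

variable {S : Type*} [CommRing S] [Algebra ℂ S] (X : DiracCalc S)

local notation "MatS" => Matrix (Fin 2) (Fin 2) S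
local notation "Ops" => Module.End ℂ (Fin 2 → S)

/-- The connection coefficient `om c`, determined by the structure functions of the frame. -/
def om (c : Fin 2) : S := algebraMap ℂ S (1 / 2) * X.κ c * X.C c

/-- The connection matrix. -/
def M (c : Fin 2) : MatS := X.om c • (X.P 0 * X.P 1) + X.τ c • 1

/-- Multiplication of spinors by a matrix. -/
def m : MatS →+* Ops where
  toFun N := N.mulVecLin.restrictScalars ℂ
  map_one' := by ext; simp
  map_mul' A B := by
    refine LinearMap.ext fun ψ => ?_
    simp
  map_zero' := by ext; simp
  map_add' A B := by
    refine LinearMap.ext fun ψ => ?_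
    simp

theorem m_apply (N : MatS) (ψ : Fin 2 → S) : m N ψ = N.mulVec ψ := rfl

theorem m_smul (z : ℂ) (N : MatS) : m (z • N) = z • m N := by
  refine LinearMap.ext fun ψ => ?_
  simp [m_apply, Matrix.smul_mulVec]

theorem m_injective : Function.Injective (m : MatS →+* Ops) := by
  intro A B h
  refine Matrix.mulVec_injective (funext fun ψ => ?_)
  exact congrArg (fun L : Ops => L ψ) h

/-- Componentwise derivative of spinors. -/
def dSp (c : Fin 2) : Ops := LinearMap.pi fun r => (X.δ c).toLinearMap ∘ₗ LinearMap.proj r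

theorem dSp_apply (c : Fin 2) (ψ : Fin 2 → S) (r : Fin 2) : X.dSp c ψ r = X.δ c (ψ r) := rfl

/-- The covariant derivative on spinors. -/
def D (c : Fin 2) : Ops := X.dSp c + m (X.M c)

/-- The covariant derivative on matrices. -/
def cov (c : Fin 2) (N : MatS) : MatS := N.map (X.δ c) + X.M c * N - N * X.M c

/-- The Dirac operator. -/
def dirac : Ops := m (X.P 0) * X.D 0 + m (X.P 1) * X.D 1 - m X.V

/-- The Leibniz rule inside the operator ring. It is the rule by which derivatives are moved past
matrices in all the operator identities below. -/
theorem D_mul_m (c : Fin 2) (N : MatS) : X.D c * m N = m N * X.D c + m (X.cov c N) := by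
  have h : X.dSp c * m N = m N * X.dSp c + m (N.map (X.δ c)) := by
    refine LinearMap.ext fun ψ => funext fun r => ?_
    fin_cases r <;> simp [m_apply, dSp_apply] <;> ring
  rw [D, add_mul, h, cov, map_sub, map_add, map_mul, map_mul]
  noncomm_ring

theorem cov_add (c : Fin 2) (A B : MatS) : X.cov c (A + B) = X.cov c A + X.cov c B := by
  rw [cov, Matrix.map_add _ (map_add _), cov, cov]
  noncomm_ring

theorem cov_smul (c : Fin 2) (f : S) (B : MatS) :
    X.cov c (f • B) = X.δ c f • B + f • X.cov c B := by
  have : (f • B).map (X.δ c) = X.δ c f • B + f • B.map (X.δ c) := by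
    ext r s
    simp
    ring
  rw [cov, this, cov]
  simp only [Matrix.mul_smul, Matrix.smul_mul]
  module

theorem cov_one (c : Fin 2) : X.cov c 1 = 0 := by
  have : (1 : MatS).map (X.δ c) = 0 := by
    ext r s
    fin_cases r <;> fin_cases s <;> simp
  rw [cov, this]
  simp

theorem map_P (c a : Fin 2) : (X.P a).map (X.δ c) = 0 := by
  ext r s
  simp [X.δ_P]

theorem P_sq' (a : Fin 2) (Z : MatS) : X.P a * (X.P a * Z) = X.κ a • Z := by
  rw [← mul_assoc, X.P_sq, Matrix.smul_mul, one_mul]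

theorem P_anti' (Z : MatS) : X.P 1 * (X.P 0 * Z) = - (X.P 0 * (X.P 1 * Z)) := by
  rw [← mul_assoc, X.P_anti, neg_mul, mul_assoc]

/-- The entries of `P` are constant, so only the commutator with the connection matrix survives, and
`P 0 * P 1` acts on the generators as an infinitesimal rotation. -/
theorem cov_P0 (c : Fin 2) : X.cov c (X.P 0) = (-2 * X.κ 0 * X.om c) • X.P 1 := by
  rw [cov, map_P, M]
  simp only [add_mul, mul_add, Matrix.smul_mul, Matrix.mul_smul, mul_assoc, X.P_anti, X.P_sq',
    mul_neg, one_mul, mul_one]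
  module

theorem cov_P1 (c : Fin 2) : X.cov c (X.P 1) = (2 * X.κ 1 * X.om c) • X.P 0 := by
  rw [cov, map_P, M]
  simp only [add_mul, mul_add, Matrix.smul_mul, Matrix.mul_smul, mul_assoc, X.P_sq,
    X.P_anti', one_mul, mul_one]
  module

/-- The element `f_0 P_0 + f_1 P_1` for the differential of `f`. -/
def dP (f : S) : MatS := X.δ 0 f • X.P 0 + X.δ 1 f • X.P 1

theorem half_of {x : S} (h : x = -x) : x = 0 := by
  have h2 : (2 : ℂ) • x = 0 := by
    rw [two_smul]; nth_rewrite 1 [h]; simp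
  simpa using congrArg (fun z => (1 / 2 : ℂ) • z) h2

theorem trace_P_mul : (X.P 0 * X.P 1).trace = 0 := by
  apply half_of
  rw [← Matrix.trace_neg, ← X.P_anti, Matrix.trace_mul_comm]

/-- Conjugation by the other generator changes the sign of `P a` but preserves its trace. -/
theorem trace_P (a : Fin 2) : (X.P a).trace = 0 := by
  have key : ∀ b c : Fin 2, X.P b * X.P c = -(X.P c * X.P b) → (X.P c).trace = 0 := by
    intro b c h
    apply half_of
    have h1 : X.κ b • X.P c = X.P b * (X.P b * X.P c) := (X.P_sq' b _).symm
    have h2 : X.κ b • (X.P c).trace = - (X.κ b • (X.P c).trace) := by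
      rw [← Matrix.trace_smul, h1]
      nth_rewrite 1 [Matrix.trace_mul_comm]
      rw [h, neg_mul, Matrix.trace_neg, mul_assoc, X.P_sq, Matrix.mul_smul, mul_one, ← h, h1.symm]
    have := congrArg (fun z => X.κ b • z) h2
    simpa [← mul_assoc, X.κ_sq] using this
  fin_cases a
  · exact key 1 0 X.P_anti
  · exact key 0 1 (by rw [X.P_anti, neg_neg])

end DiracCalc

end DiracSymmetry

/-! ### Killing equations from traces of a commutator identity -/

namespace DiracSymmetry
namespace DiracCalc

variable {S : Type*} [CommRing S] [Algebra ℂ S] (X : DiracCalc S)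

local notation "MatS" => Matrix (Fin 2) (Fin 2) S
local notation "Ops" => Module.End ℂ (Fin 2 → S)

/-- After all derivatives are moved to the right, `h₀` and `h₁` are the coefficients of `D 0` and `D
1` in `h`. Supplying them as hypotheses avoids proving that these operators are independent over the
matrices; in the application they hold identically. -/
theorem zero_order_part {N B₀ B₁ H g : MatS}
    (h : m N * X.dirac - X.dirac * m N + ((m B₀ * X.D 0 + m B₁ * X.D 1 + m H) * m g
      - m g * (m B₀ * X.D 0 + m B₁ * X.D 1 + m H)) = 0)
    (h₀ : N * X.P 0 - X.P 0 * N + (B₀ * g - g * B₀) = 0)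
    (h₁ : N * X.P 1 - X.P 1 * N + (B₁ * g - g * B₁) = 0) :
    B₀ * X.cov 0 g + B₁ * X.cov 1 g - (X.P 0 * X.cov 0 N + X.P 1 * X.cov 1 N)
      - (N * X.V - X.V * N) + (H * g - g * H) = 0 := by
  apply m_injective
  have e₀ := congrArg (fun Z => m Z * X.D 0) h₀
  have e₁ := congrArg (fun Z => m Z * X.D 1) h₁
  simp only [map_add, map_sub, map_mul, map_zero, zero_mul] at e₀ e₁ ⊢
  simp only [dirac] at h
  have d0 := X.D_mul_m 0
  have d1 := X.D_mul_m 1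
  have r : ∀ Z : MatS, (m X.V : Ops) * m Z = m (X.V * Z) := fun Z => (map_mul _ _ _).symm
  simp only [mul_add, add_mul, sub_mul, mul_sub, mul_assoc, d0, d1] at h e₀ e₁ ⊢
  linear_combination (norm := noncomm_ring) h - e₀ - e₁

theorem half_cancel {x y : S} (h : 2 * x = 2 * y) : x = y := by
  have h2 : algebraMap ℂ S (1 / 2) * 2 = 1 := by
    rw [← map_ofNat (algebraMap ℂ S) 2, ← map_mul]
    norm_num
  linear_combination algebraMap ℂ S (1 / 2) * h + (y - x) * h2

theorem cov_dP (c : Fin 2) (f : S) :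
    X.cov c (X.dP f) = (X.δ c (X.δ 0 f) + 2 * X.κ 1 * X.om c * X.δ 1 f) • X.P 0 +
      (X.δ c (X.δ 1 f) - 2 * X.κ 0 * X.om c * X.δ 0 f) • X.P 1 := by
  rw [dP, cov_add, cov_smul, cov_smul, cov_P0, cov_P1]
  module

/-- Half the derivative of the square of the differential of `f`. -/
def nder (f : S) (c : Fin 2) : S :=
  X.κ 0 * X.δ 0 f * X.δ c (X.δ 0 f) + X.κ 1 * X.δ 1 f * X.δ c (X.δ 1 f)

/-- Traces of the zero-order part against 1 and against `X.dP f` separate the equation for the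
Clifford part `α` from that for the scalar part `ν`. Both say that the symbol Poisson-commutes with
the squared length of the differential. -/
theorem symbol_equations {f ν α b₀ b₁ a₀ a₁ : S} {H : MatS} {B₀ B₁ N : MatS}
    (hN : N = ν • 1 + α • X.dP f) (hB₀ : B₀ = b₀ • 1 + a₀ • X.dP f + α • X.P 0)
    (hB₁ : B₁ = b₁ • 1 + a₁ • X.dP f + α • X.P 1)
    (h : m N * X.dirac - X.dirac * m N + ((m B₀ * X.D 0 + m B₁ * X.D 1 + m H) * m (X.dP f)
      - m (X.dP f) * (m B₀ * X.D 0 + m B₁ * X.D 1 + m H)) = 0) :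
    X.κ 0 * X.δ 0 f * X.δ 0 α + X.κ 1 * X.δ 1 f * X.δ 1 α = a₀ * X.nder f 0 + a₁ * X.nder f 1 ∧
    X.κ 0 * X.δ 0 f * X.δ 0 ν + X.κ 1 * X.δ 1 f * X.δ 1 ν = b₀ * X.nder f 0 + b₁ * X.nder f 1 := by
  have hz := X.zero_order_part h
    -- The commutator of `α • X.dP f` with `P 0` cancels that of `α • P 0` with `X.dP f`.
    (by
      rw [hN, hB₀]
      simp only [add_mul, mul_add, Matrix.smul_mul, Matrix.mul_smul, one_mul, mul_one]
      module)
    (by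
      rw [hN, hB₁]
      simp only [add_mul, mul_add, Matrix.smul_mul, Matrix.mul_smul, one_mul, mul_one]
      module)
  have hcov : ∀ c, X.cov c N = X.δ c ν • 1 + (X.δ c α • X.dP f + α • X.cov c (X.dP f)) := by
    intro c
    rw [hN, cov_add, cov_smul, cov_smul, cov_one, smul_zero, add_zero]
  have hcomm : X.dP f * N = N * X.dP f := by
    rw [hN]
    simp only [add_mul, mul_add, Matrix.smul_mul, Matrix.mul_smul, one_mul, mul_one]
  have hk0 := X.κ_sq 0
  have hk1 := X.κ_sq 1
  have hV : ∀ A B : MatS, (A * B - B * A).trace = 0 := by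
    intro A B
    rw [Matrix.trace_sub, Matrix.trace_mul_comm, sub_self]
  -- The potential drops out of the second trace because `N` commutes with `X.dP f`; in the first
  -- one it occurs only in a commutator.
  have hg : ∀ B Z : MatS, B * Z = Z * B → (Z * (B * X.V - X.V * B)).trace = 0 := by
    intro B Z hBZ
    rw [mul_sub, ← mul_assoc, ← hBZ, mul_assoc, Matrix.trace_sub, ← mul_assoc Z,
      Matrix.trace_mul_comm B, mul_assoc, sub_self]
  have hg' : (X.dP f * (H * X.dP f - X.dP f * H)).trace = 0 := by
    rw [mul_sub, Matrix.trace_sub, ← mul_assoc, Matrix.trace_mul_comm (X.dP f * H), sub_self]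
  have hP01 := X.trace_P_mul
  constructor
  · apply half_cancel
    have ht := congrArg Matrix.trace hz
    rw [Matrix.trace_add, Matrix.trace_sub, hV N, hV H, hcov, hcov, cov_dP, cov_dP, hB₀, hB₁,
      dP] at ht
    simp only [add_mul, mul_add, Matrix.smul_mul, Matrix.mul_smul, one_mul, mul_one, X.P_sq,
      X.P_anti, Matrix.trace_add, Matrix.trace_sub, Matrix.trace_smul, X.trace_P, hP01,
      Matrix.trace_neg, Matrix.trace_one, Fintype.card_fin, smul_eq_mul, Matrix.trace_zero, mul_assoc] at ht
    simp only [nder]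
    push_cast at ht
    linear_combination -ht
  · apply half_cancel
    have ht := congrArg Matrix.trace (congrArg (X.dP f * ·) hz)
    rw [mul_add, mul_sub, mul_sub, Matrix.trace_add, Matrix.trace_sub, Matrix.trace_sub,
      hg N _ hcomm.symm, hg', hcov, hcov, cov_dP, cov_dP, hB₀, hB₁, dP] at ht
    simp only [add_mul, mul_add, sub_mul, Matrix.smul_mul, Matrix.mul_smul, one_mul,
      mul_one, mul_assoc, X.P_sq, X.P_sq', X.P_anti, X.P_anti', mul_neg,
      Matrix.trace_add, Matrix.trace_smul, X.trace_P, hP01,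
      Matrix.trace_neg, Matrix.trace_one, Fintype.card_fin, smul_eq_mul, Matrix.trace_zero, mul_zero] at ht
    simp only [nder]
    push_cast at ht
    linear_combination -ht

end DiracCalc

end DiracSymmetry

/-! ### Iterated commutators with functions -/

namespace DiracSymmetry

/-- This is the commutator of [K, D] = 0 with s, by the Jacobi identity. -/
theorem commutator_first_order {R : Type*} [Ring R] {K D s n p : R} (h : K * D = D * K)
    (hK : K * s = s * K + n) (hD : D * s = s * D + p) :
    n * D - D * n + (K * p - p * K) = 0 := by
  obtain rfl : n = K * s - s * K := by rw [hK]; noncomm_ring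
  obtain rfl : p = D * s - s * D := by rw [hD]; noncomm_ring
  linear_combination (norm := noncomm_ring) h * s - s * h

/-- A second commutator with s: [[K, s], s] = 2e pairs with D, the mixed term [B, p] occurs twice,
and [p, s] = 0 removes the rest. -/
theorem commutator_second_order {R : Type*} [Ring R] {K D s B p e : R} (h : K * D = D * K)
    (hK : K * s = s * K + B) (hD : D * s = s * D + p) (hB : B * s = s * B + 2 * e)
    (hp : p * s = s * p) : 2 * (e * D - D * e + (B * p - p * B)) = 0 := by
  obtain rfl : B = K * s - s * K := by rw [hK]; noncomm_ring
  obtain rfl : p = D * s - s * D := by rw [hD]; noncomm_ring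
  linear_combination (norm := noncomm_ring)
    D * hB - hB * D + h * s * s - 2 * s * h * s + s * s * h - K * hp + hp * K

/-- In a third commutator, [e, D] contributes one copy of [e, p], and [B, p] contributes two because
[B, s] = 2e. -/
theorem commutator_third_order {R : Type*} [Ring R] {D s B p e : R}
    (h : e * D - D * e + (B * p - p * B) = 0) (hD : D * s = s * D + p) (he : e * s = s * e)
    (hp : p * s = s * p) (hB : B * s = s * B + (e + e)) : 3 * (e * p - p * e) = 0 := by
  linear_combination (norm := noncomm_ring) h * s - s * h - e * hD + hD * e - he * D + D * he
    - B * hp + hp * B - hB * p + p * hB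

namespace DiracCalc

variable {S : Type*} [CommRing S] [Algebra ℂ S] (X : DiracCalc S)

local notation "MatS" => Matrix (Fin 2) (Fin 2) S
local notation "Ops" => Module.End ℂ (Fin 2 → S)

theorem ops_half_cancel {x : Ops} (h : 2 * x = 0) : x = 0 := by
  have : (2 : ℂ) • x = 0 := by rw [two_smul, ← two_mul, h]
  simpa using congrArg (fun z => (1 / 2 : ℂ) • z) this

theorem m_mul_scalar (N : MatS) (f : S) : (m N : Ops) * m (f • 1) = m (f • 1) * m N := by
  rw [← map_mul, ← map_mul]
  simp

theorem D_mul_scalar (c : Fin 2) (f : S) :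
    X.D c * m (f • 1) = m (f • 1) * X.D c + m (X.δ c f • 1) := by
  rw [D_mul_m, cov_smul, cov_one, smul_zero, add_zero]

theorem m_mul_scalar' (N : MatS) (f : S) (Z : Ops) :
    (m N : Ops) * (m (f • 1) * Z) = m (f • 1) * (m N * Z) := by
  rw [← mul_assoc, m_mul_scalar, mul_assoc]

theorem D_mul_scalar' (c : Fin 2) (f : S) (Z : Ops) :
    X.D c * (m (f • 1) * Z) = m (f • 1) * (X.D c * Z) + m (X.δ c f • 1) * Z := by
  rw [← mul_assoc, D_mul_scalar, add_mul, mul_assoc]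

theorem m_scalar (f : S) (N : MatS) : (m (f • N) : Ops) = m (f • 1) * m N := by
  rw [← map_mul]; simp

/-- The operator of first order with the given coefficients. -/
def op₁ (F₀ F₁ G : MatS) : Ops := m F₀ * X.D 0 + m F₁ * X.D 1 + m G

/-- The operator of second order with the given coefficients. -/
def op₂ (E₀ Q E₁ F₀ F₁ G : MatS) : Ops :=
  m E₀ * (X.D 0 * X.D 0) + m Q * (X.D 0 * X.D 1) + m E₁ * (X.D 1 * X.D 1) + X.op₁ F₀ F₁ G

theorem dirac_eq : X.dirac = X.op₁ (X.P 0) (X.P 1) (-X.V) := by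
  rw [dirac, op₁, map_neg, sub_eq_add_neg]

theorem op₁_mul_scalar (F₀ F₁ G : MatS) (f : S) :
    X.op₁ F₀ F₁ G * m (f • 1) =
      m (f • 1) * X.op₁ F₀ F₁ G + m (X.δ 0 f • F₀ + X.δ 1 f • F₁) := by
  rw [op₁, map_add, m_scalar _ F₀, m_scalar _ F₁]
  simp only [add_mul, mul_add, mul_assoc, D_mul_scalar, m_mul_scalar, m_mul_scalar']
  abel

theorem dirac_mul_scalar (f : S) : X.dirac * m (f • 1) = m (f • 1) * X.dirac + m (X.dP f) := by
  rw [dirac_eq, op₁_mul_scalar, dP]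

theorem op₂_mul_scalar (E₀ Q E₁ F₀ F₁ G : MatS) (f : S) :
    X.op₂ E₀ Q E₁ F₀ F₁ G * m (f • 1) = m (f • 1) * X.op₂ E₀ Q E₁ F₀ F₁ G +
      X.op₁ ((2 * X.δ 0 f) • E₀ + X.δ 1 f • Q) (X.δ 0 f • Q + (2 * X.δ 1 f) • E₁)
        (X.δ 0 (X.δ 0 f) • E₀ + X.δ 0 (X.δ 1 f) • Q + X.δ 1 (X.δ 1 f) • E₁
          + (X.δ 0 f • F₀ + X.δ 1 f • F₁)) := by
  rw [op₂, add_mul _ (X.op₁ _ _ _), op₁_mul_scalar, map_add, m_scalar _ F₀, m_scalar _ F₁]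
  simp only [op₁, map_add, m_scalar _ E₀, m_scalar _ E₁, m_scalar _ Q, two_mul, add_smul,
    add_mul, mul_add, mul_assoc, D_mul_scalar, D_mul_scalar', m_mul_scalar, m_mul_scalar',
    m_scalar _ F₀, m_scalar _ F₁]
  abel

/-- The symbol of an operator of second order, at the differential of `f`. -/
def symb (E₀ Q E₁ : MatS) (f : S) : MatS :=
  (X.δ 0 f) ^ 2 • E₀ + (X.δ 0 f * X.δ 1 f) • Q + (X.δ 1 f) ^ 2 • E₁

/-- The zero-order coefficient of the commutator with `f` is left unspecified: it enters only
through a commutator with `X.dP f`, which no trace taken later can see. -/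
theorem op₂_commute {E₀ Q E₁ F₀ F₁ G : MatS}
    (h : X.op₂ E₀ Q E₁ F₀ F₁ G * X.dirac = X.dirac * X.op₂ E₀ Q E₁ F₀ F₁ G) (f : S) :
    ∃ H, m (X.symb E₀ Q E₁ f) * X.dirac - X.dirac * m (X.symb E₀ Q E₁ f) +
      (X.op₁ ((2 * X.δ 0 f) • E₀ + X.δ 1 f • Q) (X.δ 0 f • Q + (2 * X.δ 1 f) • E₁) H * m (X.dP f) -
      m (X.dP f) *
        X.op₁ ((2 * X.δ 0 f) • E₀ + X.δ 1 f • Q) (X.δ 0 f • Q + (2 * X.δ 1 f) • E₁) H) = 0 := by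
  refine ⟨_, ops_half_cancel (commutator_second_order h (X.op₂_mul_scalar _ _ _ _ _ _ f)
    (X.dirac_mul_scalar f) ?_ (m_mul_scalar _ f))⟩
  rw [op₁_mul_scalar, two_mul (m (X.symb E₀ Q E₁ f) : Ops), ← map_add, symb]
  refine congrArg (fun Z : MatS => _ + (m Z : Ops)) ?_
  module

theorem op₂_symb_commute {E₀ Q E₁ F₀ F₁ G : MatS}
    (h : X.op₂ E₀ Q E₁ F₀ F₁ G * X.dirac = X.dirac * X.op₂ E₀ Q E₁ F₀ F₁ G) (f : S) :
    X.symb E₀ Q E₁ f * X.dP f = X.dP f * X.symb E₀ Q E₁ f := by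
  obtain ⟨H, hH⟩ := X.op₂_commute h f
  have h2 : X.op₁ ((2 * X.δ 0 f) • E₀ + X.δ 1 f • Q) (X.δ 0 f • Q + (2 * X.δ 1 f) • E₁) H
      * m (f • 1) = m (f • 1) * X.op₁ ((2 * X.δ 0 f) • E₀ + X.δ 1 f • Q)
        (X.δ 0 f • Q + (2 * X.δ 1 f) • E₁) H + (m (X.symb E₀ Q E₁ f) + m (X.symb E₀ Q E₁ f)) := by
    rw [op₁_mul_scalar, ← map_add, symb]
    refine congrArg (fun Z : MatS => _ + (m Z : Ops)) ?_
    module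
  generalize X.op₁ ((2 * X.δ 0 f) • E₀ + X.δ 1 f • Q) (X.δ 0 f • Q + (2 * X.δ 1 f) • E₁) H = B
    at hH h2
  generalize X.symb E₀ Q E₁ f = e at hH h2 ⊢
  apply m_injective
  rw [← sub_eq_zero]
  have h3 := X.dirac_mul_scalar f
  have h4 := m_mul_scalar e f
  have h5 := m_mul_scalar (X.dP f) f
  rw [map_mul, map_mul]
  have key := commutator_third_order hH h3 h4 h5 h2
  have : (3 : ℂ) • (m e * m (X.dP f) - m (X.dP f) * m e : Ops) = 0 := by
    rw [← key, Algebra.smul_def, map_ofNat]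
  simpa using congrArg (fun z => (1 / 3 : ℂ) • z) this

theorem op₁_commute {F₀ F₁ G : MatS}
    (h : X.op₁ F₀ F₁ G * X.dirac = X.dirac * X.op₁ F₀ F₁ G) (f : S) :
    m (X.δ 0 f • F₀ + X.δ 1 f • F₁) * X.dirac - X.dirac * m (X.δ 0 f • F₀ + X.δ 1 f • F₁) +
      (X.op₁ F₀ F₁ G * m (X.dP f) - m (X.dP f) * X.op₁ F₀ F₁ G) = 0 :=
  commutator_first_order h (X.op₁_mul_scalar _ _ _ f) (X.dirac_mul_scalar f)

theorem op₁_symb_commute {F₀ F₁ G : MatS}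
    (h : X.op₁ F₀ F₁ G * X.dirac = X.dirac * X.op₁ F₀ F₁ G) (f : S) :
    (X.δ 0 f • F₀ + X.δ 1 f • F₁) * X.dP f = X.dP f * (X.δ 0 f • F₀ + X.δ 1 f • F₁) := by
  apply m_injective
  rw [← sub_eq_zero, map_mul, map_mul]
  -- For an operator of order one the second commutator with `f` vanishes, so only [B, p] = 0
  -- remains, where B is the symbol.
  have := commutator_second_order (e := 0) (K := X.op₁ F₀ F₁ G) h (X.op₁_mul_scalar _ _ _ f)
    (X.dirac_mul_scalar f) (by rw [m_mul_scalar, mul_zero, add_zero]) (m_mul_scalar _ f)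
  simpa using ops_half_cancel this

theorem op₀_commute {G : MatS} (h : m G * X.dirac = X.dirac * m G) (f : S) :
    G * X.dP f = X.dP f * G := by
  apply m_injective
  rw [← sub_eq_zero, map_mul, map_mul]
  have := commutator_first_order (n := 0) h (by rw [m_mul_scalar, add_zero])
    (X.dirac_mul_scalar f)
  simpa using this

/-- A scalar commutes with the Dirac operator up to Clifford multiplication by its differential; the
trace against `P c` isolates one component. -/
theorem op₀_scalar {r : S} (h : m (r • 1) * X.dirac = X.dirac * m (r • 1)) (c : Fin 2) :
    X.δ c r = 0 := by
  have h1 : X.dP r = 0 := by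
    apply m_injective
    rw [map_zero]
    rw [dirac_mul_scalar] at h
    simpa using h
  rw [dP] at h1
  have h2 := congrArg (fun Z => (X.P c * Z).trace) h1
  have hk := X.κ_sq c
  have ht := X.trace_P_mul
  have e2 : X.δ c r * X.κ c * 2 = 0 := by
    fin_cases c <;>
    · simp [mul_add, X.P_sq, X.P_anti, ht, ← mul_assoc] at h2 ⊢
      linear_combination h2
  have : 2 * X.δ c r = 2 * 0 := by
    linear_combination X.κ c * e2 - 2 * X.δ c r * hk
  exact half_cancel this

/-- Second derivatives of `f` occur in `symbol_equations` only in the antisymmetric combination of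
`δ 0` and `δ 1`. They are replaced by structure functions through `X.comm`, which leaves a quadratic
and a cubic form in the differential of `f`: the Killing equations of the vector and of the tensor
in the symbol. -/
theorem op₂_vector_equation {E₀ Q E₁ F₀ F₁ G : MatS} {e₀ q e₁ a₀ a₁ : S}
    (h : X.op₂ E₀ Q E₁ F₀ F₁ G * X.dirac = X.dirac * X.op₂ E₀ Q E₁ F₀ F₁ G)
    (h₀ : E₀ = e₀ • 1 + a₀ • X.P 0) (h₁ : E₁ = e₁ • 1 + a₁ • X.P 1)
    (hQ : Q = q • 1 + a₀ • X.P 1 + a₁ • X.P 0) (f : S) :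
    (X.κ 0 * X.δ 0 f * (X.δ 0 a₀ * X.δ 0 f + X.δ 0 a₁ * X.δ 1 f)
      + X.κ 1 * X.δ 1 f * (X.δ 1 a₀ * X.δ 0 f + X.δ 1 a₁ * X.δ 1 f)
      + (X.κ 0 * X.δ 0 f * a₁ - X.κ 1 * X.δ 1 f * a₀) * (X.C 0 * X.δ 0 f + X.C 1 * X.δ 1 f) = 0) ∧
    X.κ 0 * X.δ 0 f * (X.δ 0 e₀ * X.δ 0 f ^ 2 + X.δ 0 q * (X.δ 0 f * X.δ 1 f)
        + X.δ 0 e₁ * X.δ 1 f ^ 2)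
      + X.κ 1 * X.δ 1 f * (X.δ 1 e₀ * X.δ 0 f ^ 2 + X.δ 1 q * (X.δ 0 f * X.δ 1 f)
        + X.δ 1 e₁ * X.δ 1 f ^ 2)
      + (X.κ 0 * X.δ 0 f * (q * X.δ 0 f + 2 * e₁ * X.δ 1 f)
        - X.κ 1 * X.δ 1 f * (2 * e₀ * X.δ 0 f + q * X.δ 1 f))
        * (X.C 0 * X.δ 0 f + X.C 1 * X.δ 1 f) = 0 := by
  obtain ⟨H, hH⟩ := X.op₂_commute h f
  have hc := X.comm f
  obtain ⟨r1, r2⟩ := X.symbol_equations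
    (ν := e₀ * X.δ 0 f ^ 2 + q * (X.δ 0 f * X.δ 1 f) + e₁ * X.δ 1 f ^ 2)
    (α := a₀ * X.δ 0 f + a₁ * X.δ 1 f)
    (b₀ := 2 * e₀ * X.δ 0 f + q * X.δ 1 f) (b₁ := q * X.δ 0 f + 2 * e₁ * X.δ 1 f)
    (a₀ := a₀) (a₁ := a₁)
    (by rw [symb, h₀, h₁, hQ, dP]; module)
    (by rw [h₀, hQ, dP]; module)
    (by rw [h₁, hQ, dP]; module) hH
  simp only [map_add, Derivation.leibniz, Derivation.leibniz_pow, smul_eq_mul, nsmul_eq_mul,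
    nder] at r1 r2
  push_cast at r1 r2
  constructor
  · linear_combination r1 - (X.κ 0 * X.δ 0 f * a₁ - X.κ 1 * X.δ 1 f * a₀) * hc
  · linear_combination r2 - (X.κ 0 * X.δ 0 f * (q * X.δ 0 f + 2 * e₁ * X.δ 1 f)
        - X.κ 1 * X.δ 1 f * (2 * e₀ * X.δ 0 f + q * X.δ 1 f)) * hc

/-- The analogue one order lower. The Clifford part is now a scalar and obeys a linear equation,
which later makes it locally constant. -/
theorem op₁_vector_equation {F₀ F₁ G : MatS} {w₀ w₁ t : S}
    (h : X.op₁ F₀ F₁ G * X.dirac = X.dirac * X.op₁ F₀ F₁ G)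
    (h₀ : F₀ = w₀ • 1 + t • X.P 0) (h₁ : F₁ = w₁ • 1 + t • X.P 1) (f : S) :
    (X.κ 0 * X.δ 0 f * X.δ 0 t + X.κ 1 * X.δ 1 f * X.δ 1 t = 0) ∧
    X.κ 0 * X.δ 0 f * (X.δ 0 w₀ * X.δ 0 f + X.δ 0 w₁ * X.δ 1 f)
      + X.κ 1 * X.δ 1 f * (X.δ 1 w₀ * X.δ 0 f + X.δ 1 w₁ * X.δ 1 f)
      + (X.κ 0 * X.δ 0 f * w₁ - X.κ 1 * X.δ 1 f * w₀) * (X.C 0 * X.δ 0 f + X.C 1 * X.δ 1 f)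
      = 0 := by
  have hc := X.comm f
  obtain ⟨r1, r2⟩ := X.symbol_equations
    (ν := w₀ * X.δ 0 f + w₁ * X.δ 1 f) (α := t) (b₀ := w₀) (b₁ := w₁) (a₀ := 0) (a₁ := 0)
    (by rw [h₀, h₁, dP]; module)
    (by rw [h₀]; module)
    (by rw [h₁]; module) (X.op₁_commute h f)
  simp only [map_add, Derivation.leibniz, smul_eq_mul, nder] at r1 r2
  constructor
  · linear_combination r1
  · linear_combination r2 - (X.κ 0 * X.δ 0 f * w₁ - X.κ 1 * X.δ 1 f * w₀) * hc

end DiracCalc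

end DiracSymmetry

/-! ### The square of the Dirac operator -/

namespace DiracSymmetry

/-- The second-order cross terms collapse to p₀ p₁ [D₀, D₁]. The structure functions that this
commutator produces cancel those in `g₀` and `g₁`, which come from differentiating the Clifford
elements. -/
theorem square_first_order {R : Type*} [Ring R]
    {D₀ D₁ p₀ p₁ v k₀ k₁ c₀ c₁ x y z₀₀ z₀₁ z₁₀ z₁₁ v₀ v₁ r : R}
    (d₀₀ : D₀ * p₀ = p₀ * D₀ + z₀₀) (d₀₁ : D₀ * p₁ = p₁ * D₀ + z₀₁)
    (d₁₀ : D₁ * p₀ = p₀ * D₁ + z₁₀) (d₁₁ : D₁ * p₁ = p₁ * D₁ + z₁₁)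
    (h₀ : D₀ * v = v * D₀ + v₀) (h₁ : D₁ * v = v * D₁ + v₁)
    (e₀ : p₀ * p₀ = k₀) (e₁ : p₁ * p₁ = k₁) (e₂ : p₁ * p₀ = -(p₀ * p₁))
    (g₀ : p₀ * z₀₀ + p₁ * z₁₀ = -(c₀ * (p₀ * p₁)) - x)
    (g₁ : p₀ * z₀₁ + p₁ * z₁₁ = -(c₁ * (p₀ * p₁)) + y)
    (hc : D₀ * D₁ = D₁ * D₀ + c₀ * D₀ + c₁ * D₁ + r)
    (s₀ : p₀ * p₁ * c₀ = c₀ * (p₀ * p₁)) (s₁ : p₀ * p₁ * c₁ = c₁ * (p₀ * p₁)) :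
    (p₀ * D₀ + p₁ * D₁ - v) * (p₀ * D₀ + p₁ * D₁ - v) =
      k₀ * (D₀ * D₀) + k₁ * (D₁ * D₁) + ((-x - (p₀ * v + v * p₀)) * D₀
        + (y - (p₁ * v + v * p₁)) * D₁ + (p₀ * p₁ * r - (p₀ * v₀ + p₁ * v₁) + v * v)) := by
  linear_combination (norm := noncomm_ring) p₀ * d₀₀ * D₀ + p₀ * d₀₁ * D₁
    + p₁ * d₁₀ * D₀ + p₁ * d₁₁ * D₁ - p₀ * h₀ - p₁ * h₁ + e₀ * D₀ * D₀
    + e₁ * D₁ * D₁ + e₂ * D₁ * D₀ + g₀ * D₀ + g₁ * D₁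
    + p₀ * p₁ * hc + s₀ * D₀ + s₁ * D₁

theorem add_square_first_order {R : Type*} [Ring R]
    {D₀ D₁ l k₀ k₁ a b x y q q' u f₀ f₁ g w₀ w₁ w : R}
    (ha : k₀ * a = y) (hb : k₁ * b = x) (hq : q + q' = 0) :
    -(l * k₀) * (D₀ * D₀ + a * D₁) + q * u + (q' * u + -(l * k₁) * (D₁ * D₁ - b * D₀))
      + (f₀ * D₀ + f₁ * D₁) + g
      + l * (k₀ * (D₀ * D₀) + k₁ * (D₁ * D₁) + ((-x - w₀) * D₀ + (y - w₁) * D₁ + w)) =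
    (f₀ - l * w₀) * D₀ + (f₁ - l * w₁) * D₁ + (g + l * w) := by
  linear_combination (norm := noncomm_ring) hq * u - l * ha * D₁ + l * hb * D₀

theorem sub_zero_mul_add_neg_mul {R : Type*} [Ring R] (x y y' z : R) :
    x - (0 * y' + -z * y) = x + z * y := by
  simp

theorem symm_second_order {R : Type*} [Ring R] {D₀ D₁ c₀ c₁ r : R}
    (hc : D₀ * D₁ = D₁ * D₀ + c₀ * D₀ + c₁ * D₁ + r) :
    (D₀ * D₁ - (c₀ * D₀ + 0 * D₁)) + (D₁ * D₀ - (0 * D₀ + -c₁ * D₁)) =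
      (D₀ * D₁ - c₀ * D₀) + (D₀ * D₁ - c₀ * D₀) - r := by
  linear_combination (norm := noncomm_ring) -hc

namespace DiracCalc

variable {S : Type*} [CommRing S] [Algebra ℂ S] (X : DiracCalc S)

local notation "MatS" => Matrix (Fin 2) (Fin 2) S
local notation "Ops" => Module.End ℂ (Fin 2 → S)

/-- The curvature matrix. -/
def curv : MatS :=
  (X.δ 0 (X.om 1) - X.δ 1 (X.om 0) - (X.C 0 * X.om 0 + X.C 1 * X.om 1)) • (X.P 0 * X.P 1)
    + (X.δ 0 (X.τ 1) - X.δ 1 (X.τ 0) - (X.C 0 * X.τ 0 + X.C 1 * X.τ 1)) • 1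

theorem dSp_mul_m (c : Fin 2) (N : MatS) :
    X.dSp c * m N = m N * X.dSp c + m (N.map (X.δ c)) := by
  refine LinearMap.ext fun ψ => funext fun r => ?_
  fin_cases r <;> simp [m_apply, dSp_apply] <;> ring

theorem dSp_comm : X.dSp 0 * X.dSp 1 =
    X.dSp 1 * X.dSp 0 + m (X.C 0 • 1) * X.dSp 0 + m (X.C 1 • 1) * X.dSp 1 := by
  refine LinearMap.ext fun ψ => funext fun r => ?_
  have := X.comm (ψ r)
  simp only [LinearMap.add_apply, Module.End.mul_apply, m_apply, Pi.add_apply, dSp_apply,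
    Matrix.smul_mulVec, Matrix.one_mulVec, Pi.smul_apply, smul_eq_mul]
  linear_combination this

theorem map_M (c d : Fin 2) : (X.M d).map (X.δ c) =
    X.δ c (X.om d) • (X.P 0 * X.P 1) + X.δ c (X.τ d) • 1 := by
  ext r s
  simp only [M, Matrix.map_apply, Matrix.add_apply, Matrix.smul_apply, Matrix.mul_apply,
    Fin.sum_univ_two, smul_eq_mul, map_add, Derivation.leibniz, X.δ_P, Matrix.one_apply]
  split_ifs <;> simp <;> ring

/-- Both connection matrices lie in the commutative span of 1 and `P 0 * P 1`, so the curvature has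
no term quadratic in the connection. -/
theorem D_comm : X.D 0 * X.D 1 =
    X.D 1 * X.D 0 + m (X.C 0 • 1) * X.D 0 + m (X.C 1 • 1) * X.D 1 + m X.curv := by
  have hM : X.M 0 * X.M 1 = X.M 1 * X.M 0 := by
    simp only [M, add_mul, mul_add, Matrix.smul_mul, Matrix.mul_smul, one_mul, mul_one]
    module
  have h0 := X.dSp_mul_m 0 (X.M 1)
  have h1 := X.dSp_mul_m 1 (X.M 0)
  have hc : X.curv = (X.M 1).map (X.δ 0) - (X.M 0).map (X.δ 1) - X.C 0 • X.M 0
      - X.C 1 • X.M 1 := by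
    rw [map_M, map_M, M, M, curv]
    module
  have hMm := congrArg (m : MatS → Ops) hM
  rw [map_mul, map_mul] at hMm
  rw [hc, map_sub, map_sub, map_sub, m_scalar _ (X.M 0), m_scalar _ (X.M 1), D, D]
  have hd := X.dSp_comm
  linear_combination (norm := noncomm_ring) hd + h0 - h1 + hMm

theorem two_half : (2 : S) * algebraMap ℂ S (1 / 2) = 1 := by
  rw [← map_ofNat (algebraMap ℂ S) 2, ← map_mul]
  norm_num

theorem two_kappa_om (c : Fin 2) : 2 * X.κ c * X.om c = X.C c := by
  rw [om]
  linear_combination (X.κ c * X.κ c * X.C c) * two_half (S := S) + X.C c * X.κ_sq c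

/-- A Lichnerowicz formula with matrix potential. The scalar first-order terms are the contracted
connection, which completes `κ a • D a D a` to the covariant Laplacian. -/
theorem dirac_sq : X.dirac * X.dirac =
    m (X.κ 0 • 1) * (X.D 0 * X.D 0) + m (X.κ 1 • 1) * (X.D 1 * X.D 1)
      + X.op₁ (-(2 * X.κ 0 * X.κ 1 * X.om 1) • 1 - (X.P 0 * X.V + X.V * X.P 0))
        ((2 * X.κ 0 * X.κ 1 * X.om 0) • 1 - (X.P 1 * X.V + X.V * X.P 1))
        (X.P 0 * X.P 1 * X.curv - (X.P 0 * X.cov 0 X.V + X.P 1 * X.cov 1 X.V) + X.V * X.V) := by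
  have d00 := X.D_mul_m 0 (X.P 0)
  have d01 := X.D_mul_m 0 (X.P 1)
  have d10 := X.D_mul_m 1 (X.P 0)
  have d11 := X.D_mul_m 1 (X.P 1)
  have v0 := X.D_mul_m 0 X.V
  have v1 := X.D_mul_m 1 X.V
  have e0 := congrArg (m : MatS → Ops) (X.P_sq 0)
  have e1 := congrArg (m : MatS → Ops) (X.P_sq 1)
  have e2 := congrArg (m : MatS → Ops) X.P_anti
  have k0 := X.two_kappa_om 0
  have k1 := X.two_kappa_om 1
  have f0 : X.P 0 * X.cov 0 (X.P 0) + X.P 1 * X.cov 1 (X.P 0) =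
      -(X.C 0) • (X.P 0 * X.P 1) - (2 * X.κ 0 * X.κ 1 * X.om 1) • 1 := by
    rw [cov_P0, cov_P0, ← k0]
    simp only [Matrix.mul_smul, X.P_sq]
    module
  have f1 : X.P 0 * X.cov 0 (X.P 1) + X.P 1 * X.cov 1 (X.P 1) =
      -(X.C 1) • (X.P 0 * X.P 1) + (2 * X.κ 0 * X.κ 1 * X.om 0) • 1 := by
    rw [cov_P1, cov_P1, ← k1]
    simp only [Matrix.mul_smul, X.P_sq, X.P_anti]
    module
  have g0 := congrArg (m : MatS → Ops) f0
  have g1 := congrArg (m : MatS → Ops) f1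
  have hc := X.D_comm
  have s0 := m_mul_scalar (X.P 0 * X.P 1) (X.C 0)
  have s1 := m_mul_scalar (X.P 0 * X.P 1) (X.C 1)
  simp only [map_add, map_sub, map_neg, map_mul, neg_smul, m_scalar _ (X.P 0 * X.P 1)]
    at e0 e1 e2 g0 g1 s0 s1
  simp only [op₁, dirac, map_add, map_sub, map_neg, map_mul, neg_smul]
  exact square_first_order d00 d01 d10 d11 v0 v1 e0 e1 e2 g0 g1 hc s0 s1

/-- The frame components `Γ^d_{ba}` of the connection on vectors. -/
def conn (d b a : Fin 2) : S :=
  if d = b then 0 else if d = 0 then 2 * X.κ 0 * X.om a else -(2 * X.κ 1 * X.om a)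

/-- The second covariant derivative. -/
def DD (a b : Fin 2) : Ops := X.D a * X.D b - ∑ d, m (X.conn d b a • 1) * X.D d

/-- The symmetrized second covariant derivative. -/
def symDD (a b : Fin 2) : Ops := (1 / 2 : ℂ) • (X.DD a b + X.DD b a)

/-- The operator `E^{ab} D_ab + F^a D_a + G`. -/
def opK (E : Fin 2 → Fin 2 → MatS) (F : Fin 2 → MatS) (G : MatS) : Ops :=
  (∑ a, ∑ b, m (E a b) * X.symDD a b) + (∑ a, m (F a) * X.D a) + m G

theorem half_smul (x : Ops) : (1 / 2 : ℂ) • (x + x) = x := by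
  rw [← two_smul ℂ, smul_smul]; norm_num

theorem symDD_00 : X.symDD 0 0 = X.D 0 * X.D 0 + m ((2 * X.κ 1 * X.om 0) • 1) * X.D 1 := by
  rw [symDD, half_smul, DD]
  simp only [Fin.sum_univ_two, conn, one_ne_zero, if_true, if_false, zero_smul, map_zero,
    neg_smul, map_neg]
  exact sub_zero_mul_add_neg_mul _ _ _ _

theorem symDD_11 : X.symDD 1 1 = X.D 1 * X.D 1 - m ((2 * X.κ 0 * X.om 1) • 1) * X.D 0 := by
  rw [symDD, half_smul, DD]
  simp [conn]

theorem symDD_symm (a b : Fin 2) : X.symDD a b = X.symDD b a := by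
  rw [symDD, add_comm, symDD]

theorem symDD_01 : X.symDD 0 1 =
    X.D 0 * X.D 1 - m (X.C 0 • 1) * X.D 0 - m ((1 / 2 : ℂ) • X.curv) := by
  have hc := X.D_comm
  have k0 := X.two_kappa_om 0
  have k1 := X.two_kappa_om 1
  have : X.DD 0 1 + X.DD 1 0 = (X.D 0 * X.D 1 - m (X.C 0 • 1) * X.D 0)
      + (X.D 0 * X.D 1 - m (X.C 0 • 1) * X.D 0) - m X.curv := by
    simp only [DD, Fin.sum_univ_two, conn, k0, k1]
    simp only [one_ne_zero, zero_ne_one, if_true, if_false, zero_smul, map_zero,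
      neg_smul, map_neg]
    exact symm_second_order hc
  rw [symDD, this, smul_sub, half_smul, m_smul]

/-- Rewriting the symmetrized derivatives as ordered products changes only the lower coefficients.
Those do not affect the symbol equations, so their existence is enough. -/
theorem opK_eq_op₂ (E : Fin 2 → Fin 2 → MatS) (F : Fin 2 → MatS) (G : MatS) :
    ∃ F₀ F₁ G', X.opK E F G = X.op₂ (E 0 0) (E 0 1 + E 1 0) (E 1 1) F₀ F₁ G' := by
  refine ⟨F 0 - (E 1 1) * ((2 * X.κ 0 * X.om 1) • 1) - (E 0 1 + E 1 0) * (X.C 0 • 1),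
    F 1 + (E 0 0) * ((2 * X.κ 1 * X.om 0) • 1),
    G - (E 0 1 + E 1 0) * ((1 / 2 : ℂ) • X.curv), ?_⟩
  simp only [opK, op₂, op₁, Fin.sum_univ_two, symDD_00, symDD_11, X.symDD_symm 1 0, symDD_01,
    map_add, map_sub, map_mul, mul_add, add_mul, mul_sub, sub_mul, mul_assoc]
  abel

/-- The connection terms in `symDD` match those in `dirac_sq`, so the whole second-order part
cancels and first-order coefficients without derivatives of the frame remain. -/
theorem opK_add_dirac_sq {E : Fin 2 → Fin 2 → MatS} {l : S}
    (h₀ : E 0 0 = -(l * X.κ 0) • 1) (h₁ : E 1 1 = -(l * X.κ 1) • 1) (hQ : E 0 1 + E 1 0 = 0)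
    (F : Fin 2 → MatS) (G : MatS) :
    X.opK E F G + m (l • 1) * (X.dirac * X.dirac) =
      X.op₁ (F 0 - l • (X.P 0 * X.V + X.V * X.P 0)) (F 1 - l • (X.P 1 * X.V + X.V * X.P 1))
        (G + l • (X.P 0 * X.P 1 * X.curv - (X.P 0 * X.cov 0 X.V + X.P 1 * X.cov 1 X.V)
          + X.V * X.V)) := by
  have hQ' := congrArg (m : MatS → Ops) hQ
  rw [map_add, map_zero] at hQ'
  have e : ∀ f g : S, (m ((f * g) • 1) : Ops) = m (f • 1) * m (g • 1) := by
    intro f g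
    rw [← map_mul, Matrix.smul_mul, one_mul, smul_smul]
  have c1 : (m (X.κ 0 • 1) : Ops) * m ((2 * X.κ 1 * X.om 0) • 1)
      = m ((2 * X.κ 0 * X.κ 1 * X.om 0) • 1) := by
    rw [← e]; congr 2; ring
  have c2 : (m (X.κ 1 • 1) : Ops) * m ((2 * X.κ 0 * X.om 1) • 1)
      = m ((2 * X.κ 0 * X.κ 1 * X.om 1) • 1) := by
    rw [← e]; congr 2; ring
  rw [dirac_sq]
  simp only [opK, op₁, Fin.sum_univ_two, symDD_00, symDD_11, X.symDD_symm 1 0, h₀, h₁,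
    neg_smul, map_neg, e l (X.κ _)]
  rw [map_sub (m : MatS →+* Ops) (F 0), map_sub (m : MatS →+* Ops) (F 1), m_scalar l (_ + _),
    m_scalar l (_ + _), map_add (m : MatS →+* Ops) G, m_scalar l (_ + _),
    map_sub (m : MatS →+* Ops) (-_), map_sub (m : MatS →+* Ops) (_ • 1), map_neg]
  exact add_square_first_order c1 c2 hQ'

end DiracCalc

end DiracSymmetry

/-! ### The spin connection in terms of structure functions -/

namespace DiracSymmetry

open TopologicalSpace

/-- A smooth frame on an open subset of the coordinate space. -/
structure IsFrameOn (e : Fin 2 → Fin 2 → Coord → ℝ) (U : Set Coord) : Prop where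
  isOpen : IsOpen U
  smooth : ∀ a μ, ContDiffOn ℝ ∞ (e a μ) U
  det : ∀ x ∈ U, (Matrix.of fun a μ => e a μ x).det ≠ 0

/-- The structure functions `C^c` of a frame: `[e_0, e_1] = C^c e_c`. -/
def structC (e : Fin 2 → Fin 2 → Coord → ℝ) (d : Fin 2) (x : Coord) : ℝ :=
  ∑ μ, DiracMatrices.coframe e d μ x *
    ∑ ν, (e 0 ν x * pd ν (e 1 μ) x - e 1 ν x * pd ν (e 0 μ) x)

namespace IsFrameOn

open DiracMatrices

variable {e : Fin 2 → Fin 2 → Coord → ℝ} {U : Set Coord} (h : IsFrameOn e U)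

theorem det' (h : IsFrameOn e U) {x : Coord} (hx : x ∈ U) :
    e 0 0 x * e 1 1 x - e 0 1 x * e 1 0 x ≠ 0 := by
  have := h.det x hx
  rwa [Matrix.det_fin_two] at this

theorem coframe_mul (h : IsFrameOn e U) {x : Coord} (hx : x ∈ U) (a b : Fin 2) :
    coframe e a 0 x * e b 0 x + coframe e a 1 x * e b 1 x = if a = b then 1 else 0 := by
  have hu : IsUnit (Matrix.of fun b ν => e b ν x).det := (h.det x hx).isUnit
  have := congrFun (congrFun (Matrix.mul_nonsing_inv _ hu) b) a
  rw [Matrix.mul_apply, Fin.sum_univ_two, Matrix.one_apply] at this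
  simp only [coframe]
  rw [← if_congr (eq_comm (a := b) (b := a)) rfl rfl, ← this]
  simp only [Matrix.of_apply]
  ring

theorem coframe_mul' (h : IsFrameOn e U) {x : Coord} (hx : x ∈ U) (μ ν : Fin 2) :
    coframe e 0 μ x * e 0 ν x + coframe e 1 μ x * e 1 ν x = if μ = ν then 1 else 0 := by
  have hu : IsUnit (Matrix.of fun b ν => e b ν x).det := (h.det x hx).isUnit
  have := congrFun (congrFun (Matrix.nonsing_inv_mul _ hu) μ) ν
  rw [Matrix.mul_apply, Fin.sum_univ_two, Matrix.one_apply] at this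
  exact this

theorem coframe_smooth (h : IsFrameOn e U) (a μ : Fin 2) : ContDiffOn ℝ ∞ (coframe e a μ) U := by
  have hdet : ContDiffOn ℝ ∞ (fun x => e 0 0 x * e 1 1 x - e 0 1 x * e 1 0 x) U :=
    ((h.smooth 0 0).mul (h.smooth 1 1)).sub ((h.smooth 0 1).mul (h.smooth 1 0))
  have hinv := hdet.inv fun x hx => h.det' hx
  have key : ∀ x, coframe e a μ x = (e 0 0 x * e 1 1 x - e 0 1 x * e 1 0 x)⁻¹ *
      !![e 1 1 x, - e 0 1 x; -e 1 0 x, e 0 0 x] μ a := by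
    intro x
    rw [coframe, Matrix.inv_def, Matrix.adjugate_fin_two, Matrix.det_fin_two,
      Ring.inverse_eq_inv']
    rfl
  rw [show coframe e a μ = _ from funext key]
  refine hinv.mul ?_
  fin_cases a <;> fin_cases μ
  · exact h.smooth 1 1
  · exact (h.smooth 1 0).neg
  · exact (h.smooth 0 1).neg
  · exact h.smooth 0 0

theorem structC_smooth (h : IsFrameOn e U) (d : Fin 2) : ContDiffOn ℝ ∞ (structC e d) U := by
  refine ContDiffOn.sum fun μ _ => (h.coframe_smooth d μ).mul (ContDiffOn.sum fun ν _ => ?_)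
  exact ((h.smooth 0 ν).mul (smoothOn_pd h.isOpen (h.smooth 1 μ) ν)).sub
    ((h.smooth 1 ν).mul (smoothOn_pd h.isOpen (h.smooth 0 μ) ν))

/-- The frame components of the derivative of the frame, `e^a (∂_μ e_b)`. -/
def _root_.DiracSymmetry.frameDer (e : Fin 2 → Fin 2 → Coord → ℝ) (a b μ : Fin 2) (x : Coord) : ℝ :=
  coframe e a 0 x * pd μ (e b 0) x + coframe e a 1 x * pd μ (e b 1) x

theorem pd_coframe (h : IsFrameOn e U) {x : Coord} (hx : x ∈ U) (a b μ : Fin 2) :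
    pd μ (coframe e a 0) x * e b 0 x + pd μ (coframe e a 1) x * e b 1 x = - frameDer e a b μ x := by
  have hd : ∀ ν, DifferentiableAt ℝ (coframe e a ν) x := fun ν =>
    differentiableAt_of_smoothOn h.isOpen (h.coframe_smooth a ν) hx
  have he : ∀ ν, DifferentiableAt ℝ (e b ν) x := fun ν =>
    differentiableAt_of_smoothOn h.isOpen (h.smooth b ν) hx
  have h1 := pd_congr h.isOpen (fun y hy => h.coframe_mul hy a b) μ hx
  rw [pd_const, pd_add ((hd 0).fun_mul (he 0)) ((hd 1).fun_mul (he 1)), pd_mul (hd 0) (he 0),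
    pd_mul (hd 1) (he 1)] at h1
  rw [frameDer]
  linear_combination h1

variable (c : DiracMatrices)

theorem pd_metric (h : IsFrameOn e U) {x : Coord} (hx : x ∈ U) (κ β μ : Fin 2) :
    pd μ (c.metric e κ β) x =
      c.η 0 * (pd μ (coframe e 0 κ) x * coframe e 0 β x + coframe e 0 κ x * pd μ (coframe e 0 β) x) +
      c.η 1 * (pd μ (coframe e 1 κ) x * coframe e 1 β x
        + coframe e 1 κ x * pd μ (coframe e 1 β) x) := by
  have hd : ∀ a ν, DifferentiableAt ℝ (coframe e a ν) x := fun a ν =>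
    differentiableAt_of_smoothOn h.isOpen (h.coframe_smooth a ν) hx
  have : c.metric e κ β = fun y => c.η 0 * (coframe e 0 κ y * coframe e 0 β y) +
      c.η 1 * (coframe e 1 κ y * coframe e 1 β y) := by
    funext y
    rw [metric, Fin.sum_univ_two]
    ring
  rw [this, pd_add (((hd 0 κ).fun_mul (hd 0 β)).const_mul _)
      (((hd 1 κ).fun_mul (hd 1 β)).const_mul _),
    pd_mul (differentiableAt_const _) ((hd 0 κ).fun_mul (hd 0 β)),
    pd_mul (differentiableAt_const _) ((hd 1 κ).fun_mul (hd 1 β)), pd_mul (hd 0 κ) (hd 0 β),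
    pd_mul (hd 1 κ) (hd 1 β), pd_const, pd_const]
  ring

theorem frame_pd_metric (h : IsFrameOn e U) {x : Coord} (hx : x ∈ U) (a b μ : Fin 2) :
    ∑ κ, ∑ β, e a κ x * e b β x * pd μ (c.metric e κ β) x =
      -(c.η b * frameDer e b a μ x + c.η a * frameDer e a b μ x) := by
  have h1 := h.coframe_mul hx
  have h2 := h.pd_coframe hx (μ := μ)
  have key : ∑ κ, ∑ β, e a κ x * e b β x * pd μ (c.metric e κ β) x =
      ∑ d, c.η d * ((pd μ (coframe e d 0) x * e a 0 x + pd μ (coframe e d 1) x * e a 1 x) *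
        (coframe e d 0 x * e b 0 x + coframe e d 1 x * e b 1 x) +
        (coframe e d 0 x * e a 0 x + coframe e d 1 x * e a 1 x) *
        (pd μ (coframe e d 0) x * e b 0 x + pd μ (coframe e d 1) x * e b 1 x)) := by
    simp only [Fin.sum_univ_two, h.pd_metric c hx]
    ring
  rw [key]
  simp only [h1, h2, mul_ite, ite_mul, mul_one, one_mul, mul_zero, zero_mul, mul_add,
    Finset.sum_add_distrib, Finset.sum_ite_eq', Finset.mem_univ, if_true]
  ring

/-- The frame components of `frameDer`. -/
def _root_.DiracSymmetry.frameDer₃ (e : Fin 2 → Fin 2 → Coord → ℝ) (a b d : Fin 2) (x : Coord) : ℝ :=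
  e d 0 x * frameDer e a b 0 x + e d 1 x * frameDer e a b 1 x

/-- The Koszul formula in an orthonormal frame: the metric components in the frame are constant, so
each derivative of the coordinate metric is expressed by derivatives of the frame. -/
theorem frame_spinConn (h : IsFrameOn e U) {x : Coord} (hx : x ∈ U) (a b d : Fin 2) :
    e d 0 x * c.spinConn e a b 0 x + e d 1 x * c.spinConn e a b 1 x =
      1 / 2 * c.η a * c.η b *
        (-(c.η d * frameDer₃ e d a b x + c.η a * frameDer₃ e a d b x)
          - (c.η b * frameDer₃ e b a d x + c.η a * frameDer₃ e a b d x)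
          + (c.η d * frameDer₃ e d b a x + c.η b * frameDer₃ e b d a x))
        + c.η b * frameDer₃ e a b d x := by
  have h1 := h.coframe_mul hx
  have hT := h.frame_pd_metric c hx
  have hg : ∀ κ, coframe e a 0 x * c.invMetric e 0 κ x + coframe e a 1 x * c.invMetric e 1 κ x
      = c.η a * e a κ x := by
    intro κ
    have : coframe e a 0 x * c.invMetric e 0 κ x + coframe e a 1 x * c.invMetric e 1 κ x =
        ∑ f, c.η f * (coframe e a 0 x * e f 0 x + coframe e a 1 x * e f 1 x) * e f κ x := by
      simp only [invMetric, Fin.sum_univ_two]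
      ring
    rw [this]
    simp only [h1, mul_ite, ite_mul, mul_one, mul_zero, zero_mul, Finset.sum_ite_eq,
      Finset.mem_univ, if_true]
  have hs : ∀ μ, c.spinConn e a b μ x = 1 / 2 * c.η b * ∑ κ,
      (coframe e a 0 x * c.invMetric e 0 κ x + coframe e a 1 x * c.invMetric e 1 κ x) *
      (∑ β, e b β x * (pd β (c.metric e κ μ) x + pd μ (c.metric e κ β) x
        - pd κ (c.metric e β μ) x)) + c.η b * frameDer e a b μ x := by
    intro μ
    simp only [spinConn, christoffel, frameDer, Fin.sum_univ_two]
    ring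
  have t1 := hT a d
  have t2 := hT a b
  have t3 := hT b d
  simp only [Fin.sum_univ_two] at t1 t2 t3
  rw [hs, hs]
  simp only [hg, frameDer₃, Fin.sum_univ_two]
  linear_combination 1 / 2 * c.η a * c.η b * (e b 0 x * t1 0 + e b 1 x * t1 1 + e d 0 x * t2 0
    + e d 1 x * t2 1 - e a 0 x * t3 0 - e a 1 x * t3 1)

end IsFrameOn

theorem DiracMatrices.η_mul_self (c : DiracMatrices) (a : Fin 2) : c.η a * c.η a = 1 := by
  rcases c.η_sign a with h | h <;> rw [h] <;> norm_num

theorem structC_eq (e : Fin 2 → Fin 2 → Coord → ℝ) (d : Fin 2) (x : Coord) :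
    structC e d x = frameDer₃ e d 1 0 x - frameDer₃ e d 0 1 x := by
  simp only [structC, frameDer₃, frameDer, Fin.sum_univ_two]
  ring

namespace IsFrameOn

variable {e : Fin 2 → Fin 2 → Coord → ℝ} {U : Set Coord} (c : DiracMatrices)

theorem spinConn_self (h : IsFrameOn e U) {x : Coord} (hx : x ∈ U) (a d : Fin 2) :
    e d 0 x * c.spinConn e a a 0 x + e d 1 x * c.spinConn e a a 1 x = 0 := by
  rw [h.frame_spinConn c hx]
  linear_combination -c.η a * frameDer₃ e a a d x * c.η_mul_self a

/-- In dimension two the connection has a single independent component, and absence of torsion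
determines it from the bracket of the frame vectors. -/
theorem spinConn_01 (h : IsFrameOn e U) {x : Coord} (hx : x ∈ U) (d : Fin 2) :
    e d 0 x * c.spinConn e 0 1 0 x + e d 1 x * c.spinConn e 0 1 1 x =
      c.η 0 * c.η 1 * c.η d * structC e d x := by
  rw [h.frame_spinConn c hx, structC_eq]
  have h0 := c.η_mul_self 0
  fin_cases d <;> simp only [Fin.zero_eta, Fin.mk_one]
  · linear_combination -c.η 1 * frameDer₃ e 0 1 0 x * h0
  · linear_combination -c.η 1 * frameDer₃ e 0 1 1 x * h0

theorem spinConn_10 (h : IsFrameOn e U) {x : Coord} (hx : x ∈ U) (d : Fin 2) :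
    e d 0 x * c.spinConn e 1 0 0 x + e d 1 x * c.spinConn e 1 0 1 x =
      -(c.η 0 * c.η 1 * c.η d * structC e d x) := by
  rw [← h.spinConn_01 c hx, h.frame_spinConn c hx, h.frame_spinConn c hx]
  linear_combination -c.η 1 * frameDer₃ e 0 1 d x * c.η_mul_self 0
    - c.η 0 * frameDer₃ e 1 0 d x * c.η_mul_self 1

end IsFrameOn

end DiracSymmetry

/-! ### Local Dirac data as an instance of the algebraic model -/

namespace DiracSymmetry

open TopologicalSpace

namespace DiracMatrices

variable (c : DiracMatrices)

theorem γ_sq (a : Fin 2) : c.γ a * c.γ a = (c.η a : ℂ) • (1 : Mat) := by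
  have h := c.clifford a a
  rw [if_pos rfl, ← two_smul ℂ, mul_smul] at h
  exact smul_right_injective Mat (two_ne_zero (α := ℂ)) h

theorem γ_anti : c.γ 1 * c.γ 0 = -(c.γ 0 * c.γ 1) := by
  have h := c.clifford 1 0
  rw [if_neg (by decide), zero_smul] at h
  exact eq_neg_of_add_eq_zero_left h

theorem γ₂_self (a : Fin 2) : c.γ₂ a a = 0 := by simp [γ₂]

theorem γ₂_01 : c.γ₂ 0 1 = c.γ 0 * c.γ 1 := by
  rw [γ₂, c.γ_anti]
  module

theorem γ₂_10 : c.γ₂ 1 0 = -(c.γ 0 * c.γ 1) := by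
  rw [γ₂, c.γ_anti]
  module

/-- `i γ^a`, the coefficients of the Dirac operator. -/
def ig (a : Fin 2) : Mat := Complex.I • c.γup a

theorem ηC_mul_self (a : Fin 2) : (c.η a : ℂ) * c.η a = 1 := by
  rw [← Complex.ofReal_mul, c.η_mul_self, Complex.ofReal_one]

theorem ig_sq (a : Fin 2) : c.ig a * c.ig a = (-(c.η a : ℂ)) • (1 : Mat) := by
  simp only [ig, γup, Matrix.smul_mul, Matrix.mul_smul, c.γ_sq, smul_smul]
  congr 1
  linear_combination c.η a * c.η a * c.η a * Complex.I_mul_I - (c.η a : ℂ) * c.ηC_mul_self a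

theorem ig_anti : c.ig 1 * c.ig 0 = -(c.ig 0 * c.ig 1) := by
  simp only [ig, γup, Matrix.smul_mul, Matrix.mul_smul, c.γ_anti]
  module

theorem ig_mul : c.ig 0 * c.ig 1 = (-(c.η 0 * c.η 1 : ℂ)) • (c.γ 0 * c.γ 1) := by
  simp only [ig, γup, Matrix.smul_mul, Matrix.mul_smul, smul_smul]
  congr 1
  linear_combination c.η 0 * c.η 1 * Complex.I_mul_I

end DiracMatrices

/-- The matrix over `Sm U` given by a smooth matrix-valued function. -/
def smMat {U : Opens Coord} (N : Coord → Mat) (hN : SmoothMatOn N U) :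
    Matrix (Fin 2) (Fin 2) (Sm U) :=
  Matrix.of fun r s => Sm.mk (fun y => N y r s) (hN r s)

/-- The data on an open subset of the coordinate space that define a Dirac operator. -/
structure LocalData (c : DiracMatrices) where
  U : Opens Coord
  e : Fin 2 → Fin 2 → Coord → ℝ
  isFrame : IsFrameOn e U
  q : ℝ
  A : Fin 2 → Coord → ℝ
  A_smooth : ∀ μ, ContDiffOn ℝ ∞ (A μ) U
  V : Coord → Mat
  V_smooth : SmoothMatOn V U

namespace LocalData

variable {c : DiracMatrices} (L : LocalData c)

/-- The frame as a matrix over `Sm U`. -/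
def eS (a μ : Fin 2) : Sm L.U :=
  Sm.mk (fun y => (L.e a μ y : ℂ)) (smoothOn_ofReal (L.isFrame.smooth a μ))

/-- The structure functions as elements of `Sm U`. -/
def CS (d : Fin 2) : Sm L.U :=
  Sm.mk (fun y => (structC L.e d y : ℂ)) (smoothOn_ofReal (L.isFrame.structC_smooth d))

/-- The derivations given by the frame vectors. -/
def δS (a : Fin 2) : Derivation ℂ (Sm L.U) (Sm L.U) :=
  L.eS a 0 • Sm.pdS 0 + L.eS a 1 • Sm.pdS 1

theorem δS_apply (a : Fin 2) (f : Sm L.U) :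
    L.δS a f = L.eS a 0 * Sm.pdS 0 f + L.eS a 1 * Sm.pdS 1 f := rfl

theorem structC_smul_frame (μ : Fin 2) :
    L.eS 0 0 * Sm.pdS 0 (L.eS 1 μ) + L.eS 0 1 * Sm.pdS 1 (L.eS 1 μ)
      - (L.eS 1 0 * Sm.pdS 0 (L.eS 0 μ) + L.eS 1 1 * Sm.pdS 1 (L.eS 0 μ))
      = L.CS 0 * L.eS 0 μ + L.CS 1 * L.eS 1 μ := by
  refine Sm.eq_of_ev fun y => ?_
  have hd : ∀ a ν, DifferentiableAt ℝ (L.e a ν) y := fun a ν =>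
    differentiableAt_of_smoothOn L.U.2 (L.isFrame.smooth a ν) y.2
  have h0 := L.isFrame.coframe_mul' y.2 0 μ
  have h1 := L.isFrame.coframe_mul' y.2 1 μ
  simp only [eS, CS, Sm.pdS_mk, map_add, map_sub, map_mul, Sm.ev_mk, pd_ofReal (hd _ _)]
  norm_cast
  simp only [structC, Fin.sum_univ_two]
  fin_cases μ <;> simp at h0 h1 ⊢
  · linear_combination -(L.e 0 0 y * pd 0 (L.e 1 0) y + L.e 0 1 y * pd 1 (L.e 1 0) y
      - (L.e 1 0 y * pd 0 (L.e 0 0) y + L.e 1 1 y * pd 1 (L.e 0 0) y)) * h0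
      - (L.e 0 0 y * pd 0 (L.e 1 1) y + L.e 0 1 y * pd 1 (L.e 1 1) y
      - (L.e 1 0 y * pd 0 (L.e 0 1) y + L.e 1 1 y * pd 1 (L.e 0 1) y)) * h1
  · linear_combination -(L.e 0 0 y * pd 0 (L.e 1 0) y + L.e 0 1 y * pd 1 (L.e 1 0) y
      - (L.e 1 0 y * pd 0 (L.e 0 0) y + L.e 1 1 y * pd 1 (L.e 0 0) y)) * h0
      - (L.e 0 0 y * pd 0 (L.e 1 1) y + L.e 0 1 y * pd 1 (L.e 1 1) y
      - (L.e 1 0 y * pd 0 (L.e 0 1) y + L.e 1 1 y * pd 1 (L.e 0 1) y)) * h1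

/-- The algebraic data of the Dirac operator. -/
def dc : DiracCalc (Sm L.U) where
  δ := L.δS
  C := L.CS
  comm f := by
    have h0 := L.structC_smul_frame 0
    have h1 := L.structC_smul_frame 1
    have h := Sm.pdS_comm 0 1 f
    simp only [δS_apply, map_add, Derivation.leibniz, smul_eq_mul]
    linear_combination Sm.pdS 0 f * h0 + Sm.pdS 1 f * h1
      + (L.eS 0 0 * L.eS 1 1 - L.eS 0 1 * L.eS 1 0) * h
  -- The sign is that of the square of i γ^a, which is -η^{aa}.
  κ a := algebraMap ℂ _ (-(c.η a : ℂ))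
  κ_sq a := by rw [← map_mul, neg_mul_neg, c.ηC_mul_self, map_one]
  δ_κ d a := Derivation.map_algebraMap _ _
  P a := (c.ig a).map (algebraMap ℂ _)
  P_sq a := by
    rw [← Matrix.map_mul, c.ig_sq]
    refine Matrix.ext fun r s => ?_
    rw [Matrix.map_apply, Matrix.smul_apply, Matrix.smul_apply, Matrix.one_apply,
      Matrix.one_apply, smul_eq_mul, smul_eq_mul, map_mul, apply_ite (algebraMap ℂ (Sm L.U)),
      map_one, map_zero]
  P_anti := by
    rw [← Matrix.map_mul, ← Matrix.map_mul, c.ig_anti]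
    refine Matrix.ext fun r s => ?_
    rw [Matrix.map_apply, Matrix.neg_apply, map_neg]
    rfl
  δ_P d a r s := Derivation.map_algebraMap _ _
  τ a := -(algebraMap ℂ _ (Complex.I * L.q) *
    (L.eS a 0 * Sm.mk (fun y => (L.A 0 y : ℂ)) (smoothOn_ofReal (L.A_smooth 0))
      + L.eS a 1 * Sm.mk (fun y => (L.A 1 y : ℂ)) (smoothOn_ofReal (L.A_smooth 1))))
  V := smMat L.V L.V_smooth

/-- `Ψ` represents the spinor field `ψ` on `U`. -/
def Rep (ψ : Coord → Spinor) (Ψ : Fin 2 → Sm L.U) : Prop :=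
  ∀ y : L.U, ∀ r, ψ y r = Sm.ev y (Ψ r)

variable {L}

theorem Rep.smooth {ψ : Coord → Spinor} {Ψ : Fin 2 → Sm L.U} (h : L.Rep ψ Ψ) :
    ContDiffOn ℝ ∞ ψ L.U := by
  rw [contDiffOn_pi]
  intro r
  exact (Sm.lift_smooth (Ψ r)).congr fun y hy => (h ⟨y, hy⟩ r).trans (Sm.lift_apply _ ⟨y, hy⟩).symm

theorem exists_rep {ψ : Coord → Spinor} (h : ContDiffOn ℝ ∞ ψ L.U) : ∃ Ψ, L.Rep ψ Ψ :=
  ⟨fun r => Sm.mk (fun y => ψ y r) (contDiffOn_pi.1 h r), fun _ _ => rfl⟩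

theorem exists_of_rep (Ψ : Fin 2 → Sm L.U) : ∃ ψ, L.Rep ψ Ψ :=
  ⟨fun y r => Sm.lift (Ψ r) y, fun y r => Sm.lift_apply (Ψ r) y⟩

theorem Rep.unique {ψ φ : Coord → Spinor} {Ψ : Fin 2 → Sm L.U} (h : L.Rep ψ Ψ) (h' : L.Rep φ Ψ)
    (y : Coord) (hy : y ∈ L.U) : ψ y = φ y :=
  funext fun r => (h ⟨y, hy⟩ r).trans (h' ⟨y, hy⟩ r).symm

theorem Rep.add {ψ φ : Coord → Spinor} {Ψ Φ : Fin 2 → Sm L.U} (h : L.Rep ψ Ψ) (h' : L.Rep φ Φ) :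
    L.Rep (fun y => ψ y + φ y) (Ψ + Φ) := fun y r => by
  simp [h y r, h' y r]

theorem Rep.sub {ψ φ : Coord → Spinor} {Ψ Φ : Fin 2 → Sm L.U} (h : L.Rep ψ Ψ) (h' : L.Rep φ Φ) :
    L.Rep (fun y => ψ y - φ y) (Ψ - Φ) := fun y r => by
  simp [h y r, h' y r]

theorem Rep.const_smul {ψ : Coord → Spinor} {Ψ : Fin 2 → Sm L.U} (h : L.Rep ψ Ψ) (z : ℂ) :
    L.Rep (fun y => z • ψ y) (z • Ψ) := fun y r => by
  change z • ψ y r = Sm.ev y (z • Ψ r)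
  rw [map_smul, h y r]

theorem Rep.sum {ψ : Fin 2 → Coord → Spinor} {Ψ : Fin 2 → Fin 2 → Sm L.U}
    (h : ∀ a, L.Rep (ψ a) (Ψ a)) : L.Rep (fun y => ∑ a, ψ a y) (∑ a, Ψ a) := fun y r => by
  simp [Fin.sum_univ_two, h 0 y r, h 1 y r]

theorem Rep.mulVec {ψ : Coord → Spinor} {Ψ : Fin 2 → Sm L.U} (h : L.Rep ψ Ψ) {N : Coord → Mat}
    {N' : Matrix (Fin 2) (Fin 2) (Sm L.U)} (hN : ∀ y : L.U, ∀ r s, N y r s = Sm.ev y (N' r s)) :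
    L.Rep (fun y => (N y).mulVec (ψ y)) (DiracCalc.m N' Ψ) := fun y r => by
  simp [DiracCalc.m_apply, Matrix.mulVec, dotProduct, Fin.sum_univ_two, h y _, hN y]

theorem Rep.smul {ψ : Coord → Spinor} {Ψ : Fin 2 → Sm L.U} (h : L.Rep ψ Ψ) {f : Coord → ℂ}
    {f' : Sm L.U} (hf : ∀ y : L.U, f y = Sm.ev y f') :
    L.Rep (fun y => f y • ψ y) (DiracCalc.m (f' • 1) Ψ) := fun y r => by
  rw [DiracCalc.m_apply, Matrix.smul_mulVec, Matrix.one_mulVec, Pi.smul_apply,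
    smul_eq_mul, map_mul, ← h y r, ← hf y]
  rfl

theorem ev_smMat {N : Coord → Mat} (hN : SmoothMatOn N L.U) (y : L.U) (r s : Fin 2) :
    N y r s = Sm.ev y (smMat N hN r s) := rfl

theorem Rep.congr {ψ φ : Coord → Spinor} {Ψ : Fin 2 → Sm L.U} (h : L.Rep ψ Ψ)
    (h' : ∀ y ∈ L.U, φ y = ψ y) : L.Rep φ Ψ := fun y r => by
  rw [h' y y.2, h y r]

theorem Rep.pd {ψ : Coord → Spinor} {Ψ : Fin 2 → Sm L.U} (h : L.Rep ψ Ψ) (μ : Fin 2) :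
    L.Rep (pd μ ψ) (fun r => Sm.pdS μ (Ψ r)) := fun y r => by
  have hr : Ψ r = Sm.mk (fun y => ψ y r) (contDiffOn_pi.1 h.smooth r) :=
    Sm.eq_of_ev fun z => (h z r).symm
  rw [pd_apply (differentiableAt_of_smoothOn L.U.2 h.smooth y.2)]
  change _ = Sm.ev y (Sm.pdS μ (Ψ r))
  rw [hr, Sm.pdS_mk]
  rfl

theorem ev_PP (y : L.U) (r s : Fin 2) : Sm.ev y ((L.dc.P 0 * L.dc.P 1) r s) =
    (-(c.η 0 * c.η 1 : ℂ)) * (c.γ 0 * c.γ 1) r s := by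
  rw [show L.dc.P 0 * L.dc.P 1 = (c.ig 0 * c.ig 1).map (algebraMap ℂ (Sm L.U)) from
    (Matrix.map_mul).symm, c.ig_mul, Matrix.map_apply, AlgHom.commutes]
  rfl

theorem ev_om (y : L.U) (a : Fin 2) : Sm.ev y (L.dc.om a) =
    -(1 / 2 : ℂ) * c.η a * structC L.e a y := by
  rw [DiracCalc.om, map_mul, map_mul, AlgHom.commutes,
    show Sm.ev y (L.dc.C a) = (structC L.e a y : ℂ) from rfl,
    show L.dc.κ a = algebraMap ℂ _ (-(c.η a : ℂ)) from rfl, AlgHom.commutes]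
  simp

theorem ev_τ (y : L.U) (a : Fin 2) : Sm.ev y (L.dc.τ a) =
    -(Complex.I * L.q * (L.e a 0 y * L.A 0 y + L.e a 1 y * L.A 1 y)) := by
  rw [show L.dc.τ a = -(algebraMap ℂ _ (Complex.I * L.q) *
    (L.eS a 0 * Sm.mk (fun y => (L.A 0 y : ℂ)) (smoothOn_ofReal (L.A_smooth 0))
      + L.eS a 1 * Sm.mk (fun y => (L.A 1 y : ℂ)) (smoothOn_ofReal (L.A_smooth 1)))) from rfl,
    map_neg, map_mul, map_add, map_mul, map_mul, AlgHom.commutes]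
  rfl

/-- The double sum over the spin connection reduces to twice the (0, 1) term. The result has the
shape of `DiracCalc.D`: a derivation, a multiple of γ₀ γ₁ and a scalar. -/
theorem frameD_eq (ψ : Coord → Spinor) (y : L.U) (a : Fin 2) :
    c.frameD L.e L.q L.A a ψ y = (L.e a 0 y : ℂ) • pd 0 ψ y + (L.e a 1 y : ℂ) • pd 1 ψ y +
      (((1 / 2 : ℂ) * (c.η 0 * c.η 1 * c.η a * structC L.e a y)) • (c.γ 0 * c.γ 1) -
        (Complex.I * L.q * (L.e a 0 y * L.A 0 y + L.e a 1 y * L.A 1 y)) • (1 : Mat)).mulVec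
          (ψ y) := by
  have s2 := congrArg (fun t : ℝ => (t : ℂ)) (L.isFrame.spinConn_01 c y.2 a)
  have s3 := congrArg (fun t : ℝ => (t : ℂ)) (L.isFrame.spinConn_10 c y.2 a)
  push_cast at s2 s3
  have key : ∀ (z : Spinor), ∑ μ, (L.e a μ y : ℂ) • ((1 / 4 : ℂ) • ∑ a, ∑ b,
      (c.spinConn L.e a b μ y : ℂ) • (c.γ₂ a b).mulVec z)
      = (1 / 4 : ℂ) • (((L.e a 0 y : ℂ) * c.spinConn L.e 0 1 0 y
          + (L.e a 1 y : ℂ) * c.spinConn L.e 0 1 1 y) • (c.γ 0 * c.γ 1).mulVec z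
        - ((L.e a 0 y : ℂ) * c.spinConn L.e 1 0 0 y
          + (L.e a 1 y : ℂ) * c.spinConn L.e 1 0 1 y) • (c.γ 0 * c.γ 1).mulVec z) := by
    intro z
    simp only [Fin.sum_univ_two, c.γ₂_self, c.γ₂_01, c.γ₂_10, Matrix.zero_mulVec, smul_zero,
      Matrix.neg_mulVec]
    module
  have e1 : c.frameD L.e L.q L.A a ψ y = (L.e a 0 y : ℂ) • pd 0 ψ y + (L.e a 1 y : ℂ) • pd 1 ψ y +
      (∑ μ, (L.e a μ y : ℂ) • ((1 / 4 : ℂ) • ∑ a, ∑ b,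
      (c.spinConn L.e a b μ y : ℂ) • (c.γ₂ a b).mulVec (ψ y)))
      - (Complex.I * L.q * (L.e a 0 y * L.A 0 y + L.e a 1 y * L.A 1 y)) • ψ y := by
    simp only [DiracMatrices.frameD, DiracMatrices.covD]
    rw [Fin.sum_univ_two, Fin.sum_univ_two (f := fun μ => (L.e a μ y : ℂ) • ((1 / 4 : ℂ) • _))]
    module
  rw [e1, key, s2, s3, Matrix.sub_mulVec, Matrix.smul_mulVec, Matrix.smul_mulVec,
    Matrix.one_mulVec]
  module

theorem Rep.frameD {ψ : Coord → Spinor} {Ψ : Fin 2 → Sm L.U} (h : L.Rep ψ Ψ) (a : Fin 2) :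
    L.Rep (c.frameD L.e L.q L.A a ψ) (L.dc.D a Ψ) := by
  have hE : ∀ μ, ∀ y : L.U, (L.e a μ y : ℂ) = Sm.ev y (L.eS a μ) := fun μ y => rfl
  have hN : ∀ y : L.U, ∀ r s, (((1 / 2 : ℂ) * (c.η 0 * c.η 1 * c.η a * structC L.e a y)) •
      (c.γ 0 * c.γ 1) - (Complex.I * L.q * (L.e a 0 y * L.A 0 y + L.e a 1 y * L.A 1 y)) •
      (1 : Mat)) r s = Sm.ev y (L.dc.M a r s) := by
    intro y r s
    rw [DiracCalc.M, Matrix.add_apply, Matrix.smul_apply, Matrix.smul_apply, map_add, smul_eq_mul,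
      smul_eq_mul, map_mul, map_mul, ev_PP, ev_om, ev_τ, Matrix.sub_apply, Matrix.smul_apply,
      Matrix.smul_apply, smul_eq_mul, smul_eq_mul, Matrix.one_apply, Matrix.one_apply]
    split_ifs <;> simp <;> ring
  have h1 := (((h.pd 0).smul (f := fun y => (L.e a 0 y : ℂ)) (hE 0)).add
    ((h.pd 1).smul (f := fun y => (L.e a 1 y : ℂ)) (hE 1))).add (h.mulVec (N := fun y =>
    ((1 / 2 : ℂ) * (c.η 0 * c.η 1 * c.η a * structC L.e a y)) • (c.γ 0 * c.γ 1) -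
    (Complex.I * L.q * (L.e a 0 y * L.A 0 y + L.e a 1 y * L.A 1 y)) • (1 : Mat)) hN)
  have h2 := h1.congr (φ := c.frameD L.e L.q L.A a ψ) fun y hy => frameD_eq ψ ⟨y, hy⟩ a
  convert h2 using 1
  rw [DiracCalc.D, LinearMap.add_apply]
  congr 1
  funext r
  rw [Pi.add_apply, DiracCalc.m_apply, DiracCalc.m_apply, Matrix.smul_mulVec, Matrix.smul_mulVec,
    Matrix.one_mulVec, Matrix.one_mulVec]
  rfl

end LocalData

end DiracSymmetry

/-! ### Second-order operators in the algebraic model -/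

namespace DiracSymmetry

open TopologicalSpace

namespace LocalData

variable {c : DiracMatrices} (L : LocalData c)

/-- The Dirac operator of the local data. -/
def dirac (ψ : Coord → Spinor) (x : Coord) : Spinor :=
  Complex.I • ∑ a, (c.γup a).mulVec (c.frameD L.e L.q L.A a ψ x) - (L.V x).mulVec (ψ x)

/-- The operator `E^{ab} D_ab + F^a D_a + G`. -/
def act (E : Fin 2 → Fin 2 → Coord → Mat) (F : Fin 2 → Coord → Mat) (G : Coord → Mat)
    (ψ : Coord → Spinor) (x : Coord) : Spinor :=
  (∑ a, ∑ b, (E a b x).mulVec (c.symDD L.e L.q L.A a b ψ x))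
    + (∑ a, (F a x).mulVec (c.frameD L.e L.q L.A a ψ x)) + (G x).mulVec (ψ x)

variable {L}

theorem frame_conn (y : L.U) (d b a : Fin 2) :
    ((∑ μ, L.e a μ y * c.spinConnMixed L.e d b μ y : ℝ) : ℂ) = Sm.ev y (L.dc.conn d b a) := by
  have hκ : ∀ a, Sm.ev y (L.dc.κ a) = -(c.η a : ℂ) := fun a => by
    rw [show L.dc.κ a = algebraMap ℂ _ (-(c.η a : ℂ)) from rfl, AlgHom.commutes]
    rfl
  have s0 := L.isFrame.spinConn_self c y.2 d a
  have s2 := L.isFrame.spinConn_01 c y.2 a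
  have s3 := L.isFrame.spinConn_10 c y.2 a
  have h0 := c.η_mul_self 0
  have h1 := c.η_mul_self 1
  have e : ∑ μ, L.e a μ y * c.spinConnMixed L.e d b μ y =
      c.η b * (L.e a 0 y * c.spinConn L.e d b 0 y + L.e a 1 y * c.spinConn L.e d b 1 y) := by
    simp only [DiracMatrices.spinConnMixed, Fin.sum_univ_two]
    ring
  rw [e, DiracCalc.conn]
  by_cases hdb : d = b
  · subst hdb
    rw [s0, if_pos rfl, map_zero, mul_zero, Complex.ofReal_zero]
  · rw [if_neg hdb]
    have hd : ∀ d b : Fin 2, d ≠ b → (d = 0 ∧ b = 1) ∨ (d = 1 ∧ b = 0) := by decide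
    rcases hd d b hdb with ⟨rfl, rfl⟩ | ⟨rfl, rfl⟩
    · rw [if_pos rfl, s2, map_mul, map_mul, hκ, ev_om, map_ofNat]
      have h1' := c.ηC_mul_self 1
      push_cast
      linear_combination (c.η 0 * c.η a * structC L.e a y : ℂ) * h1'
    · rw [if_neg one_ne_zero, s3, map_neg, map_mul, map_mul, hκ, ev_om, map_ofNat]
      have h1' := c.ηC_mul_self 0
      push_cast
      linear_combination -(c.η 1 * c.η a * structC L.e a y : ℂ) * h1'

theorem Rep.frameDD {ψ : Coord → Spinor} {Ψ : Fin 2 → Sm L.U} (h : L.Rep ψ Ψ) (a b : Fin 2) :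
    L.Rep (c.frameDD L.e L.q L.A a b ψ) (L.dc.DD a b Ψ) := by
  have h1 := ((h.frameD b).frameD a).sub (Rep.sum fun d => (h.frameD d).smul
    (f := fun y => ((∑ μ, L.e a μ y * c.spinConnMixed L.e d b μ y : ℝ) : ℂ))
    fun y => frame_conn y d b a)
  have h2 := h1.congr (φ := c.frameDD L.e L.q L.A a b ψ) fun y _ => by
    simp only [DiracMatrices.frameDD, Fin.sum_univ_two]
    push_cast
    module
  convert h2 using 1
  simp only [DiracCalc.DD, LinearMap.sub_apply, Module.End.mul_apply, LinearMap.sum_apply]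

theorem Rep.symDD {ψ : Coord → Spinor} {Ψ : Fin 2 → Sm L.U} (h : L.Rep ψ Ψ) (a b : Fin 2) :
    L.Rep (c.symDD L.e L.q L.A a b ψ) (L.dc.symDD a b Ψ) :=
  ((h.frameDD a b).add (h.frameDD b a)).const_smul (1 / 2)

theorem Rep.dirac {ψ : Coord → Spinor} {Ψ : Fin 2 → Sm L.U} (h : L.Rep ψ Ψ) :
    L.Rep (L.dirac ψ) (L.dc.dirac Ψ) := by
  have hP : ∀ (a : Fin 2) (y : L.U) (r s : Fin 2), c.ig a r s = Sm.ev y (L.dc.P a r s) :=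
    fun a y r s => (AlgHom.commutes (Sm.ev y) _).symm
  have h1 := (((h.frameD 0).mulVec (N := fun _ => c.ig 0) (hP 0)).add
    ((h.frameD 1).mulVec (N := fun _ => c.ig 1) (hP 1))).sub
    (h.mulVec (N := L.V) (ev_smMat L.V_smooth))
  exact h1.congr (φ := L.dirac ψ) fun y _ => by
    simp only [LocalData.dirac, DiracMatrices.ig, Fin.sum_univ_two, smul_add, Matrix.smul_mulVec]

variable {E : Fin 2 → Fin 2 → Coord → Mat} {F : Fin 2 → Coord → Mat} {G : Coord → Mat}
  (hE : ∀ a b, SmoothMatOn (E a b) L.U) (hF : ∀ a, SmoothMatOn (F a) L.U)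
  (hG : SmoothMatOn G L.U)

theorem Rep.act {ψ : Coord → Spinor} {Ψ : Fin 2 → Sm L.U} (h : L.Rep ψ Ψ) :
    L.Rep (L.act E F G ψ) (L.dc.opK (fun a b => smMat (E a b) (hE a b))
      (fun a => smMat (F a) (hF a)) (smMat G hG) Ψ) := by
  have h1 := ((Rep.sum fun a => Rep.sum fun b => (h.symDD a b).mulVec (ev_smMat (hE a b))).add
    (Rep.sum fun a => (h.frameD a).mulVec (ev_smMat (hF a)))).add (h.mulVec (ev_smMat hG))
  rw [DiracCalc.opK, LinearMap.add_apply, LinearMap.add_apply, LinearMap.sum_apply,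
    LinearMap.sum_apply]
  simp only [LinearMap.sum_apply]
  exact h1

/-- Every tuple over `Sm L.U` comes from a smooth local spinor, so commutation on spinors becomes an
identity in the operator ring, to which the commutator calculus applies. -/
theorem commute_of_symmetry
    (h : ∀ ψ : Coord → Spinor, ContDiffOn ℝ ∞ ψ L.U → ∀ x ∈ L.U,
      L.act E F G (L.dirac ψ) x = L.dirac (L.act E F G ψ) x) :
    L.dc.opK (fun a b => smMat (E a b) (hE a b)) (fun a => smMat (F a) (hF a)) (smMat G hG) *
      L.dc.dirac = L.dc.dirac *
      L.dc.opK (fun a b => smMat (E a b) (hE a b)) (fun a => smMat (F a) (hF a)) (smMat G hG) := by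
  refine LinearMap.ext fun Ψ => funext fun r => Sm.eq_of_ev fun y => ?_
  obtain ⟨ψ, hψ⟩ := exists_of_rep (L := L) Ψ
  have h1 := hψ.dirac.act hE hF hG y r
  have h2 := (hψ.act hE hF hG).dirac y r
  rw [Module.End.mul_apply, Module.End.mul_apply, ← h1, ← h2, h ψ hψ.smooth y y.2]

end LocalData

end DiracSymmetry

/-! ### Clifford algebra: the shape of a symbol -/

namespace DiracSymmetry

namespace DiracMatrices

variable (c : DiracMatrices)

theorem eq_zero_of_eq_neg {x : ℂ} (h : x = -x) : x = 0 := by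
  linear_combination (1 / 2 : ℂ) * h

theorem trace_ig_mul : (c.ig 0 * c.ig 1).trace = 0 := by
  apply eq_zero_of_eq_neg
  rw [← Matrix.trace_neg, ← c.ig_anti, Matrix.trace_mul_comm]

theorem η_ne_zero (a : Fin 2) : (c.η a : ℂ) ≠ 0 := fun h => by
  have := c.ηC_mul_self a
  rw [h] at this
  simp at this

theorem ig_sq_mul (a : Fin 2) (Z : Mat) : c.ig a * (c.ig a * Z) = (-(c.η a : ℂ)) • Z := by
  rw [← mul_assoc, c.ig_sq, Matrix.smul_mul, one_mul]

theorem ig_anti_mul (Z : Mat) : c.ig 1 * (c.ig 0 * Z) = -(c.ig 0 * (c.ig 1 * Z)) := by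
  rw [← mul_assoc, c.ig_anti, neg_mul, mul_assoc]

theorem trace_ig (a : Fin 2) : (c.ig a).trace = 0 := by
  have key : ∀ b d : Fin 2, c.ig b * c.ig d = -(c.ig d * c.ig b) → (c.ig d).trace = 0 := by
    intro b d h
    apply eq_zero_of_eq_neg
    have h1 := c.ig_sq_mul b (c.ig d)
    have h2 : (c.ig b * (c.ig b * c.ig d)).trace = -(c.ig b * (c.ig b * c.ig d)).trace := by
      conv_lhs => rw [Matrix.trace_mul_comm, h]
      rw [neg_mul, Matrix.trace_neg, mul_assoc, c.ig_sq, Matrix.mul_smul, mul_one, h1]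
    rw [h1, Matrix.trace_smul, smul_eq_mul, ← mul_neg] at h2
    exact mul_left_cancel₀ (neg_ne_zero.2 (c.η_ne_zero b)) h2
  fin_cases a
  · exact key 1 0 c.ig_anti
  · exact key 0 1 (by rw [c.ig_anti, neg_neg])

/-- The combination of the basis of the matrix algebra given by the Dirac matrices. -/
def comb (x y z u : ℂ) : Mat :=
  x • (1 : Mat) + y • c.ig 0 + z • c.ig 1 + u • (c.ig 0 * c.ig 1)

theorem trace_comb (x y z u : ℂ) : (c.comb x y z u).trace = 2 * x := by
  simp only [comb, Matrix.trace_add, Matrix.trace_smul, c.trace_ig, c.trace_ig_mul,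
    Matrix.trace_one, Fintype.card_fin, smul_eq_mul]
  push_cast
  ring

theorem ig0_mul_comb (x y z u : ℂ) :
    c.ig 0 * c.comb x y z u = c.comb (-c.η 0 * y) x (-c.η 0 * u) z := by
  simp only [comb, mul_add, Matrix.mul_smul, mul_one, c.ig_sq, c.ig_sq_mul]
  module

theorem ig1_mul_comb (x y z u : ℂ) :
    c.ig 1 * c.comb x y z u = c.comb (-c.η 1 * z) (c.η 1 * u) x (-y) := by
  simp only [comb, mul_add, Matrix.mul_smul, mul_one, c.ig_sq, c.ig_anti, c.ig_anti_mul]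
  module

theorem comb_mul_ig0 (x y z u : ℂ) :
    c.comb x y z u * c.ig 0 = c.comb (-c.η 0 * y) x (c.η 0 * u) (-z) := by
  simp only [comb, add_mul, Matrix.smul_mul, one_mul, c.ig_sq, c.ig_anti, mul_assoc, mul_neg,
    c.ig_sq_mul]
  module

theorem comb_mul_ig1 (x y z u : ℂ) :
    c.comb x y z u * c.ig 1 = c.comb (-c.η 1 * z) (-c.η 1 * u) x y := by
  simp only [comb, add_mul, Matrix.smul_mul, one_mul, c.ig_sq, mul_assoc, Matrix.mul_smul, mul_one]
  module

/-- Only the unit among the four basis elements has nonzero trace, and left multiplication by each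
of the others moves its own coefficient onto the unit. -/
theorem comb_eq_zero {x y z u : ℂ} (h : c.comb x y z u = 0) : x = 0 ∧ y = 0 ∧ z = 0 ∧ u = 0 := by
  have h0 := c.η_ne_zero 0
  have h1 := c.η_ne_zero 1
  have ha := c.trace_comb x y z u
  have hb := congrArg (c.ig 0 * ·) h
  have hc := congrArg (c.ig 1 * ·) h
  have hd := congrArg (c.ig 0 * ·) hc
  simp only [ig0_mul_comb, ig1_mul_comb, mul_zero] at hb hc hd
  have tb := congrArg Matrix.trace hb
  have tc := congrArg Matrix.trace hc
  have td := congrArg Matrix.trace hd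
  rw [h] at ha
  rw [trace_comb] at tb tc td
  simp [h0, h1] at ha tb tc td
  exact ⟨ha, tb, tc, td⟩

theorem comb_injective {x y z u x' y' z' u' : ℂ} (h : c.comb x y z u = c.comb x' y' z' u') :
    x = x' ∧ y = y' ∧ z = z' ∧ u = u' := by
  have h' : c.comb (x - x') (y - y') (z - z') (u - u') = 0 := by
    rw [← sub_eq_zero] at h
    rw [← h, comb, comb, comb]
    module
  simpa only [sub_eq_zero] using c.comb_eq_zero h'

/-- Four independent elements of a space of dimension four span it. -/
theorem exists_comb (N : Mat) : ∃ x y z u, N = c.comb x y z u := by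
  let T : (Fin 4 → ℂ) →ₗ[ℂ] Mat :=
    { toFun := fun v => c.comb (v 0) (v 1) (v 2) (v 3)
      map_add' := fun v w => by simp only [comb, Pi.add_apply]; module
      map_smul' := fun r v => by simp only [comb, Pi.smul_apply, RingHom.id_apply, smul_eq_mul]; module }
  have hinj : Function.Injective T := by
    intro v w h
    obtain ⟨h0, h1, h2, h3⟩ := c.comb_injective h
    funext i
    fin_cases i
    exacts [h0, h1, h2, h3]
  have hsurj := (LinearMap.injective_iff_surjective_of_finrank_eq_finrank (f := T)
    (by simp [Module.finrank_matrix])).1 hinj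
  obtain ⟨v, hv⟩ := hsurj N
  exact ⟨_, _, _, _, hv.symm⟩

theorem comb_add (x y z u x' y' z' u' : ℂ) :
    c.comb x y z u + c.comb x' y' z' u' = c.comb (x + x') (y + y') (z + z') (u + u') := by
  rw [comb, comb, comb]
  module

theorem commute_both {N : Mat} (h₀ : N * c.ig 0 = c.ig 0 * N) (h₁ : N * c.ig 1 = c.ig 1 * N) :
    N = ((1 / 2 : ℂ) * N.trace) • (1 : Mat) := by
  obtain ⟨x, y, z, u, rfl⟩ := c.exists_comb N
  rw [comb_mul_ig0, ig0_mul_comb] at h₀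
  rw [comb_mul_ig1, ig1_mul_comb] at h₁
  obtain ⟨-, -, a1, a2⟩ := c.comb_injective h₀
  obtain ⟨-, -, -, b1⟩ := c.comb_injective h₁
  have h0 := c.η_ne_zero 0
  have hz : z = 0 := eq_zero_of_eq_neg a2.symm
  have hy : y = 0 := eq_zero_of_eq_neg b1
  have hu : u = 0 := by
    apply eq_zero_of_eq_neg
    apply mul_left_cancel₀ h0
    linear_combination a1
  rw [trace_comb, hy, hz, hu, comb]
  module

theorem commute_ig0 {N : Mat} (h : N * c.ig 0 = c.ig 0 * N) : ∃ x y, N = c.comb x y 0 0 := by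
  obtain ⟨x, y, z, u, rfl⟩ := c.exists_comb N
  rw [comb_mul_ig0, ig0_mul_comb] at h
  obtain ⟨-, -, a1, a2⟩ := c.comb_injective h
  have h0 := c.η_ne_zero 0
  have hz : z = 0 := eq_zero_of_eq_neg a2.symm
  have hu : u = 0 := by
    apply eq_zero_of_eq_neg
    apply mul_left_cancel₀ h0
    linear_combination a1
  exact ⟨x, y, by rw [hz, hu]⟩

theorem commute_ig1 {N : Mat} (h : N * c.ig 1 = c.ig 1 * N) : ∃ x z, N = c.comb x 0 z 0 := by
  obtain ⟨x, y, z, u, rfl⟩ := c.exists_comb N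
  rw [comb_mul_ig1, ig1_mul_comb] at h
  obtain ⟨-, a1, -, a2⟩ := c.comb_injective h
  have h0 := c.η_ne_zero 1
  have hy : y = 0 := eq_zero_of_eq_neg a2
  have hu : u = 0 := by
    apply eq_zero_of_eq_neg
    apply mul_left_cancel₀ h0
    linear_combination -a1
  exact ⟨x, z, by rw [hy, hu]⟩

/-- The scalar `t` in the symbol `w^a + t i γ^a` of an operator of first order. -/
def scalPart (F : Fin 2 → Mat) : ℂ :=
  (-Complex.I / 4) * ∑ b, (c.γ b * F b).trace

/-- The vector `w^a` in the symbol `w^a + t i γ^a` of an operator of first order. -/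
def vecPart₁ (F : Fin 2 → Mat) (a : Fin 2) : ℂ := (1 / 2) * (F a).trace

/-- The vector `a^c` in the symbol `e^{ab} + a^{(a} i γ^{b)}` of an operator of second order. -/
def vecPart₂ (E : Fin 2 → Fin 2 → Mat) (a : Fin 2) : ℂ :=
  (-Complex.I / 6) * ∑ b, (c.γ b * (E a b + E b a)).trace

/-- The tensor `e^{ab}` in the symbol `e^{ab} + a^{(a} i γ^{b)}` of an operator of second order. -/
def tenPart (E : Fin 2 → Fin 2 → Mat) (a b : Fin 2) : ℂ := (1 / 4) * (E a b + E b a).trace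

theorem γ_eq_ig (a : Fin 2) : c.γ a = (-Complex.I * c.η a) • c.ig a := by
  rw [ig, γup, smul_smul, smul_smul]
  have : -Complex.I * c.η a * (Complex.I * c.η a) = 1 := by
    linear_combination -(c.η a * c.η a : ℂ) * Complex.I_mul_I + c.ηC_mul_self a
  rw [mul_assoc (-Complex.I * (c.η a : ℂ)), this, one_smul]

theorem trace_γ0_comb (x y z u : ℂ) : (c.γ 0 * c.comb x y z u).trace = 2 * Complex.I * y := by
  rw [γ_eq_ig, Matrix.smul_mul, ig0_mul_comb, Matrix.trace_smul, trace_comb, smul_eq_mul]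
  linear_combination (2 * Complex.I * y) * c.ηC_mul_self 0

theorem trace_γ1_comb (x y z u : ℂ) : (c.γ 1 * c.comb x y z u).trace = 2 * Complex.I * z := by
  rw [γ_eq_ig, Matrix.smul_mul, ig1_mul_comb, Matrix.trace_smul, trace_comb, smul_eq_mul]
  linear_combination (2 * Complex.I * z) * c.ηC_mul_self 1

/-- The coordinate directions confine each `F a` to the span of 1 and its own Clifford element; the
direction (1, 1) then equates the two Clifford coefficients. -/
theorem symbol_first_order {F : Fin 2 → Mat}
    (h : ∀ x y : ℂ, (x • F 0 + y • F 1) * (x • c.ig 0 + y • c.ig 1) =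
      (x • c.ig 0 + y • c.ig 1) * (x • F 0 + y • F 1)) (a : Fin 2) :
    F a = vecPart₁ F a • (1 : Mat) + c.scalPart F • c.ig a := by
  have h00 := h 1 0
  have h11 := h 0 1
  have h01 := h 1 1
  simp only [one_smul, zero_smul, add_zero, zero_add] at h00 h11 h01
  obtain ⟨x, y, hF0⟩ := c.commute_ig0 h00
  obtain ⟨x', z, hF1⟩ := c.commute_ig1 h11
  rw [hF0, hF1, comb_add, mul_add, add_mul, comb_mul_ig0, comb_mul_ig1, ig0_mul_comb,
    ig1_mul_comb, comb_add, comb_add] at h01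
  obtain ⟨-, -, -, h3⟩ := c.comb_injective h01
  have hzy : y = z := by linear_combination (1 / 2 : ℂ) * h3
  -- Each of the two traces equals 2i times the common coefficient, hence the normalization -i/4.
  have ht : c.scalPart F = y := by
    rw [scalPart, Fin.sum_univ_two, hF0, hF1, trace_γ0_comb, trace_γ1_comb]
    linear_combination (-(y + z) / 2) * Complex.I_mul_I - (1 / 2 : ℂ) * hzy
  have key : ∀ a, F a = c.comb (vecPart₁ F a) 0 0 0 + c.scalPart F • c.ig a := by
    intro a
    fin_cases a
    · simp only [Fin.zero_eta, vecPart₁, ht]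
      rw [hF0, trace_comb, comb, comb]
      module
    · simp only [Fin.mk_one, vecPart₁, ht, hzy]
      rw [hF1, trace_comb, comb, comb]
      module
  rw [key a, comb]
  module

/-- The coordinate directions fix the shape of the diagonal coefficients. The directions (1, 1) and
(1, -1) then remove the γ₀ γ₁ part of the mixed coefficient and express its Clifford part by the
diagonal ones. Only the sum of `E 0 1` and `E 1 0` is determined, since only it enters the symbol.
-/
theorem symbol_second_order {E : Fin 2 → Fin 2 → Mat}
    (h : ∀ x y : ℂ, (x ^ 2 • E 0 0 + (x * y) • (E 0 1 + E 1 0) + y ^ 2 • E 1 1) *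
        (x • c.ig 0 + y • c.ig 1) =
      (x • c.ig 0 + y • c.ig 1) *
        (x ^ 2 • E 0 0 + (x * y) • (E 0 1 + E 1 0) + y ^ 2 • E 1 1)) :
    E 0 0 = tenPart E 0 0 • (1 : Mat) + c.vecPart₂ E 0 • c.ig 0 ∧
    E 1 1 = tenPart E 1 1 • (1 : Mat) + c.vecPart₂ E 1 • c.ig 1 ∧
    E 0 1 + E 1 0 = (2 * tenPart E 0 1) • (1 : Mat) + c.vecPart₂ E 0 • c.ig 1
      + c.vecPart₂ E 1 • c.ig 0 := by
  have h00 := h 1 0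
  have h11 := h 0 1
  have hp := h 1 1
  have hm := h 1 (-1)
  generalize hQ : E 0 1 + E 1 0 = Q at *
  simp only [one_pow, mul_zero, zero_pow two_ne_zero, one_smul, zero_smul, add_zero,
    zero_add, mul_one, one_mul, neg_smul, neg_one_sq] at h00 h11 hp hm
  obtain ⟨e0, a0, hE0⟩ := c.commute_ig0 h00
  obtain ⟨e1, a1, hE1⟩ := c.commute_ig1 h11
  obtain ⟨q, r, s, u, rfl⟩ := c.exists_comb Q
  have hneg : ∀ x y z u : ℂ, -c.comb x y z u = c.comb (-x) (-y) (-z) (-u) := by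
    intro x y z u
    rw [comb, comb]
    module
  rw [hE0, hE1] at hp hm
  simp only [hneg, comb_add, mul_add, add_mul, mul_neg, neg_mul, comb_mul_ig0, comb_mul_ig1,
    ig0_mul_comb, ig1_mul_comb] at hp hm
  obtain ⟨-, p1, p2, p3⟩ := c.comb_injective hp
  obtain ⟨-, m1, m2, m3⟩ := c.comb_injective hm
  have hu : u = 0 := by
    apply eq_zero_of_eq_neg
    apply mul_left_cancel₀ (c.η_ne_zero 0)
    linear_combination p2
  have hr : r = a1 := by linear_combination (1 / 4 : ℂ) * p3 + (1 / 4 : ℂ) * m3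
  have hs : s = a0 := by linear_combination -(1 / 4 : ℂ) * p3 + (1 / 4 : ℂ) * m3
  subst hu hr hs
  -- The diagonal coefficient contributes 4i s and the mixed one 2i s, hence the factor -i/6.
  have v0 : c.vecPart₂ E 0 = s := by
    rw [vecPart₂, Fin.sum_univ_two, hQ, hE0, comb_add, trace_γ0_comb, trace_γ1_comb]
    linear_combination (-s) * Complex.I_mul_I
  have v1 : c.vecPart₂ E 1 = r := by
    rw [vecPart₂, Fin.sum_univ_two, add_comm (E 1 0), hQ, hE1, comb_add, trace_γ0_comb,
      trace_γ1_comb]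
    linear_combination (-r) * Complex.I_mul_I
  have t0 : tenPart E 0 0 = e0 := by
    rw [tenPart, hE0, comb_add, trace_comb]
    ring
  have t1 : tenPart E 1 1 = e1 := by
    rw [tenPart, hE1, comb_add, trace_comb]
    ring
  have tq : 2 * tenPart E 0 1 = q := by
    rw [tenPart, hQ, trace_comb]
    ring
  rw [v0, v1, t0, t1, tq, hE0, hE1, comb, comb, comb]
  refine ⟨?_, ?_, ?_⟩ <;> module

end DiracMatrices

end DiracSymmetry

/-! ### Killing equations of the second-order symbol -/

namespace DiracSymmetry

open TopologicalSpace

/-- The derivative of a function along the `a`-th vector of a frame. -/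
def frameDeriv {F : Type*} [NormedAddCommGroup F] [NormedSpace ℝ F]
    (e : Fin 2 → Fin 2 → Coord → ℝ) (a : Fin 2) (f : Coord → F) (x : Coord) : F :=
  e a 0 x • pd 0 f x + e a 1 x • pd 1 f x

theorem SmoothMatOn.trace_mul {N : Coord → Mat} {U : Set Coord} (hN : SmoothMatOn N U) (B : Mat) :
    ContDiffOn ℝ ∞ (fun y => (B * N y).trace) U := by
  simp only [Matrix.trace, Matrix.diag, Matrix.mul_apply, Fin.sum_univ_two]
  exact (((contDiffOn_const.mul (hN 0 0)).add (contDiffOn_const.mul (hN 1 0)))).add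
    ((contDiffOn_const.mul (hN 0 1)).add (contDiffOn_const.mul (hN 1 1)))

theorem SmoothMatOn.trace {N : Coord → Mat} {U : Set Coord} (hN : SmoothMatOn N U) :
    ContDiffOn ℝ ∞ (fun y => (N y).trace) U := by
  simpa using hN.trace_mul 1

theorem SmoothMatOn.add {N N' : Coord → Mat} {U : Set Coord} (hN : SmoothMatOn N U)
    (hN' : SmoothMatOn N' U) : SmoothMatOn (fun y => N y + N' y) U := fun r s =>
  (hN r s).add (hN' r s)

theorem SmoothMatOn.sub {N N' : Coord → Mat} {U : Set Coord} (hN : SmoothMatOn N U)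
    (hN' : SmoothMatOn N' U) : SmoothMatOn (fun y => N y - N' y) U := fun r s =>
  (hN r s).sub (hN' r s)

theorem SmoothMatOn.const_smul {N : Coord → Mat} {U : Set Coord} (hN : SmoothMatOn N U) (z : ℂ) :
    SmoothMatOn (fun y => z • N y) U := fun r s => contDiffOn_const.mul (hN r s)

theorem smoothMatOn_const (B : Mat) (U : Set Coord) : SmoothMatOn (fun _ => B) U := fun _ _ =>
  contDiffOn_const

theorem SmoothMatOn.mul {N N' : Coord → Mat} {U : Set Coord} (hN : SmoothMatOn N U)
    (hN' : SmoothMatOn N' U) : SmoothMatOn (fun y => N y * N' y) U := fun r s => by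
  simp only [Matrix.mul_apply, Fin.sum_univ_two]
  exact ((hN r 0).mul (hN' 0 s)).add ((hN r 1).mul (hN' 1 s))

theorem scalPart_smooth (c : DiracMatrices) {F : Fin 2 → Coord → Mat} {U : Set Coord}
    (hF : ∀ a, SmoothMatOn (F a) U) : ContDiffOn ℝ ∞ (fun y => c.scalPart fun a => F a y) U :=
  contDiffOn_const.mul (ContDiffOn.sum fun b _ => (hF b).trace_mul _)

theorem vecPart₁_smooth {F : Fin 2 → Coord → Mat} {U : Set Coord}
    (hF : ∀ a, SmoothMatOn (F a) U) (a : Fin 2) :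
    ContDiffOn ℝ ∞ (fun y => DiracMatrices.vecPart₁ (fun a => F a y) a) U :=
  contDiffOn_const.mul (hF a).trace

theorem vecPart₂_smooth (c : DiracMatrices) {E : Fin 2 → Fin 2 → Coord → Mat} {U : Set Coord}
    (hE : ∀ a b, SmoothMatOn (E a b) U) (a : Fin 2) :
    ContDiffOn ℝ ∞ (fun y => c.vecPart₂ (fun a b => E a b y) a) U :=
  contDiffOn_const.mul (ContDiffOn.sum fun b _ => ((hE a b).add (hE b a)).trace_mul _)

theorem tenPart_smooth {E : Fin 2 → Fin 2 → Coord → Mat} {U : Set Coord}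
    (hE : ∀ a b, SmoothMatOn (E a b) U) (a b : Fin 2) :
    ContDiffOn ℝ ∞ (fun y => DiracMatrices.tenPart (fun a b => E a b y) a b) U :=
  contDiffOn_const.mul ((hE a b).add (hE b a)).trace

namespace LocalData

variable {c : DiracMatrices} {L : LocalData c}

theorem ev_δS (y : L.U) (a : Fin 2) {f : Coord → ℂ} (hf : ContDiffOn ℝ ∞ f L.U) :
    Sm.ev y (L.dc.δ a (Sm.mk f hf)) = frameDeriv L.e a f y := by
  rw [show L.dc.δ a (Sm.mk f hf) = L.eS a 0 * Sm.pdS 0 (Sm.mk f hf) +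
    L.eS a 1 * Sm.pdS 1 (Sm.mk f hf) from rfl, Sm.pdS_mk, Sm.pdS_mk, map_add, map_mul, map_mul]
  rfl

/-- A linear function of the coordinates suffices, with coefficients obtained from the dual frame.
Its values are complex, so complex covectors are allowed. -/
theorem exists_differential (y : L.U) (p : Fin 2 → ℂ) :
    ∃ f : Sm L.U, ∀ a, Sm.ev y (L.dc.δ a f) = p a := by
  let k : Fin 2 → ℂ := fun μ => ∑ a, (DiracMatrices.coframe L.e a μ y : ℂ) * p a
  have hx : ∀ μ, ContDiff ℝ ∞ (fun z : Coord => (z μ : ℂ)) := fun μ =>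
    Complex.ofRealCLM.contDiff.comp (EuclideanSpace.proj (𝕜 := ℝ) μ).contDiff
  have hpx : ∀ μ ν z, pd ν (fun z : Coord => (z μ : ℂ)) z = if μ = ν then 1 else 0 := by
    intro μ ν z
    have h1 : pd ν (fun z : Coord => z μ) z = if μ = ν then 1 else 0 := by
      rw [show (fun z : Coord => z μ) = (EuclideanSpace.proj (𝕜 := ℝ) μ : Coord →L[ℝ] ℝ) from rfl,
        pd, ContinuousLinearMap.fderiv]
      simp
    have hd : DifferentiableAt ℝ (fun z : Coord => z μ) z :=
      (EuclideanSpace.proj (𝕜 := ℝ) μ : Coord →L[ℝ] ℝ).differentiableAt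
    rw [pd_ofReal hd, h1]
    split_ifs <;> simp
  let X : Fin 2 → Sm L.U := fun μ => Sm.mk _ (hx μ).contDiffOn
  have hX : ∀ a μ, Sm.ev y (L.dc.δ a (X μ)) = L.e a μ y := by
    intro a μ
    rw [ev_δS, frameDeriv, hpx, hpx]
    fin_cases μ <;> simp
  refine ⟨k 0 • X 0 + k 1 • X 1, fun a => ?_⟩
  rw [map_add, Derivation.map_smul, Derivation.map_smul, map_add, map_smul, map_smul, hX, hX]
  have h0 := congrArg (fun t : ℝ => (t : ℂ)) (L.isFrame.coframe_mul y.2 0 a)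
  have h1 := congrArg (fun t : ℝ => (t : ℂ)) (L.isFrame.coframe_mul y.2 1 a)
  simp only [k, Fin.sum_univ_two, smul_eq_mul]
  push_cast at h0 h1
  fin_cases a <;> simp at h0 h1 ⊢
  · linear_combination p 0 * h0 + p 1 * h1
  · linear_combination p 0 * h0 + p 1 * h1

theorem ev_P (y : L.U) (a : Fin 2) : (L.dc.P a).map (Sm.ev y) = c.ig a := by
  refine Matrix.ext fun r s => ?_
  rw [Matrix.map_apply, show L.dc.P a r s = algebraMap ℂ _ (c.ig a r s) from rfl, AlgHom.commutes]
  rfl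

theorem ev_κ (y : L.U) (a : Fin 2) : Sm.ev y (L.dc.κ a) = -(c.η a : ℂ) := by
  rw [show L.dc.κ a = algebraMap ℂ _ (-(c.η a : ℂ)) from rfl, AlgHom.commutes]
  rfl

theorem ev_C (y : L.U) (a : Fin 2) : Sm.ev y (L.dc.C a) = (structC L.e a y : ℂ) := rfl

/-- The matrix of values at a point, as a ring homomorphism. -/
def evM (y : L.U) : Matrix (Fin 2) (Fin 2) (Sm L.U) →+* Mat := (Sm.ev y).toRingHom.mapMatrix

theorem evM_apply (y : L.U) (N : Matrix (Fin 2) (Fin 2) (Sm L.U)) (r s : Fin 2) :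
    evM y N r s = Sm.ev y (N r s) := rfl

theorem evM_P (y : L.U) (a : Fin 2) : evM y (L.dc.P a) = c.ig a := ev_P y a

theorem evM_smul (y : L.U) (f : Sm L.U) (N : Matrix (Fin 2) (Fin 2) (Sm L.U)) :
    evM y (f • N) = Sm.ev y f • evM y N := by
  refine Matrix.ext fun r s => ?_
  rw [evM_apply, Matrix.smul_apply, smul_eq_mul, map_mul]
  rfl

theorem evM_smMat (y : L.U) {N : Coord → Mat} (hN : SmoothMatOn N L.U) :
    evM y (smMat N hN) = N y := rfl

theorem ev_const_smul (y : L.U) (z : ℂ) (f : Sm L.U) : Sm.ev y (z • f) = z * Sm.ev y f :=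
  map_smul (Sm.ev y) z f

theorem eq_of_evM {A B : Matrix (Fin 2) (Fin 2) (Sm L.U)} (h : ∀ y, evM y A = evM y B) : A = B :=
  Matrix.ext fun r s => Sm.eq_of_ev fun y => congrFun (congrFun (h y) r) s

variable (L)

/-- `w` satisfies the Killing equation, written as the vanishing of a quadratic form. -/
def IsKillingVector (w : Fin 2 → Coord → ℂ) : Prop :=
  ∀ y ∈ L.U, ∀ p : Fin 2 → ℝ,
    (c.η 0 * p 0 : ℂ) * (frameDeriv L.e 0 (w 0) y * p 0 + frameDeriv L.e 0 (w 1) y * p 1)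
      + c.η 1 * p 1 * (frameDeriv L.e 1 (w 0) y * p 0 + frameDeriv L.e 1 (w 1) y * p 1)
      + (c.η 0 * p 0 * w 1 y - c.η 1 * p 1 * w 0 y)
        * (structC L.e 0 y * p 0 + structC L.e 1 y * p 1) = 0

/-- `t` satisfies the Killing equation, written as the vanishing of a cubic form. -/
def IsKillingTensor (t : Fin 2 → Fin 2 → Coord → ℂ) : Prop :=
  ∀ y ∈ L.U, ∀ p : Fin 2 → ℝ,
    (c.η 0 * p 0 : ℂ) * (frameDeriv L.e 0 (t 0 0) y * p 0 ^ 2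
        + 2 * frameDeriv L.e 0 (t 0 1) y * (p 0 * p 1) + frameDeriv L.e 0 (t 1 1) y * p 1 ^ 2)
      + c.η 1 * p 1 * (frameDeriv L.e 1 (t 0 0) y * p 0 ^ 2
        + 2 * frameDeriv L.e 1 (t 0 1) y * (p 0 * p 1) + frameDeriv L.e 1 (t 1 1) y * p 1 ^ 2)
      + (c.η 0 * p 0 * (2 * t 0 1 y * p 0 + 2 * t 1 1 y * p 1)
        - c.η 1 * p 1 * (2 * t 0 0 y * p 0 + 2 * t 0 1 y * p 1))
        * (structC L.e 0 y * p 0 + structC L.e 1 y * p 1) = 0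

variable {L}

variable {E : Fin 2 → Fin 2 → Coord → Mat} {F : Fin 2 → Coord → Mat} {G : Coord → Mat}

/-- The algebraic identities hold for every function; choosing functions with prescribed
differential at a point turns them into statements about all covectors there. -/
theorem second_order_killing (hE : ∀ a b, SmoothMatOn (E a b) L.U)
    (hF : ∀ a, SmoothMatOn (F a) L.U) (hG : SmoothMatOn G L.U)
    (h : ∀ ψ : Coord → Spinor, ContDiffOn ℝ ∞ ψ L.U → ∀ x ∈ L.U,
      L.act E F G (L.dirac ψ) x = L.dirac (L.act E F G ψ) x) :
    (∀ y ∈ L.U, E 0 0 y = DiracMatrices.tenPart (fun a b => E a b y) 0 0 • (1 : Mat)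
        + c.vecPart₂ (fun a b => E a b y) 0 • c.ig 0 ∧
      E 1 1 y = DiracMatrices.tenPart (fun a b => E a b y) 1 1 • (1 : Mat)
        + c.vecPart₂ (fun a b => E a b y) 1 • c.ig 1 ∧
      E 0 1 y + E 1 0 y = (2 * DiracMatrices.tenPart (fun a b => E a b y) 0 1) • (1 : Mat)
        + c.vecPart₂ (fun a b => E a b y) 0 • c.ig 1
        + c.vecPart₂ (fun a b => E a b y) 1 • c.ig 0) ∧
    L.IsKillingVector (fun a y => c.vecPart₂ (fun a b => E a b y) a) ∧
    L.IsKillingTensor (fun a b y => DiracMatrices.tenPart (fun a b => E a b y) a b) := by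
  have hcomm := commute_of_symmetry hE hF hG h
  obtain ⟨F₀, F₁, G', hK⟩ := L.dc.opK_eq_op₂ (fun a b => smMat (E a b) (hE a b))
    (fun a => smMat (F a) (hF a)) (smMat G hG)
  rw [hK] at hcomm
  have hpt : ∀ y : L.U, _ := fun y => c.symbol_second_order (E := fun a b => E a b y) (by
    intro u v
    obtain ⟨f, hf⟩ := exists_differential y ![u, v]
    have h1 := congrArg (evM y) (L.dc.op₂_symb_commute hcomm f)
    have h0 : Sm.ev y (L.dc.δ 0 f) = u := hf 0
    have h1' : Sm.ev y (L.dc.δ 1 f) = v := hf 1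
    simp only [DiracCalc.symb, DiracCalc.dP, map_add, map_mul, evM_smul, evM_P, evM_smMat,
      map_pow, h0, h1'] at h1
    exact h1)
  refine ⟨fun y hy => hpt ⟨y, hy⟩, ?_⟩
  have hv := vecPart₂_smooth c hE
  have ht := tenPart_smooth hE
  have key := fun f => L.dc.op₂_vector_equation hcomm (f := f)
    (e₀ := Sm.mk _ (ht 0 0)) (q := (2 : ℂ) • Sm.mk _ (ht 0 1)) (e₁ := Sm.mk _ (ht 1 1))
    (a₀ := Sm.mk _ (hv 0)) (a₁ := Sm.mk _ (hv 1))
    (eq_of_evM fun y => by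
      simp only [map_add, evM_smul, evM_smMat, map_one, evM_P, Sm.ev_mk]
      exact (hpt y).1)
    (eq_of_evM fun y => by
      simp only [map_add, evM_smul, evM_smMat, map_one, evM_P, Sm.ev_mk]
      exact (hpt y).2.1)
    (eq_of_evM fun y => by
      simp only [map_add, evM_smul, evM_smMat, map_one, evM_P, Sm.ev_mk, ev_const_smul]
      exact (hpt y).2.2)
  constructor
  · intro y hy p
    obtain ⟨f, hf⟩ := exists_differential (L := L) ⟨y, hy⟩ (fun a => (p a : ℂ))
    have h1 := congrArg (Sm.ev ⟨y, hy⟩) (key f).1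
    simp only [map_add, map_sub, map_mul, map_zero, ev_κ, hf, ev_δS, ev_C, Sm.ev_mk] at h1
    -- The algebraic equations carry κ = -η, hence the sign.
    linear_combination -h1
  · intro y hy p
    obtain ⟨f, hf⟩ := exists_differential (L := L) ⟨y, hy⟩ (fun a => (p a : ℂ))
    have h1 := congrArg (Sm.ev ⟨y, hy⟩) (key f).2
    simp only [map_add, map_sub, map_mul, map_zero, ev_κ, hf, ev_δS, ev_C, Sm.ev_mk, map_pow,
      Derivation.map_smul, ev_const_smul, map_ofNat] at h1
    linear_combination -h1

end LocalData

end DiracSymmetry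

/-! ### Reduction to order one and to order zero -/

namespace DiracSymmetry

open TopologicalSpace

/-- The scalar curvature of a frame, up to a factor. -/
def frameCurv (c : DiracMatrices) (e : Fin 2 → Fin 2 → Coord → ℝ) (y : Coord) : ℝ :=
  c.η 0 * frameDeriv e 0 (structC e 1) y - c.η 1 * frameDeriv e 1 (structC e 0) y
    - c.η 1 * structC e 0 y ^ 2 - c.η 0 * structC e 1 y ^ 2

/-- The divergence of a vector field with frame components `v`. -/
def frameDiv (e : Fin 2 → Fin 2 → Coord → ℝ) (v : Fin 2 → Coord → ℂ) (y : Coord) : ℂ :=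
  frameDeriv e 0 (v 0) y + frameDeriv e 1 (v 1) y
    + structC e 0 y * v 1 y - structC e 1 y * v 0 y

theorem frameDeriv_ofReal {e : Fin 2 → Fin 2 → Coord → ℝ} {f : Coord → ℝ} {x : Coord}
    (hf : DifferentiableAt ℝ f x) (a : Fin 2) :
    frameDeriv e a (fun y => (f y : ℂ)) x = ((frameDeriv e a f x : ℝ) : ℂ) := by
  rw [frameDeriv, frameDeriv, pd_ofReal hf, pd_ofReal hf]
  push_cast
  simp

namespace DiracCalc

variable {S : Type*} [CommRing S] [Algebra ℂ S] (X : DiracCalc S)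

/-- The scalar part of the curvature, which contains the electromagnetic field, multiplies `P 0 * P
1` and has no trace; only the scalar curvature of the frame is left. -/
theorem trace_curv : (X.P 0 * X.P 1 * X.curv).trace =
    -(X.κ 0 * X.δ 0 (X.C 1) - X.κ 1 * X.δ 1 (X.C 0) - X.κ 1 * X.C 0 ^ 2 - X.κ 0 * X.C 1 ^ 2) := by
  have h : X.P 0 * X.P 1 * (X.P 0 * X.P 1) = (-(X.κ 0 * X.κ 1)) • (1 : Matrix _ _ S) := by
    rw [mul_assoc, X.P_anti', mul_neg, X.P_sq', X.P_sq]
    module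
  have hom : ∀ a b, X.δ a (X.om b) = algebraMap ℂ S (1 / 2) * X.κ b * X.δ a (X.C b) := by
    intro a b
    rw [om, Derivation.leibniz, Derivation.leibniz, Derivation.map_algebraMap, X.δ_κ]
    simp only [smul_eq_mul]
    ring
  rw [curv, mul_add, Matrix.mul_smul, Matrix.mul_smul, mul_one, h, Matrix.trace_add,
    Matrix.trace_smul, Matrix.trace_smul, Matrix.trace_smul, X.trace_P_mul, Matrix.trace_one,
    Fintype.card_fin, hom, hom, om, om]
  have hh := two_half (S := S)
  have h0 := X.κ_sq 0
  have h1 := X.κ_sq 1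
  simp only [smul_eq_mul, mul_zero, add_zero]
  push_cast
  linear_combination (-X.κ 0 * X.κ 1 * (X.κ 1 * X.δ 0 (X.C 1) - X.κ 0 * X.δ 1 (X.C 0)
    - X.κ 0 * X.C 0 ^ 2 - X.κ 1 * X.C 1 ^ 2)) * hh
    + (X.κ 1 * X.δ 1 (X.C 0) + X.κ 1 * X.C 0 ^ 2) * h0
    - (X.κ 0 * X.δ 0 (X.C 1) - X.κ 0 * X.C 1 ^ 2) * h1

/-- Under the trace the connection acts only on the Clifford factor, and rotating that factor
produces the connection terms of a divergence. -/
theorem trace_cov (N : Matrix (Fin 2) (Fin 2) S) :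
    (X.P 0 * X.cov 0 N + X.P 1 * X.cov 1 N).trace =
      X.δ 0 (X.P 0 * N).trace + X.δ 1 (X.P 1 * N).trace
        + X.C 0 * (X.P 1 * N).trace - X.C 1 * (X.P 0 * N).trace := by
  have hd : ∀ a, (X.P a * N.map (X.δ a)).trace = X.δ a (X.P a * N).trace := by
    intro a
    simp only [Matrix.trace, Matrix.diag, Matrix.mul_apply, Fin.sum_univ_two, Matrix.map_apply,
      map_add, Derivation.leibniz, X.δ_P, smul_eq_mul]
    ring
  have hc : ∀ a, (X.P a * X.cov a N).trace = X.δ a (X.P a * N).trace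
      + ((X.P a * X.M a - X.M a * X.P a) * N).trace := by
    intro a
    rw [cov, mul_sub, mul_add, Matrix.trace_sub, Matrix.trace_add, hd, sub_mul, Matrix.trace_sub,
      ← mul_assoc, ← mul_assoc, Matrix.trace_mul_comm (X.P a * N), ← mul_assoc]
    ring
  have m0 : X.P 0 * X.M 0 - X.M 0 * X.P 0 = X.C 0 • X.P 1 := by
    rw [M, ← X.two_kappa_om 0]
    simp only [mul_add, add_mul, Matrix.mul_smul, Matrix.smul_mul, X.P_sq', mul_assoc, X.P_anti,
      mul_neg, mul_one, one_mul]
    module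
  have m1 : X.P 1 * X.M 1 - X.M 1 * X.P 1 = -X.C 1 • X.P 0 := by
    rw [M, ← X.two_kappa_om 1]
    simp only [mul_add, add_mul, Matrix.mul_smul, Matrix.smul_mul, X.P_sq, mul_assoc, X.P_anti',
      mul_one, one_mul]
    module
  rw [Matrix.trace_add, hc, hc, m0, m1, Matrix.smul_mul, Matrix.smul_mul, Matrix.trace_smul,
    Matrix.trace_smul]
  simp only [smul_eq_mul]
  ring

theorem op₁_eq_dirac_add {t : S} {F₀ F₁ G : Matrix (Fin 2) (Fin 2) S} (h₀ : F₀ = t • X.P 0)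
    (h₁ : F₁ = t • X.P 1) : X.op₁ F₀ F₁ G = m (t • 1) * X.dirac + m (G + t • X.V) := by
  rw [h₀, h₁, op₁, dirac, map_add, m_scalar t (X.P 0), m_scalar t (X.P 1), m_scalar t X.V]
  simp only [mul_add, mul_sub, mul_assoc]
  abel

end DiracCalc

namespace LocalData

variable {c : DiracMatrices} {L : LocalData c}

theorem evM_trace (y : L.U) (N : Matrix (Fin 2) (Fin 2) (Sm L.U)) :
    Sm.ev y N.trace = (evM y N).trace := by
  rw [Matrix.trace, Matrix.trace, map_sum]
  rfl

theorem ev_δ_trace (y : L.U) (a b : Fin 2) :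
    Sm.ev y (L.dc.δ a (L.dc.P b * L.dc.V).trace) =
      frameDeriv L.e a (fun z => (c.ig b * L.V z).trace) y := by
  rw [← ev_δS y a (L.V_smooth.trace_mul (c.ig b))]
  congr 2

variable (L)

/-- The first-order coefficients of `K + λ 𝔻²`. -/
def reducedF (l : ℂ) (F : Fin 2 → Coord → Mat) (a : Fin 2) (y : Coord) : Mat :=
  F a y - l • (c.ig a * L.V y + L.V y * c.ig a)

/-- The trace of the zero-order coefficient of `K + λ 𝔻² - t 𝔻`, divided by two. -/
def reducedG (l t : ℂ) (G : Coord → Mat) (y : Coord) : ℂ :=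
  (1 / 2) * ((G y).trace + l * (frameCurv c L.e y
    - frameDiv L.e (fun a z => (c.ig a * L.V z).trace) y + (L.V y * L.V y).trace)
    + t * (L.V y).trace)

variable {L}

theorem reducedF_smooth (l : ℂ) {F : Fin 2 → Coord → Mat} (hF : ∀ a, SmoothMatOn (F a) L.U)
    (a : Fin 2) : SmoothMatOn (L.reducedF l F a) L.U :=
  (hF a).sub ((((smoothMatOn_const _ _).mul L.V_smooth).add
    (L.V_smooth.mul (smoothMatOn_const _ _))).const_smul l)

variable {E : Fin 2 → Fin 2 → Coord → Mat} {F : Fin 2 → Coord → Mat} {G : Coord → Mat}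

theorem pd_eq_zero_of_frameDeriv {f : Coord → ℂ} (y : L.U) (h : ∀ a, frameDeriv L.e a f y = 0)
    (μ : Fin 2) : pd μ f y = 0 := by
  have h0 := h 0
  have h1 := h 1
  rw [frameDeriv] at h0 h1
  have e0 := congrArg (fun t : ℝ => (t : ℂ)) (L.isFrame.coframe_mul' y.2 μ 0)
  have e1 := congrArg (fun t : ℝ => (t : ℂ)) (L.isFrame.coframe_mul' y.2 μ 1)
  simp only [Complex.real_smul] at h0 h1
  push_cast at e0 e1
  fin_cases μ <;> simp at e0 e1 ⊢
  · linear_combination (DiracMatrices.coframe L.e 0 0 y : ℂ) * h0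
      + (DiracMatrices.coframe L.e 1 0 y : ℂ) * h1 - pd 0 f y * e0 - pd 1 f y * e1
  · linear_combination (DiracMatrices.coframe L.e 0 1 y : ℂ) * h0
      + (DiracMatrices.coframe L.e 1 1 y : ℂ) * h1 - pd 0 f y * e0 - pd 1 f y * e1

/-- The zero-order coefficient of `K + λ 𝔻²`. -/
def redG (l : ℂ) (hG : SmoothMatOn G L.U) : Matrix (Fin 2) (Fin 2) (Sm L.U) :=
  smMat G hG + (algebraMap ℂ (Sm L.U) l) • (L.dc.P 0 * L.dc.P 1 * L.dc.curv
    - (L.dc.P 0 * L.dc.cov 0 L.dc.V + L.dc.P 1 * L.dc.cov 1 L.dc.V) + L.dc.V * L.dc.V)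

theorem opK_add_sq (hE : ∀ a b, SmoothMatOn (E a b) L.U)
    (hF : ∀ a, SmoothMatOn (F a) L.U) (hG : SmoothMatOn G L.U) {l : ℂ}
    (h₀ : ∀ y ∈ L.U, E 0 0 y = (l * c.η 0) • (1 : Mat))
    (h₁ : ∀ y ∈ L.U, E 1 1 y = (l * c.η 1) • (1 : Mat))
    (hQ : ∀ y ∈ L.U, E 0 1 y + E 1 0 y = 0) :
    L.dc.opK (fun a b => smMat (E a b) (hE a b)) (fun a => smMat (F a) (hF a)) (smMat G hG)
      + l • (L.dc.dirac * L.dc.dirac) =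
    L.dc.op₁ (smMat _ (reducedF_smooth l hF 0)) (smMat _ (reducedF_smooth l hF 1))
      (redG l hG) := by
  have hk : ∀ (a : Fin 2) (y : L.U), Sm.ev y (algebraMap ℂ (Sm L.U) l * L.dc.κ a) =
      -(l * c.η a) := by
    intro a y
    rw [map_mul, ev_κ, AlgHom.commutes]
    simp
  have h1 := L.dc.opK_add_dirac_sq (l := algebraMap ℂ (Sm L.U) l)
    (E := fun a b => smMat (E a b) (hE a b))
    (eq_of_evM fun y => by rw [evM_smMat, evM_smul, map_neg, hk, map_one, h₀ y y.2, neg_neg])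
    (eq_of_evM fun y => by rw [evM_smMat, evM_smul, map_neg, hk, map_one, h₁ y y.2, neg_neg])
    (eq_of_evM fun y => by rw [map_add, evM_smMat, evM_smMat, hQ y y.2, map_zero])
    (fun a => smMat (F a) (hF a)) (smMat G hG)
  have h2 : ∀ a, smMat _ (reducedF_smooth l hF a) = smMat (F a) (hF a) -
      algebraMap ℂ (Sm L.U) l • (L.dc.P a * L.dc.V + L.dc.V * L.dc.P a) := by
    intro a
    refine eq_of_evM fun y => ?_
    rw [map_sub, evM_smul, map_add, map_mul, map_mul, evM_P, AlgHom.commutes]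
    rfl
  rw [h2, h2, redG, ← h1]
  congr 1
  rw [algebraMap_smul, DiracCalc.m_smul, map_one, smul_mul_assoc, one_mul]

/-- By `opK_add_sq` the operator `K + l 𝔻²` has order one, and it commutes with the Dirac operator
together with `K`; the argument for the second-order symbol then repeats one order lower. -/
theorem first_order_killing (hE : ∀ a b, SmoothMatOn (E a b) L.U)
    (hF : ∀ a, SmoothMatOn (F a) L.U) (hG : SmoothMatOn G L.U) {l : ℂ}
    (h₀ : ∀ y ∈ L.U, E 0 0 y = (l * c.η 0) • (1 : Mat))
    (h₁ : ∀ y ∈ L.U, E 1 1 y = (l * c.η 1) • (1 : Mat))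
    (hQ : ∀ y ∈ L.U, E 0 1 y + E 1 0 y = 0)
    (h : ∀ ψ : Coord → Spinor, ContDiffOn ℝ ∞ ψ L.U → ∀ x ∈ L.U,
      L.act E F G (L.dirac ψ) x = L.dirac (L.act E F G ψ) x) :
    (∀ y ∈ L.U, ∀ a, L.reducedF l F a y =
      DiracMatrices.vecPart₁ (fun a => L.reducedF l F a y) a • (1 : Mat)
        + c.scalPart (fun a => L.reducedF l F a y) • c.ig a) ∧
    L.IsKillingVector (fun a y => DiracMatrices.vecPart₁ (fun a => L.reducedF l F a y) a) ∧
    (∀ y ∈ L.U, ∀ μ, pd μ (fun y => c.scalPart (fun a => L.reducedF l F a y)) y = 0) := by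
  have hK := commute_of_symmetry hE hF hG h
  have hK' := opK_add_sq hE hF hG h₀ h₁ hQ
  have hcomm : L.dc.op₁ (smMat _ (reducedF_smooth l hF 0)) (smMat _ (reducedF_smooth l hF 1))
      (redG l hG) * L.dc.dirac = L.dc.dirac * L.dc.op₁ (smMat _ (reducedF_smooth l hF 0))
      (smMat _ (reducedF_smooth l hF 1)) (redG l hG) := by
    rw [← hK', add_mul, mul_add, hK, smul_mul_assoc, mul_smul_comm, mul_assoc]
  have hpt : ∀ y : L.U, _ := fun y => c.symbol_first_order (F := fun a => L.reducedF l F a y) (by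
    intro u v
    obtain ⟨f, hf⟩ := exists_differential y ![u, v]
    have h1 := congrArg (evM y) (L.dc.op₁_symb_commute hcomm f)
    have h0 : Sm.ev y (L.dc.δ 0 f) = u := hf 0
    have h1' : Sm.ev y (L.dc.δ 1 f) = v := hf 1
    simp only [DiracCalc.dP, map_add, map_mul, evM_smul, evM_P, evM_smMat, h0, h1'] at h1
    exact h1)
  refine ⟨fun y hy => hpt ⟨y, hy⟩, ?_⟩
  have hv := vecPart₁_smooth (reducedF_smooth l hF)
  have ht := scalPart_smooth c (reducedF_smooth l hF)
  have key := fun f => L.dc.op₁_vector_equation hcomm (f := f)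
    (w₀ := Sm.mk _ (hv 0)) (w₁ := Sm.mk _ (hv 1)) (t := Sm.mk _ ht)
    (eq_of_evM fun y => by
      simp only [map_add, evM_smul, evM_smMat, map_one, evM_P, Sm.ev_mk]
      exact hpt y 0)
    (eq_of_evM fun y => by
      simp only [map_add, evM_smul, evM_smMat, map_one, evM_P, Sm.ev_mk]
      exact hpt y 1)
  constructor
  · intro y hy p
    obtain ⟨f, hf⟩ := exists_differential (L := L) ⟨y, hy⟩ (fun a => (p a : ℂ))
    have h1 := congrArg (Sm.ev ⟨y, hy⟩) (key f).2
    simp only [map_add, map_sub, map_mul, map_zero, ev_κ, hf, ev_δS, ev_C, Sm.ev_mk] at h1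
    linear_combination -h1
  · intro y hy
    refine pd_eq_zero_of_frameDeriv ⟨y, hy⟩ fun a => ?_
    -- This covector makes the equation for the scalar part consist of one frame derivative with a
    -- nonzero coefficient.
    obtain ⟨f, hf⟩ := exists_differential (L := L) ⟨y, hy⟩
      (fun b => if b = a then -(c.η a : ℂ) else 0)
    have h1 := congrArg (Sm.ev ⟨y, hy⟩) (key f).1
    simp only [map_add, map_mul, map_zero, ev_κ, hf, ev_δS] at h1
    have h2 := c.ηC_mul_self a
    fin_cases a <;> simp at h1 ⊢
    · exact h1.resolve_left (by exact_mod_cast c.η_ne_zero 0)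
    · exact h1.resolve_left (by exact_mod_cast c.η_ne_zero 1)

theorem evM_V (y : L.U) : evM y L.dc.V = L.V y := rfl

theorem ev_δ_structC (y : L.U) (a b : Fin 2) : Sm.ev y (L.dc.δ a (L.dc.C b)) =
    ((frameDeriv L.e a (structC L.e b) y : ℝ) : ℂ) := by
  rw [← frameDeriv_ofReal (differentiableAt_of_smoothOn L.U.2 (L.isFrame.structC_smooth b) y.2)]
  exact ev_δS y a (smoothOn_ofReal (L.isFrame.structC_smooth b))

/-- The explicit formula makes the constant built from this trace comparable between
trivializations: each term in it is visibly a candidate for an invariant. -/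
theorem trace_redG (hG : SmoothMatOn G L.U) (l t : ℂ) (y : L.U) :
    (1 / 2 : ℂ) * (evM y (redG l hG + algebraMap ℂ (Sm L.U) t • L.dc.V)).trace =
      L.reducedG l t G y := by
  have hVt : ∀ a, Sm.ev y (L.dc.P a * L.dc.V).trace = (c.ig a * L.V y).trace := by
    intro a
    rw [evM_trace, map_mul, evM_P, evM_V]
  have hVV : Sm.ev y (L.dc.V * L.dc.V).trace = (L.V y * L.V y).trace := by
    rw [evM_trace, map_mul, evM_V]
  have hV : Sm.ev y L.dc.V.trace = (L.V y).trace := by rw [evM_trace, evM_V]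
  have hGt : Sm.ev y (smMat G hG).trace = (G y).trace := by rw [evM_trace, evM_smMat]
  rw [← evM_trace, redG, Matrix.trace_add, Matrix.trace_add, Matrix.trace_smul,
    Matrix.trace_smul, Matrix.trace_add, Matrix.trace_sub, DiracCalc.trace_curv,
    DiracCalc.trace_cov, reducedG, frameCurv, frameDiv]
  simp only [map_add, map_sub, map_neg, map_mul, smul_eq_mul, AlgHom.commutes, ev_δ_structC, hVt, hVV,
    hV, hGt, ev_δ_trace, ev_κ, ev_C, map_pow]
  push_cast
  simp only [Algebra.algebraMap_self, RingHom.id_apply]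
  ring

theorem _root_.DiracSymmetry.commute_add_sq {R : Type*} [Ring R] [Algebra ℂ R] {K D : R} (l t : ℂ)
    (h : K * D = D * K) : (K + l • (D * D) - t • D) * D = D * (K + l • (D * D) - t • D) := by
  rw [sub_mul, mul_sub, add_mul, mul_add, h]
  simp only [smul_mul_assoc, mul_smul_comm, mul_assoc]

theorem reducedG_smooth (hG : SmoothMatOn G L.U) (l t : ℂ) :
    ContDiffOn ℝ ∞ (L.reducedG l t G) L.U := by
  refine (Sm.lift_smooth (algebraMap ℂ (Sm L.U) (1 / 2) *
    (redG l hG + algebraMap ℂ (Sm L.U) t • L.dc.V).trace)).congr fun y hy => ?_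
  rw [← trace_redG hG l t ⟨y, hy⟩, ← evM_trace]
  refine Eq.trans ?_ (Sm.lift_apply _ ⟨y, hy⟩).symm
  rfl

-- Subtracting `t 𝔻` from `K + l 𝔻²` leaves a matrix that commutes with the Dirac operator. It
-- commutes with both Clifford generators, so it is half its trace times the identity, and then its
-- derivatives vanish.
set_option maxHeartbeats 1000000 in
theorem zero_order_const (hE : ∀ a b, SmoothMatOn (E a b) L.U)
    (hF : ∀ a, SmoothMatOn (F a) L.U) (hG : SmoothMatOn G L.U) {l t : ℂ}
    (h₀ : ∀ y ∈ L.U, E 0 0 y = (l * c.η 0) • (1 : Mat))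
    (h₁ : ∀ y ∈ L.U, E 1 1 y = (l * c.η 1) • (1 : Mat))
    (hQ : ∀ y ∈ L.U, E 0 1 y + E 1 0 y = 0)
    (hFt : ∀ y ∈ L.U, ∀ a, L.reducedF l F a y = t • c.ig a)
    (h : ∀ ψ : Coord → Spinor, ContDiffOn ℝ ∞ ψ L.U → ∀ x ∈ L.U,
      L.act E F G (L.dirac ψ) x = L.dirac (L.act E F G ψ) x) :
    (∀ y ∈ L.U, ∀ μ, pd μ (L.reducedG l t G) y = 0) ∧
    ∀ ψ : Coord → Spinor, ContDiffOn ℝ ∞ ψ L.U → ∀ x ∈ L.U,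
      L.act E F G ψ x = (-l) • L.dirac (L.dirac ψ) x + t • L.dirac ψ x
        + L.reducedG l t G x • ψ x := by
  have hK := commute_of_symmetry hE hF hG h
  have hK' := opK_add_sq hE hF hG h₀ h₁ hQ
  have hP : ∀ a, smMat _ (reducedF_smooth l hF a) = algebraMap ℂ (Sm L.U) t • L.dc.P a := by
    intro a
    refine eq_of_evM fun y => ?_
    rw [evM_smul, evM_P, AlgHom.commutes, evM_smMat, hFt y y.2]
    rfl
  rw [L.dc.op₁_eq_dirac_add (hP 0) (hP 1), algebraMap_smul, DiracCalc.m_smul, map_one,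
    smul_mul_assoc, one_mul] at hK'
  set R := redG l hG + algebraMap ℂ (Sm L.U) t • L.dc.V with hR
  set Kop := L.dc.opK (fun a b => smMat (E a b) (hE a b)) (fun a => smMat (F a) (hF a))
    (smMat G hG) with hKop
  have hKe : Kop = (-l) • (L.dc.dirac * L.dc.dirac) + t • L.dc.dirac + DiracCalc.m R := by
    rw [add_assoc, ← hK']
    module
  have hcomm : DiracCalc.m R * L.dc.dirac = L.dc.dirac * DiracCalc.m R := by
    have e : DiracCalc.m R = Kop + l • (L.dc.dirac * L.dc.dirac) - t • L.dc.dirac := by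
      rw [hK']; module
    rw [e]
    exact commute_add_sq (R := Module.End ℂ (Fin 2 → Sm L.U)) l t hK
  have hpt : ∀ y : L.U, evM y R = ((1 / 2 : ℂ) * (evM y R).trace) • (1 : Mat) := by
    intro y
    have h1 : ∀ p : Fin 2 → ℂ, evM y R * (p 0 • c.ig 0 + p 1 • c.ig 1) =
        (p 0 • c.ig 0 + p 1 • c.ig 1) * evM y R := by
      intro p
      obtain ⟨f, hf⟩ := exists_differential y p
      have h1 := congrArg (evM y) (L.dc.op₀_commute hcomm f)
      simpa only [DiracCalc.dP, map_add, map_mul, evM_smul, evM_P, hf] using h1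
    exact c.commute_both (by simpa using h1 ![1, 0]) (by simpa using h1 ![0, 1])
  have htr : ∀ y : L.U, (1 / 2 : ℂ) * (evM y R).trace = L.reducedG l t G y :=
    trace_redG hG l t
  have hsm : ∃ r : Sm L.U, R = r • 1 ∧ ∀ y, Sm.ev y r = L.reducedG l t G y := by
    refine ⟨(1 / 2 : ℂ) • R.trace, eq_of_evM fun y => ?_, fun y => ?_⟩
    · rw [evM_smul, map_one, map_smul, evM_trace]
      exact hpt y
    · rw [map_smul, evM_trace]
      exact htr y
  obtain ⟨r, hr, hry⟩ := hsm
  constructor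
  · intro y hy
    refine pd_eq_zero_of_frameDeriv ⟨y, hy⟩ fun a => ?_
    rw [hr] at hcomm
    have h1 := L.dc.op₀_scalar hcomm a
    obtain ⟨f, hf, rfl⟩ := Sm.exists_mk r
    have h2 := ev_δS ⟨y, hy⟩ a hf
    rw [h1, map_zero] at h2
    have h3 : ∀ z ∈ L.U, L.reducedG l t G z = f z := fun z hz => (hry ⟨z, hz⟩).symm
    rw [frameDeriv, pd_congr L.U.2 h3 0 hy, pd_congr L.U.2 h3 1 hy]
    exact h2.symm
  · intro ψ hψ x hx
    obtain ⟨Ψ, hΨ⟩ := exists_rep hψ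
    have h1 : Kop Ψ = (-l) • L.dc.dirac (L.dc.dirac Ψ) + t • L.dc.dirac Ψ
        + DiracCalc.m (r • 1) Ψ := by
      rw [hKe, hr]
      rw [LinearMap.add_apply]
      congr 1
    have h2 := ((hΨ.dirac.dirac.const_smul (-l)).add (hΨ.dirac.const_smul t)).add
      (hΨ.smul (f := L.reducedG l t G) fun y => (hry y).symm)
    rw [← h1] at h2
    exact (hΨ.act hE hF hG).unique h2 x hx

end LocalData

end DiracSymmetry

/-! ### Killing vectors and Killing tensors -/

namespace DiracSymmetry

open TopologicalSpace

theorem frameDeriv_clm {F G : Type*} [NormedAddCommGroup F] [NormedSpace ℝ F]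
    [NormedAddCommGroup G] [NormedSpace ℝ G] (T : F →L[ℝ] G) (e : Fin 2 → Fin 2 → Coord → ℝ)
    (a : Fin 2) {f : Coord → F} {x : Coord} (hf : DifferentiableAt ℝ f x) :
    frameDeriv e a (fun y => T (f y)) x = T (frameDeriv e a f x) := by
  rw [frameDeriv, frameDeriv, pd_clm T hf, pd_clm T hf, map_add, map_smul, map_smul]

theorem frameDeriv_re (e : Fin 2 → Fin 2 → Coord → ℝ) (a : Fin 2) {f : Coord → ℂ} {x : Coord}
    (hf : DifferentiableAt ℝ f x) :
    frameDeriv e a (fun y => (f y).re) x = (frameDeriv e a f x).re :=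
  frameDeriv_clm Complex.reCLM e a hf

theorem frameDeriv_mul {𝔸 : Type*} [NormedCommRing 𝔸] [NormedAlgebra ℝ 𝔸]
    (e : Fin 2 → Fin 2 → Coord → ℝ) (a : Fin 2) {f g : Coord → 𝔸} {x : Coord}
    (hf : DifferentiableAt ℝ f x) (hg : DifferentiableAt ℝ g x) :
    frameDeriv e a (fun y => f y * g y) x = f x * frameDeriv e a g x + g x * frameDeriv e a f x := by
  rw [frameDeriv, frameDeriv, frameDeriv, pd_mul hf hg, pd_mul hf hg]
  simp only [smul_add, mul_add, mul_smul_comm]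
  abel

theorem frameDeriv_const {F : Type*} [NormedAddCommGroup F] [NormedSpace ℝ F]
    (e : Fin 2 → Fin 2 → Coord → ℝ) (a : Fin 2) (r : F) (x : Coord) :
    frameDeriv e a (fun _ => r) x = 0 := by
  rw [frameDeriv, pd_const, pd_const, smul_zero, smul_zero, add_zero]

theorem IsFrameOn.nablaUp_eq {e : Fin 2 → Fin 2 → Coord → ℝ} {U : Set Coord} (h : IsFrameOn e U)
    (c : DiracMatrices) {x : Coord} (hx : x ∈ U) (t : Fin 2 → Fin 2 → Coord → ℝ) (d a b : Fin 2) :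
    c.nablaUp e t d a b x = c.η d * frameDeriv e d (t a b) x + structC e d x *
      ((if a = 0 then c.η 0 * t 1 b x else -(c.η 1 * t 0 b x)) +
        if b = 0 then c.η 0 * t a 1 x else -(c.η 1 * t a 0 x)) := by
  have s0 := h.spinConn_self c hx 0 d
  have s1 := h.spinConn_self c hx 1 d
  have s2 := h.spinConn_01 c hx d
  have s3 := h.spinConn_10 c hx d
  have h0 := c.η_mul_self 0
  have h1 := c.η_mul_self 1
  have hd := c.η_mul_self d
  rw [DiracMatrices.nablaUp, frameDeriv]
  simp only [DiracMatrices.spinConnMixed, Fin.sum_univ_two, smul_eq_mul]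
  have h2 : ∀ a : Fin 2, a = 0 ∨ a = 1 := by decide
  rcases h2 a with rfl | rfl <;> rcases h2 b with rfl | rfl <;>
    simp only [if_pos, if_neg one_ne_zero]
  · linear_combination c.η d * (2 * c.η 0 * t 0 0 x * s0 + c.η 1 * (t 1 0 x + t 0 1 x) * s2)
      + c.η d * c.η 0 * c.η d * structC e d x * (t 1 0 x + t 0 1 x) * h1
      + c.η 0 * structC e d x * (t 1 0 x + t 0 1 x) * hd
  · linear_combination c.η d * (c.η 0 * t 0 1 x * s0 + c.η 1 * t 0 1 x * s1
        + c.η 1 * t 1 1 x * s2 + c.η 0 * t 0 0 x * s3)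
      + c.η d * c.η 0 * c.η d * structC e d x * t 1 1 x * h1
      - c.η d * c.η 1 * c.η d * structC e d x * t 0 0 x * h0
      + structC e d x * (c.η 0 * t 1 1 x - c.η 1 * t 0 0 x) * hd
  · linear_combination c.η d * (c.η 0 * t 1 0 x * s0 + c.η 1 * t 1 0 x * s1
        + c.η 1 * t 1 1 x * s2 + c.η 0 * t 0 0 x * s3)
      + c.η d * c.η 0 * c.η d * structC e d x * t 1 1 x * h1
      - c.η d * c.η 1 * c.η d * structC e d x * t 0 0 x * h0
      + structC e d x * (c.η 0 * t 1 1 x - c.η 1 * t 0 0 x) * hd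
  · linear_combination c.η d * (2 * c.η 1 * t 1 1 x * s1 + c.η 0 * (t 1 0 x + t 0 1 x) * s3)
      - c.η d * c.η 1 * c.η d * structC e d x * (t 1 0 x + t 0 1 x) * h0
      - c.η 1 * structC e d x * (t 1 0 x + t 0 1 x) * hd

namespace LocalData

variable {c : DiracMatrices} {L : LocalData c}

theorem IsKillingVector.const_mul {w : Fin 2 → Coord → ℂ} (h : L.IsKillingVector w)
    (hw : ∀ a, ContDiffOn ℝ ∞ (w a) L.U) (z : ℂ) : L.IsKillingVector (fun a y => z * w a y) := by
  intro y hy p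
  have hd : ∀ a b, frameDeriv L.e a (fun y => z * w b y) y = z * frameDeriv L.e a (w b) y := by
    intro a b
    rw [frameDeriv_mul L.e a (differentiableAt_const z)
      (differentiableAt_of_smoothOn L.U.2 (hw b) hy), frameDeriv_const, mul_zero, add_zero]
  simp only [hd]
  linear_combination z * h y hy p

theorem IsKillingTensor.const_mul {t : Fin 2 → Fin 2 → Coord → ℂ} (h : L.IsKillingTensor t)
    (ht : ∀ a b, ContDiffOn ℝ ∞ (t a b) L.U) (z : ℂ) :
    L.IsKillingTensor (fun a b y => z * t a b y) := by
  intro y hy p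
  have hd : ∀ d a b, frameDeriv L.e d (fun y => z * t a b y) y =
      z * frameDeriv L.e d (t a b) y := by
    intro d a b
    rw [frameDeriv_mul L.e d (differentiableAt_const z)
      (differentiableAt_of_smoothOn L.U.2 (ht a b) hy), frameDeriv_const, mul_zero, add_zero]
  simp only [hd]
  linear_combination z * h y hy p

/-- The Killing equation is linear with real coefficients; `h1` regroups it so that each coefficient
is the cast of a real number. -/
theorem IsKillingVector.re {w : Fin 2 → Coord → ℂ} (h : L.IsKillingVector w)
    (hw : ∀ a, ContDiffOn ℝ ∞ (w a) L.U) :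
    L.IsKillingVector (fun a y => ((w a y).re : ℂ)) := by
  intro y hy p
  have hdw := fun b => differentiableAt_of_smoothOn L.U.2 (hw b) hy
  have hd : ∀ a b, frameDeriv L.e a (fun y => ((w b y).re : ℂ)) y =
      ((frameDeriv L.e a (w b) y).re : ℂ) := by
    intro a b
    rw [frameDeriv_ofReal (f := fun y => (w b y).re)
        (Complex.reCLM.differentiableAt.comp y (hdw b)),
      frameDeriv_re L.e a (hdw b)]
  simp only [hd]
  have h1 : ((c.η 0 * p 0 * p 0 : ℝ) : ℂ) * frameDeriv L.e 0 (w 0) y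
      + ((c.η 0 * p 0 * p 1 : ℝ) : ℂ) * frameDeriv L.e 0 (w 1) y
      + ((c.η 1 * p 1 * p 0 : ℝ) : ℂ) * frameDeriv L.e 1 (w 0) y
      + ((c.η 1 * p 1 * p 1 : ℝ) : ℂ) * frameDeriv L.e 1 (w 1) y
      + ((c.η 0 * p 0 * (structC L.e 0 y * p 0 + structC L.e 1 y * p 1) : ℝ) : ℂ) * w 1 y
      + ((-(c.η 1 * p 1 * (structC L.e 0 y * p 0 + structC L.e 1 y * p 1)) : ℝ) : ℂ) * w 0 y
      = 0 := by
    push_cast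
    linear_combination h y hy p
  have h2 := congrArg Complex.re h1
  simp only [Complex.add_re, Complex.re_ofReal_mul, Complex.zero_re] at h2
  have h3 := congrArg (fun r : ℝ => (r : ℂ)) h2
  push_cast at h3
  linear_combination h3

/-- By the Leibniz rule the cubic form of w ⊗ w is 2 w(p) times the quadratic form of w. -/
theorem IsKillingVector.tensor {w : Fin 2 → Coord → ℂ} (h : L.IsKillingVector w)
    (hw : ∀ a, ContDiffOn ℝ ∞ (w a) L.U) :
    L.IsKillingTensor (fun a b y => w a y * w b y) := by
  intro y hy p
  have hdw := fun b => differentiableAt_of_smoothOn L.U.2 (hw b) hy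
  simp only [frameDeriv_mul L.e _ (hdw _) (hdw _)]
  linear_combination 2 * (w 0 y * p 0 + w 1 y * p 1) * h y hy p

/-- Polarization: the Killing equation is the vanishing of a cubic form in two variables, whose four
coefficients are the components of the symmetrized derivative. -/
theorem IsKillingTensor.nablaUp_re {z : Fin 2 → Fin 2 → Coord → ℂ} (h : L.IsKillingTensor z)
    (hz : ∀ a b, ContDiffOn ℝ ∞ (z a b) L.U) (hs : ∀ a b, z a b = z b a) {y : Coord} (hy : y ∈ L.U)
    (d a b : Fin 2) :
    c.nablaUp L.e (fun a b y => (z a b y).re) d a b y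
      + c.nablaUp L.e (fun a b y => (z a b y).re) a b d y
      + c.nablaUp L.e (fun a b y => (z a b y).re) b d a y = 0 := by
  have hdz := fun a b => differentiableAt_of_smoothOn L.U.2 (hz a b) hy
  have key : ∀ p : Fin 2 → ℝ,
      (c.η 0 * p 0) * ((frameDeriv L.e 0 (z 0 0) y).re * p 0 ^ 2
        + 2 * (frameDeriv L.e 0 (z 0 1) y).re * (p 0 * p 1)
        + (frameDeriv L.e 0 (z 1 1) y).re * p 1 ^ 2)
      + c.η 1 * p 1 * ((frameDeriv L.e 1 (z 0 0) y).re * p 0 ^ 2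
        + 2 * (frameDeriv L.e 1 (z 0 1) y).re * (p 0 * p 1)
        + (frameDeriv L.e 1 (z 1 1) y).re * p 1 ^ 2)
      + (c.η 0 * p 0 * (2 * (z 0 1 y).re * p 0 + 2 * (z 1 1 y).re * p 1)
        - c.η 1 * p 1 * (2 * (z 0 0 y).re * p 0 + 2 * (z 0 1 y).re * p 1))
        * (structC L.e 0 y * p 0 + structC L.e 1 y * p 1) = 0 := by
    intro p
    have h1 : ((c.η 0 * p 0 * p 0 ^ 2 : ℝ) : ℂ) * frameDeriv L.e 0 (z 0 0) y
        + ((2 * c.η 0 * p 0 * (p 0 * p 1) : ℝ) : ℂ) * frameDeriv L.e 0 (z 0 1) y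
        + ((c.η 0 * p 0 * p 1 ^ 2 : ℝ) : ℂ) * frameDeriv L.e 0 (z 1 1) y
        + ((c.η 1 * p 1 * p 0 ^ 2 : ℝ) : ℂ) * frameDeriv L.e 1 (z 0 0) y
        + ((2 * c.η 1 * p 1 * (p 0 * p 1) : ℝ) : ℂ) * frameDeriv L.e 1 (z 0 1) y
        + ((c.η 1 * p 1 * p 1 ^ 2 : ℝ) : ℂ) * frameDeriv L.e 1 (z 1 1) y
        + ((2 * (c.η 0 * p 0 * p 0 - c.η 1 * p 1 * p 1)
            * (structC L.e 0 y * p 0 + structC L.e 1 y * p 1) : ℝ) : ℂ) * z 0 1 y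
        + ((2 * c.η 0 * p 0 * p 1
            * (structC L.e 0 y * p 0 + structC L.e 1 y * p 1) : ℝ) : ℂ) * z 1 1 y
        + ((-(2 * c.η 1 * p 1 * p 0
            * (structC L.e 0 y * p 0 + structC L.e 1 y * p 1)) : ℝ) : ℂ) * z 0 0 y = 0 := by
      push_cast
      linear_combination h y hy p
    have h2 := congrArg Complex.re h1
    simp only [Complex.add_re, Complex.re_ofReal_mul, Complex.zero_re] at h2
    linear_combination h2
  have hs' := hs 1 0
  -- The values at these four covectors determine a binary cubic form.
  have k0 := key ![1, 0]
  have k1 := key ![0, 1]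
  have k2 := key ![1, 1]
  have k3 := key ![1, -1]
  simp only [Matrix.cons_val_zero, Matrix.cons_val_one] at k0 k1 k2 k3
  have h2 : ∀ a : Fin 2, a = 0 ∨ a = 1 := by decide
  simp only [L.isFrame.nablaUp_eq c hy, frameDeriv_re L.e _ (hdz _ _)]
  rcases h2 a with rfl | rfl <;> rcases h2 b with rfl | rfl <;> rcases h2 d with rfl | rfl <;>
    simp only [if_pos, if_neg one_ne_zero, hs']
  · linear_combination 3 * k0
  · linear_combination (1 / 2) * k2 - (1 / 2) * k3 - k1
  · linear_combination (1 / 2) * k2 - (1 / 2) * k3 - k1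
  · linear_combination (1 / 2) * k2 + (1 / 2) * k3 - k0
  · linear_combination (1 / 2) * k2 - (1 / 2) * k3 - k1
  · linear_combination (1 / 2) * k2 + (1 / 2) * k3 - k0
  · linear_combination (1 / 2) * k2 + (1 / 2) * k3 - k0
  · linear_combination 3 * k1

end LocalData

end DiracSymmetry

/-! ### Frame independence of curvature and divergence -/

namespace DiracSymmetry

/-- Pulling back along a change of coordinates that rotates the frame by
`(p, q; -κ₀κ₁q, p)`. -/
structure FrameChange {S S' : Type*} [CommRing S] [Algebra ℂ S] [CommRing S'] [Algebra ℂ S']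
    (X : DiracCalc S) (X' : DiracCalc S') where
  T : S →+* S'
  κ : ∀ a, T (X.κ a) = X'.κ a
  p : S'
  q : S'
  unit : p * p + X'.κ 0 * X'.κ 1 * q * q = 1
  δ₀ : ∀ f, T (X.δ 0 f) = p * X'.δ 0 (T f) + q * X'.δ 1 (T f)
  δ₁ : ∀ f, T (X.δ 1 f) = -(X'.κ 0 * X'.κ 1 * q) * X'.δ 0 (T f) + p * X'.δ 1 (T f)
  ext : ∀ u v, (∀ f, u * X'.δ 0 (T f) + v * X'.δ 1 (T f) = 0) → u = 0 ∧ v = 0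

namespace FrameChange

variable {S S' : Type*} [CommRing S] [Algebra ℂ S] [CommRing S'] [Algebra ℂ S']
  {X : DiracCalc S} {X' : DiracCalc S'} (Φ : FrameChange X X')

/-- The derivative of the rotation angle. -/
def θ (a : Fin 2) : S' := Φ.p * X'.δ a Φ.q - Φ.q * X'.δ a Φ.p

/-- Half the derivative of `Φ.unit`. It says that the matrix entries vary only through the angle, so
`Φ.θ` carries all of their derivatives. -/
theorem δ_unit (a : Fin 2) : Φ.p * X'.δ a Φ.p + X'.κ 0 * X'.κ 1 * Φ.q * X'.δ a Φ.q = 0 := by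
  have h := congrArg (X'.δ a) Φ.unit
  simp only [map_add, Derivation.leibniz, X'.δ_κ, Derivation.map_one_eq_zero, smul_eq_mul,
    mul_zero, add_zero] at h
  have hh := DiracCalc.two_half (S := S')
  linear_combination (algebraMap ℂ S' (1 / 2)) * h
    - (Φ.p * X'.δ a Φ.p + X'.κ 0 * X'.κ 1 * Φ.q * X'.δ a Φ.q) * hh

theorem δ_q (a : Fin 2) : X'.δ a Φ.q = Φ.p * Φ.θ a := by
  rw [θ]
  linear_combination -X'.δ a Φ.q * Φ.unit + Φ.q * Φ.δ_unit a

theorem δ_p (a : Fin 2) : X'.δ a Φ.p = -(X'.κ 0 * X'.κ 1 * Φ.q * Φ.θ a) := by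
  rw [θ]
  linear_combination -X'.δ a Φ.p * Φ.unit + Φ.p * Φ.δ_unit a

/-- The differential of the angle is closed; this is its exterior derivative evaluated on a frame
with structure functions `X'.C`. -/
theorem δ_θ : X'.δ 0 (Φ.θ 1) - X'.δ 1 (Φ.θ 0) = X'.C 0 * Φ.θ 0 + X'.C 1 * Φ.θ 1 := by
  have hp := X'.comm Φ.p
  have hq := X'.comm Φ.q
  have e : X'.δ 0 Φ.p * X'.δ 1 Φ.q = X'.δ 1 Φ.p * X'.δ 0 Φ.q := by
    rw [δ_p, δ_q, δ_p, δ_q]; ring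
  rw [θ, θ]
  simp only [map_sub, Derivation.leibniz, smul_eq_mul]
  linear_combination 2 * e + Φ.p * hq - Φ.q * hp

/-- The rotation has determinant one, so the bracket of the rotated frame is that of the original
frame plus derivatives of the rotation. `Φ.ext` permits comparing the coefficients. The structure
functions therefore change like a gauge potential, by the differential of the angle. -/
theorem C_rot : Φ.p * Φ.T (X.C 0) - X'.κ 0 * X'.κ 1 * Φ.q * Φ.T (X.C 1) =
      X'.C 0 - X'.κ 0 * X'.κ 1 * Φ.θ 0 ∧
    Φ.q * Φ.T (X.C 0) + Φ.p * Φ.T (X.C 1) = X'.C 1 - Φ.θ 1 := by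
  rw [← sub_eq_zero, ← sub_eq_zero (b := X'.C 1 - Φ.θ 1)]
  refine Φ.ext _ _ fun f => ?_
  have h := congrArg Φ.T (X.comm f)
  have h' := X'.comm (Φ.T f)
  simp only [map_sub, map_add, map_mul, Φ.δ₀, Φ.δ₁, Derivation.leibniz, smul_eq_mul, map_neg,
    X'.δ_κ, Φ.δ_p, Φ.δ_q] at h
  linear_combination -h + (X'.C 0 * X'.δ 0 (Φ.T f) + X'.C 1 * X'.δ 1 (Φ.T f)
    - X'.κ 0 * X'.κ 1 * Φ.θ 0 * X'.δ 0 (Φ.T f) - Φ.θ 1 * X'.δ 1 (Φ.T f)) * Φ.unit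
    + (Φ.p * Φ.p + X'.κ 0 * X'.κ 1 * Φ.q * Φ.q) * h'

theorem T_C₀ : Φ.T (X.C 0) = Φ.p * (X'.C 0 - X'.κ 0 * X'.κ 1 * Φ.θ 0)
    + X'.κ 0 * X'.κ 1 * Φ.q * (X'.C 1 - Φ.θ 1) := by
  linear_combination Φ.p * Φ.C_rot.1 + X'.κ 0 * X'.κ 1 * Φ.q * Φ.C_rot.2 - Φ.T (X.C 0) * Φ.unit

theorem T_C₁ : Φ.T (X.C 1) = -Φ.q * (X'.C 0 - X'.κ 0 * X'.κ 1 * Φ.θ 0)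
    + Φ.p * (X'.C 1 - Φ.θ 1) := by
  linear_combination -Φ.q * Φ.C_rot.1 + Φ.p * Φ.C_rot.2 - Φ.T (X.C 1) * Φ.unit

/-- The curvature is the exterior derivative of the connection form. The gauge term is the
differential of the angle, closed by `δ_θ`, so it disappears. -/
theorem curvature_invariant :
    Φ.T (X.κ 0 * X.δ 0 (X.C 1) - X.κ 1 * X.δ 1 (X.C 0) - X.κ 1 * X.C 0 ^ 2 - X.κ 0 * X.C 1 ^ 2) =
      X'.κ 0 * X'.δ 0 (X'.C 1) - X'.κ 1 * X'.δ 1 (X'.C 0) - X'.κ 1 * X'.C 0 ^ 2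
        - X'.κ 0 * X'.C 1 ^ 2 := by
  have s0 := X'.κ_sq 0
  have s1 := X'.κ_sq 1
  have u := Φ.unit
  have hθ := Φ.δ_θ
  simp only [map_sub, map_add, map_mul, map_pow, Φ.κ, Φ.δ₀, Φ.δ₁, Φ.T_C₀, Φ.T_C₁]
  set x := X'.C 0 - X'.κ 0 * X'.κ 1 * Φ.θ 0 with hx
  set y := X'.C 1 - Φ.θ 1 with hy
  have hx1 : X'.δ 1 x = X'.δ 1 (X'.C 0) - X'.κ 0 * X'.κ 1 * X'.δ 1 (Φ.θ 0) := by
    simp [hx, X'.δ_κ]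
  have hy0 : X'.δ 0 y = X'.δ 0 (X'.C 1) - X'.δ 0 (Φ.θ 1) := by
    simp [hy]
  have key : X'.κ 0 * (Φ.p * X'.δ 0 (-Φ.q * x + Φ.p * y) + Φ.q * X'.δ 1 (-Φ.q * x + Φ.p * y))
      - X'.κ 1 * (-(X'.κ 0 * X'.κ 1 * Φ.q) * X'.δ 0 (Φ.p * x + X'.κ 0 * X'.κ 1 * Φ.q * y)
        + Φ.p * X'.δ 1 (Φ.p * x + X'.κ 0 * X'.κ 1 * Φ.q * y)) =
      X'.κ 0 * X'.δ 0 y - X'.κ 1 * X'.δ 1 x - X'.κ 0 * Φ.θ 0 * x - X'.κ 0 * Φ.θ 1 * y := by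
    simp only [map_add, Derivation.leibniz, smul_eq_mul, map_neg, X'.δ_κ, Φ.δ_p, Φ.δ_q]
    clear_value x y
    clear hθ
    grind
  have sq : X'.κ 1 * (Φ.p * x + X'.κ 0 * X'.κ 1 * Φ.q * y) ^ 2
      + X'.κ 0 * (-Φ.q * x + Φ.p * y) ^ 2 = X'.κ 1 * x ^ 2 + X'.κ 0 * y ^ 2 := by
    clear_value x y
    clear hθ
    grind
  simp only [map_add] at key
  rw [sub_sub, key, sq, hx1, hy0, hx, hy]
  clear_value x y
  clear key sq hx1 hy0 u
  grind

/-- The derivatives of the rotation matrix cancel the inhomogeneous terms in the structure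
functions. -/
theorem divergence_invariant {v : Fin 2 → S} {v' : Fin 2 → S'}
    (h₀ : v' 0 = Φ.p * Φ.T (v 0) - X'.κ 0 * X'.κ 1 * Φ.q * Φ.T (v 1))
    (h₁ : v' 1 = Φ.q * Φ.T (v 0) + Φ.p * Φ.T (v 1)) :
    Φ.T (X.δ 0 (v 0) + X.δ 1 (v 1) + X.C 0 * v 1 - X.C 1 * v 0) =
      X'.δ 0 (v' 0) + X'.δ 1 (v' 1) + X'.C 0 * v' 1 - X'.C 1 * v' 0 := by
  have s0 := X'.κ_sq 0
  have s1 := X'.κ_sq 1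
  have u := Φ.unit
  rw [h₀, h₁]
  simp only [map_sub, map_add, map_mul, Φ.δ₀, Φ.δ₁, Φ.T_C₀, Φ.T_C₁, Derivation.leibniz,
    smul_eq_mul, X'.δ_κ, Φ.δ_p, Φ.δ_q]
  clear h₀ h₁
  grind

end FrameChange

end DiracSymmetry

/-! ### Spin transformations and the rotations they cover -/

namespace DiracSymmetry

namespace DiracMatrices

variable (c : DiracMatrices)

theorem vec_mul_vec_self (v : Fin 2 → ℝ) : c.vec v * c.vec v = (c.sq v : ℂ) • (1 : Mat) := by
  have h0 := c.clifford 0 0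
  have h1 := c.clifford 1 1
  have h01 := c.clifford 0 1
  rw [if_pos rfl] at h0 h1
  rw [if_neg zero_ne_one, zero_smul] at h01
  simp only [vec, sq, Fin.sum_univ_two, add_mul, mul_add, Matrix.smul_mul, Matrix.mul_smul]
  push_cast
  linear_combination (norm := skip) ((1 / 2 : ℂ) * v 0 ^ 2) • h0 + ((1 / 2 : ℂ) * v 1 ^ 2) • h1
    + ((v 0 : ℂ) * v 1) • h01
  module

theorem vec_mul_volume (v : Fin 2 → ℝ) :
    c.vec v * (c.γ 0 * c.γ 1) = -(c.γ 0 * c.γ 1 * c.vec v) := by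
  have h01 : c.γ 1 * c.γ 0 = -(c.γ 0 * c.γ 1) := by
    have := c.clifford 0 1
    rw [if_neg zero_ne_one, zero_smul] at this
    exact eq_neg_of_add_eq_zero_right this
  have e0 : c.γ 0 * (c.γ 0 * c.γ 1) = -(c.γ 0 * c.γ 1 * c.γ 0) := by
    rw [mul_assoc (c.γ 0) (c.γ 1), h01, mul_neg, neg_neg]
  have e1 : c.γ 1 * (c.γ 0 * c.γ 1) = -(c.γ 0 * c.γ 1 * c.γ 1) := by
    rw [← mul_assoc, h01, neg_mul]
  simp only [vec, Fin.sum_univ_two, add_mul, mul_add, Matrix.smul_mul, Matrix.mul_smul, e0, e1]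
  module

/-- A vector anticommutes with the volume element γ₀ γ₁ and is invertible when its square is ±1, so
an even product is invertible and commutes with the volume element. -/
theorem spin_isUnit_and_commute {S : Mat} (hS : S ∈ c.spin) :
    IsUnit S ∧ S * (c.γ 0 * c.γ 1) = c.γ 0 * c.γ 1 * S := by
  have hu : ∀ v : Fin 2 → ℝ, |c.sq v| = 1 → IsUnit (c.vec v) := by
    intro v hv
    have h0 : (c.sq v : ℂ) ≠ 0 := by
      intro h
      rw [Complex.ofReal_eq_zero.1 h] at hv
      simp at hv
    refine IsUnit.of_mul_eq_one ((c.sq v : ℂ)⁻¹ • c.vec v) ?_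
    rw [Matrix.mul_smul, vec_mul_vec_self, smul_smul, inv_mul_cancel₀ h0, one_smul]
  induction hS using Submonoid.closure_induction with
  | mem S h =>
    obtain ⟨v, w, hv, hw, rfl⟩ := h
    refine ⟨(hu v hv).mul (hu w hw), ?_⟩
    rw [mul_assoc, vec_mul_volume, mul_neg, ← mul_assoc, vec_mul_volume, neg_mul, neg_neg,
      mul_assoc]
  | one => exact ⟨isUnit_one, by rw [one_mul, mul_one]⟩
  | mul S T _ _ hS hT =>
    refine ⟨hS.1.mul hT.1, ?_⟩
    rw [mul_assoc, hT.2, ← mul_assoc, hS.2, mul_assoc]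

/-- `S` is invertible and covers the Lorentz rotation `(p, q; -η₀η₁q, p)`. -/
structure IsSpinRotation (S : Mat) (R : Matrix (Fin 2) (Fin 2) ℝ) : Prop where
  isUnit : IsUnit S
  eq₁₁ : R 1 1 = R 0 0
  eq₁₀ : R 1 0 = -(c.η 0 * c.η 1 * R 0 1)
  unit : R 0 0 * R 0 0 + c.η 0 * c.η 1 * R 0 1 * R 0 1 = 1
  conj₀ : S * c.ig 0 = ((R 0 0 : ℂ) • c.ig 0 + (R 1 0 : ℂ) • c.ig 1) * S
  conj₁ : S * c.ig 1 = ((R 0 1 : ℂ) • c.ig 0 + (R 1 1 : ℂ) • c.ig 1) * S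

variable {c}

/-- The Clifford relations make `R` preserve η, and commutation with the volume element makes its
determinant one. In dimension two these conditions give the form (p, q; -η₀η₁q, p). -/
theorem isSpinRotation_of_spin {S : Mat} {R : Matrix (Fin 2) (Fin 2) ℝ} (hS : S ∈ c.spin)
    (h : ∀ a, c.γ a * S = S * ∑ b, (R a b : ℂ) • c.γ b) : c.IsSpinRotation S R := by
  obtain ⟨hu, hv⟩ := c.spin_isUnit_and_commute hS
  have hg : ∀ a b, c.γ a * c.γ b * S =
      S * ((∑ d, (R a d : ℂ) • c.γ d) * ∑ d, (R b d : ℂ) • c.γ d) := by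
    intro a b
    rw [mul_assoc, h, ← mul_assoc, h, mul_assoc]
  have hcl : ∀ a b, ((∑ d, (R a d : ℂ) • c.γ d) * ∑ d, (R b d : ℂ) • c.γ d)
      + ((∑ d, (R b d : ℂ) • c.γ d) * ∑ d, (R a d : ℂ) • c.γ d)
      = (if a = b then (2 * c.η a : ℂ) else 0) • (1 : Mat) := by
    intro a b
    apply hu.mul_left_cancel
    rw [mul_add, ← hg, ← hg, ← add_mul, c.clifford, Matrix.smul_mul, Matrix.mul_smul, mul_one,
      one_mul]
  have g0 := c.clifford 0 0
  have g1 := c.clifford 1 1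
  have g01 := c.clifford 0 1
  rw [if_pos rfl] at g0 g1
  rw [if_neg zero_ne_one, zero_smul] at g01
  have smul_one_inj : ∀ {x y : ℂ}, x • (1 : Mat) = y • (1 : Mat) → x = y := by
    intro x y hxy
    simpa using congrFun (congrFun hxy 0) 0
  have hq : ∀ a b, (R a 0 * R b 0 * c.η 0 + R a 1 * R b 1 * c.η 1 : ℝ) =
      if a = b then c.η a else 0 := by
    intro a b
    have h1 := hcl a b
    have h2 : ((R a 0 * R b 0 * (2 * c.η 0) + R a 1 * R b 1 * (2 * c.η 1) : ℂ)) • (1 : Mat) =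
        (if a = b then (2 * c.η a : ℂ) else 0) • (1 : Mat) := by
      rw [← h1]
      simp only [Fin.sum_univ_two, add_mul, mul_add, Matrix.smul_mul, Matrix.mul_smul]
      linear_combination (norm := skip) -((R a 0 * R b 0 : ℂ) • g0 + (R a 1 * R b 1 : ℂ) • g1
        + (R a 0 * R b 1 + R a 1 * R b 0 : ℂ) • g01)
      module
    have h3 := smul_one_inj h2
    have h4 : ((R a 0 * R b 0 * c.η 0 + R a 1 * R b 1 * c.η 1 : ℝ) : ℂ) =
        ((if a = b then c.η a else 0 : ℝ) : ℂ) := by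
      split_ifs at h3 ⊢ <;> push_cast <;> linear_combination (1 / 2 : ℂ) * h3
    exact_mod_cast h4
  -- Modulo the orthogonality of its rows, `R` multiplies γ₀ γ₁ by its determinant, and γ₀ γ₁ is not
  -- zero.
  have hdet : R 0 0 * R 1 1 - R 0 1 * R 1 0 = 1 := by
    have h1 : (∑ d, (R 0 d : ℂ) • c.γ d) * ∑ d, (R 1 d : ℂ) • c.γ d = c.γ 0 * c.γ 1 := by
      apply hu.mul_left_cancel
      rw [← hg, hv]
    have h2 : ((R 0 0 * R 1 1 - R 0 1 * R 1 0 - 1 : ℝ) : ℂ) • (c.γ 0 * c.γ 1) = 0 := by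
      have h3 := hq 0 1
      rw [if_neg zero_ne_one] at h3
      have h4 := congrArg (fun r : ℝ => (r : ℂ) • (1 : Mat)) h3
      push_cast at h4 ⊢
      rw [zero_smul] at h4
      simp only [Fin.sum_univ_two, add_mul, mul_add, Matrix.smul_mul, Matrix.mul_smul] at h1
      linear_combination (norm := skip) h1 - h4 - (1 / 2 * R 0 0 * R 1 0 : ℂ) • g0
        - (1 / 2 * R 0 1 * R 1 1 : ℂ) • g1 - (R 0 1 * R 1 0 : ℂ) • g01
      module
    have h3 : (c.γ 0 * c.γ 1) ≠ 0 := by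
      intro h3
      have h4 := congrArg (fun N => c.γ 0 * N * c.γ 1) h3
      simp only [mul_zero, zero_mul] at h4
      have h5 : c.γ 0 * (c.γ 0 * c.γ 1) * c.γ 1 = ((c.η 0 : ℂ) * c.η 1) • (1 : Mat) := by
        rw [← mul_assoc, mul_assoc, c.γ_sq, c.γ_sq, Matrix.smul_mul, one_mul, smul_smul]
      rw [h5] at h4
      have h6 := congrFun (congrFun h4 0) 0
      simp at h6
      rcases h6 with h6 | h6
      · exact c.η_ne_zero 0 (by rw [h6]; simp)
      · exact c.η_ne_zero 1 (by rw [h6]; simp)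
    rcases smul_eq_zero.1 h2 with h4 | h4
    · have := Complex.ofReal_eq_zero.1 h4
      linarith
    · exact absurd h4 h3
  have q00 := hq 0 0
  have q01 := hq 0 1
  have q11 := hq 1 1
  rw [if_pos rfl] at q00 q11
  rw [if_neg zero_ne_one] at q01
  have n0 := c.η_mul_self 0
  have n1 := c.η_mul_self 1
  have e11 : R 1 1 = R 0 0 := by
    clear hcl hg h g0 g1 g01 hv
    grind
  have e10 : R 1 0 = -(c.η 0 * c.η 1 * R 0 1) := by
    clear hcl hg h g0 g1 g01 hv
    grind
  have eu : R 0 0 * R 0 0 + c.η 0 * c.η 1 * R 0 1 * R 0 1 = 1 := by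
    linear_combination c.η 0 * q00 - R 0 0 * R 0 0 * n0 + n0
  have h0 := h 0
  have h1 := h 1
  simp only [Fin.sum_univ_two, mul_add, Matrix.mul_smul] at h0 h1
  have m0 : ((c.η 0 : ℂ)) * c.η 0 = 1 := c.ηC_mul_self 0
  have m1 : ((c.η 1 : ℂ)) * c.η 1 = 1 := c.ηC_mul_self 1
  have ce10 : (R 1 0 : ℂ) = -(c.η 0 * c.η 1 * R 0 1) := by rw [e10]; push_cast; ring
  have ce11 : (R 1 1 : ℂ) = R 0 0 := by rw [e11]
  have ceu : (R 0 0 * R 0 0 + c.η 0 * c.η 1 * R 0 1 * R 0 1 : ℂ) = 1 := by exact_mod_cast eu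
  -- The relation for γ_a S is solved for S γ_a with the inverse of the rotation.
  have k0 : S * c.γ 0 = (R 0 0 : ℂ) • (c.γ 0 * S) - (R 0 1 : ℂ) • (c.γ 1 * S) := by
    rw [h0, h1, ce10, ce11]
    linear_combination (norm := skip) -(ceu • (S * c.γ 0))
    module
  have k1 : S * c.γ 1 = (c.η 0 * c.η 1 * R 0 1 : ℂ) • (c.γ 0 * S) + (R 0 0 : ℂ) • (c.γ 1 * S) := by
    rw [h0, h1, ce10, ce11]
    linear_combination (norm := skip) -(ceu • (S * c.γ 1))
    module
  refine ⟨hu, e11, e10, eu, ?_, ?_⟩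
  · simp only [ig, γup, Matrix.mul_smul, k0, ce10, add_mul, Matrix.smul_mul]
    linear_combination (norm := skip) (Complex.I * c.η 0 * R 0 1) • (m1 • (c.γ 1 * S))
    module
  · simp only [ig, γup, Matrix.mul_smul, k1, ce11, add_mul, Matrix.smul_mul]
    linear_combination (norm := skip) (Complex.I * c.η 0 * R 0 1) • (m1 • (c.γ 0 * S))
    module

end DiracMatrices

end DiracSymmetry

/-! ### Symbol components under a spin rotation -/

namespace DiracSymmetry

namespace DiracMatrices

variable {c : DiracMatrices}

theorem scalPart_eq (F : Fin 2 → Mat) : c.scalPart F =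
    -(1 / 4) * (c.η 0 * (c.ig 0 * F 0).trace + c.η 1 * (c.ig 1 * F 1).trace) := by
  rw [scalPart, Fin.sum_univ_two, γ_eq_ig, γ_eq_ig, Matrix.smul_mul, Matrix.smul_mul,
    Matrix.trace_smul, Matrix.trace_smul, smul_eq_mul, smul_eq_mul]
  linear_combination (1 / 4 : ℂ) * (c.η 0 * (c.ig 0 * F 0).trace
    + c.η 1 * (c.ig 1 * F 1).trace) * Complex.I_mul_I

theorem vecPart₂_eq (E : Fin 2 → Fin 2 → Mat) (a : Fin 2) : c.vecPart₂ E a =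
    -(1 / 6) * (c.η 0 * (c.ig 0 * (E a 0 + E 0 a)).trace
      + c.η 1 * (c.ig 1 * (E a 1 + E 1 a)).trace) := by
  rw [vecPart₂, Fin.sum_univ_two, γ_eq_ig, γ_eq_ig, Matrix.smul_mul, Matrix.smul_mul,
    Matrix.trace_smul, Matrix.trace_smul, smul_eq_mul, smul_eq_mul]
  linear_combination (1 / 6 : ℂ) * (c.η 0 * (c.ig 0 * (E a 0 + E 0 a)).trace
    + c.η 1 * (c.ig 1 * (E a 1 + E 1 a)).trace) * Complex.I_mul_I

namespace IsSpinRotation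

variable {S : Mat} {R : Matrix (Fin 2) (Fin 2) ℝ} (h : c.IsSpinRotation S R)
include h

theorem trace_eq {N N' : Mat} (hN : S * N' = N * S) : N'.trace = N.trace := by
  obtain ⟨u, rfl⟩ := h.isUnit
  have : N' = (↑u⁻¹ : Mat) * (N * u) := by rw [← hN, ← mul_assoc, Units.inv_mul, one_mul]
  rw [this, Matrix.trace_mul_comm, mul_assoc, Units.mul_inv, mul_one]

theorem conj (k : Fin 2) : S * c.ig k = (∑ a, (R a k : ℂ) • c.ig a) * S := by
  rw [Fin.sum_univ_two]
  fin_cases k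
  exacts [h.conj₀, h.conj₁]

theorem trace_ig_mul {N N' : Mat} (hN : S * N' = N * S) (k : Fin 2) :
    (c.ig k * N').trace = R 0 k * (c.ig 0 * N).trace + R 1 k * (c.ig 1 * N).trace := by
  have h1 : S * (c.ig k * N') = ((∑ a, (R a k : ℂ) • c.ig a) * N) * S := by
    rw [← mul_assoc, h.conj, mul_assoc, hN, mul_assoc]
  rw [h.trace_eq h1, Fin.sum_univ_two, add_mul, Matrix.smul_mul, Matrix.smul_mul,
    Matrix.trace_add, Matrix.trace_smul, Matrix.trace_smul, smul_eq_mul, smul_eq_mul]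

theorem orth (a b : Fin 2) : (c.η 0 * R a 0 * R b 0 + c.η 1 * R a 1 * R b 1 : ℂ) =
    if a = b then (c.η a : ℂ) else 0 := by
  have n0 := c.η_mul_self 0
  have n1 := c.η_mul_self 1
  have u := h.unit
  have h11 := h.eq₁₁
  have h10 := h.eq₁₀
  have h2 : ∀ a : Fin 2, a = 0 ∨ a = 1 := by decide
  have key : c.η 0 * R a 0 * R b 0 + c.η 1 * R a 1 * R b 1 = if a = b then c.η a else 0 := by
    rcases h2 a with rfl | rfl <;> rcases h2 b with rfl | rfl <;>
      simp only [if_pos, if_neg one_ne_zero, if_neg zero_ne_one, h11, h10] <;> grind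
  split_ifs at key ⊢ <;> exact_mod_cast key

/-- The trace contracts the index of `F` with that of a Clifford element through η. Conjugation
rotates both indices, and orthogonality of the rotation absorbs this. -/
theorem scalPart_eq {F F' : Fin 2 → Mat}
    (hF : ∀ k, S * F' k = (∑ a, (R a k : ℂ) • F a) * S) : c.scalPart F' = c.scalPart F := by
  have h00 := h.orth 0 0
  have h01 := h.orth 0 1
  have h11 := h.orth 1 1
  rw [if_pos rfl] at h00 h11
  rw [if_neg zero_ne_one] at h01
  rw [DiracMatrices.scalPart_eq, DiracMatrices.scalPart_eq, h.trace_ig_mul (hF 0),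
    h.trace_ig_mul (hF 1)]
  simp only [Fin.sum_univ_two, mul_add, Matrix.mul_smul, Matrix.trace_add, Matrix.trace_smul,
    smul_eq_mul]
  linear_combination -(1 / 4 : ℂ) * ((c.ig 0 * F 0).trace * h00 + (c.ig 1 * F 1).trace * h11
    + ((c.ig 0 * F 1).trace + (c.ig 1 * F 0).trace) * h01)

theorem vecPart₁_eq {F F' : Fin 2 → Mat}
    (hF : ∀ k, S * F' k = (∑ a, (R a k : ℂ) • F a) * S) (k : Fin 2) :
    vecPart₁ F' k = R 0 k * vecPart₁ F 0 + R 1 k * vecPart₁ F 1 := by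
  rw [vecPart₁, h.trace_eq (hF k), vecPart₁, vecPart₁, Fin.sum_univ_two, Matrix.trace_add,
    Matrix.trace_smul, Matrix.trace_smul, smul_eq_mul, smul_eq_mul]
  ring

variable {E E' : Fin 2 → Fin 2 → Mat}
  (hE : ∀ k l, S * E' k l = (∑ a, ∑ b, ((R a k * R b l : ℝ) : ℂ) • E a b) * S)
include hE

omit h in
theorem symm_eq (k l : Fin 2) : S * (E' k l + E' l k) =
    (∑ a, ∑ b, ((R a k * R b l : ℝ) : ℂ) • (E a b + E b a)) * S := by
  rw [mul_add, hE, hE, ← add_mul]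
  congr 1
  simp only [Fin.sum_univ_two]
  push_cast
  module

theorem tenPart_eq (k l : Fin 2) : tenPart E' k l =
    ∑ a, ∑ b, ((R a k * R b l : ℝ) : ℂ) * tenPart E a b := by
  rw [tenPart, h.trace_eq (symm_eq hE k l)]
  simp only [Fin.sum_univ_two, Matrix.trace_add, Matrix.trace_smul, smul_eq_mul, tenPart]
  ring

/-- One index is contracted with a Clifford element as in `scalPart_eq`; the free index still
rotates. -/
theorem vecPart₂_eq (k : Fin 2) :
    c.vecPart₂ E' k = R 0 k * c.vecPart₂ E 0 + R 1 k * c.vecPart₂ E 1 := by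
  have h00 := h.orth 0 0
  have h01 := h.orth 0 1
  have h11 := h.orth 1 1
  rw [if_pos rfl] at h00 h11
  rw [if_neg zero_ne_one] at h01
  rw [DiracMatrices.vecPart₂_eq, DiracMatrices.vecPart₂_eq, DiracMatrices.vecPart₂_eq,
    h.trace_ig_mul (symm_eq hE k 0), h.trace_ig_mul (symm_eq hE k 1)]
  simp only [Fin.sum_univ_two, mul_add, Matrix.mul_smul, Matrix.trace_add, Matrix.trace_smul,
    smul_eq_mul]
  push_cast
  linear_combination -(1 / 6 : ℂ) * (
    (R 0 k * (2 * (c.ig 0 * E 0 0).trace)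
      + R 1 k * ((c.ig 0 * E 1 0).trace + (c.ig 0 * E 0 1).trace)) * h00
    + (R 0 k * ((c.ig 1 * E 0 1).trace + (c.ig 1 * E 1 0).trace)
      + R 1 k * (2 * (c.ig 1 * E 1 1).trace)) * h11
    + (R 0 k * ((c.ig 0 * E 0 1).trace + (c.ig 0 * E 1 0).trace + 2 * (c.ig 1 * E 0 0).trace)
      + R 1 k * (2 * (c.ig 0 * E 1 1).trace + (c.ig 1 * E 1 0).trace
        + (c.ig 1 * E 0 1).trace)) * h01)

end IsSpinRotation

end DiracMatrices

end DiracSymmetry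

/-! ### Changes of coordinates and frame -/

namespace DiracSymmetry

open TopologicalSpace

/-- A change of coordinates and frame between local data, which rotates the frame. -/
structure Transition {c : DiracMatrices} (L L' : LocalData c) where
  τ : Coord → Coord
  smooth : ContDiffOn ℝ ∞ τ L'.U
  maps : ∀ y ∈ L'.U, τ y ∈ L.U
  R : Coord → Matrix (Fin 2) (Fin 2) ℝ
  frame : ∀ y ∈ L'.U, ∀ a μ,
    L.e a μ (τ y) = ∑ b, R y a b * ∑ ν, pd ν (fun z => τ z μ) y * L'.e b ν y
  eq₁₁ : ∀ y ∈ L'.U, R y 1 1 = R y 0 0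
  eq₁₀ : ∀ y ∈ L'.U, R y 1 0 = -(c.η 0 * c.η 1 * R y 0 1)
  unit : ∀ y ∈ L'.U, R y 0 0 * R y 0 0 + c.η 0 * c.η 1 * R y 0 1 * R y 0 1 = 1

namespace Transition

variable {c : DiracMatrices} {L L' : LocalData c} (Φ : Transition L L')

theorem smooth_apply (μ : Fin 2) : ContDiffOn ℝ ∞ (fun z => Φ.τ z μ) L'.U :=
  (EuclideanSpace.proj (𝕜 := ℝ) μ : Coord →L[ℝ] ℝ).contDiff.comp_contDiffOn Φ.smooth

/-- The image of the second frame under the differential of the change of coordinates. -/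
def pushFrame (b μ : Fin 2) (y : Coord) : ℝ := ∑ ν, pd ν (fun z => Φ.τ z μ) y * L'.e b ν y

theorem isFrameOn_pushFrame : IsFrameOn Φ.pushFrame L'.U where
  isOpen := L'.U.2
  smooth b μ := ContDiffOn.sum fun ν _ =>
    (smoothOn_pd L'.U.2 (Φ.smooth_apply μ) ν).mul (L'.isFrame.smooth b ν)
  det y hy h0 := by
    have h := L.isFrame.det _ (Φ.maps y hy)
    have e : (Matrix.of fun a μ => L.e a μ (Φ.τ y)) =
        Φ.R y * Matrix.of fun b μ => Φ.pushFrame b μ y := by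
      refine Matrix.ext fun a μ => ?_
      rw [Matrix.of_apply, Φ.frame y hy, Matrix.mul_apply]
      rfl
    rw [e, Matrix.det_mul, h0, mul_zero] at h
    exact h rfl

/-- Smoothness of the rotation is not part of the data. It follows because the rotation is the
matrix of one smooth frame with respect to another. -/
theorem R_smooth (a b : Fin 2) : ContDiffOn ℝ ∞ (fun y => Φ.R y a b) L'.U := by
  have hs : ContDiffOn ℝ ∞ (fun y => DiracMatrices.coframe Φ.pushFrame b 0 y * L.e a 0 (Φ.τ y)
      + DiracMatrices.coframe Φ.pushFrame b 1 y * L.e a 1 (Φ.τ y)) L'.U :=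
    ((Φ.isFrameOn_pushFrame.coframe_smooth b 0).mul
      ((L.isFrame.smooth a 0).comp Φ.smooth Φ.maps)).add
      ((Φ.isFrameOn_pushFrame.coframe_smooth b 1).mul
      ((L.isFrame.smooth a 1).comp Φ.smooth Φ.maps))
  refine hs.congr fun y hy => ?_
  have h0 := Φ.isFrameOn_pushFrame.coframe_mul hy b 0
  have h1 := Φ.isFrameOn_pushFrame.coframe_mul hy b 1
  have e : ∀ μ, L.e a μ (Φ.τ y) =
      Φ.R y a 0 * Φ.pushFrame 0 μ y + Φ.R y a 1 * Φ.pushFrame 1 μ y := fun μ => by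
    rw [Φ.frame y hy, Fin.sum_univ_two]
    rfl
  rw [e, e]
  fin_cases b <;> simp at h0 h1 ⊢
  · linear_combination -Φ.R y a 0 * h0 - Φ.R y a 1 * h1
  · linear_combination -Φ.R y a 0 * h0 - Φ.R y a 1 * h1

theorem pd_comp {F : Type*} [NormedAddCommGroup F] [NormedSpace ℝ F] {f : Coord → F}
    (hf : ContDiffOn ℝ ∞ f L.U) {y : Coord} (hy : y ∈ L'.U) (ν : Fin 2) :
    pd ν (fun z => f (Φ.τ z)) y = pd ν (fun z => Φ.τ z 0) y • pd 0 f (Φ.τ y)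
      + pd ν (fun z => Φ.τ z 1) y • pd 1 f (Φ.τ y) := by
  have hτ := differentiableAt_of_smoothOn L'.U.2 Φ.smooth hy
  have hf' := differentiableAt_of_smoothOn L.U.2 hf (Φ.maps y hy)
  have h1 : ∀ μ, pd ν (fun z => Φ.τ z μ) y = (pd ν Φ.τ y) μ := fun μ =>
    pd_clm (EuclideanSpace.proj (𝕜 := ℝ) μ : Coord →L[ℝ] ℝ) hτ ν
  have h2 : pd ν (fun z => f (Φ.τ z)) y = fderiv ℝ f (Φ.τ y) (pd ν Φ.τ y) := by
    rw [pd, show (fun z => f (Φ.τ z)) = f ∘ Φ.τ from rfl, fderiv_comp y hf' hτ]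
    rfl
  have h3 : ∀ v : Coord, v = v 0 • EuclideanSpace.single 0 1 + v 1 • EuclideanSpace.single 1 1 := by
    intro v
    ext i
    fin_cases i <;> simp
  rw [h2, h1, h1, h3 (pd ν Φ.τ y), map_add, map_smul, map_smul, ← h3]
  rfl

theorem frameDeriv_comp {F : Type*} [NormedAddCommGroup F] [NormedSpace ℝ F] {f : Coord → F}
    (hf : ContDiffOn ℝ ∞ f L.U) {y : Coord} (hy : y ∈ L'.U) (a : Fin 2) :
    frameDeriv L.e a f (Φ.τ y) = Φ.R y a 0 • frameDeriv L'.e 0 (fun z => f (Φ.τ z)) y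
      + Φ.R y a 1 • frameDeriv L'.e 1 (fun z => f (Φ.τ z)) y := by
  simp only [frameDeriv, Φ.frame y hy, Φ.pd_comp hf hy, Fin.sum_univ_two]
  module

/-- The pullback of smooth functions. -/
def pullback : Sm L.U →+* Sm L'.U where
  toFun f := Sm.mk (fun y => Sm.lift f (Φ.τ y)) ((Sm.lift_smooth f).comp Φ.smooth Φ.maps)
  map_one' := Sm.eq_of_ev fun y => Sm.lift_apply _ ⟨Φ.τ y, Φ.maps y y.2⟩
  map_zero' := Sm.eq_of_ev fun y => Sm.lift_apply _ ⟨Φ.τ y, Φ.maps y y.2⟩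
  map_add' f g := Sm.eq_of_ev fun y => by
    have h := fun f => Sm.lift_apply f ⟨Φ.τ y, Φ.maps y y.2⟩
    rw [map_add, Sm.ev_mk, Sm.ev_mk, Sm.ev_mk, h, h, h]
    rfl
  map_mul' f g := Sm.eq_of_ev fun y => by
    have h := fun f => Sm.lift_apply f ⟨Φ.τ y, Φ.maps y y.2⟩
    rw [map_mul, Sm.ev_mk, Sm.ev_mk, Sm.ev_mk, h, h, h]
    rfl

theorem ev_pullback (f : Sm L.U) (y : L'.U) :
    Sm.ev y (Φ.pullback f) = Sm.ev ⟨Φ.τ y, Φ.maps y y.2⟩ f :=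
  Sm.lift_apply f ⟨Φ.τ y, Φ.maps y y.2⟩

theorem pullback_mk {f : Coord → ℂ} (hf : ContDiffOn ℝ ∞ f L.U) :
    Φ.pullback (Sm.mk f hf) = Sm.mk (fun y => f (Φ.τ y)) (hf.comp Φ.smooth Φ.maps) :=
  Sm.eq_of_ev fun y => by rw [ev_pullback]; rfl

theorem ev_pullback_δ (f : Sm L.U) (y : L'.U) (a : Fin 2) :
    Sm.ev ⟨Φ.τ y, Φ.maps y y.2⟩ (L.dc.δ a f) =
      Φ.R y a 0 * Sm.ev y (L'.dc.δ 0 (Φ.pullback f))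
        + Φ.R y a 1 * Sm.ev y (L'.dc.δ 1 (Φ.pullback f)) := by
  obtain ⟨F, hF, rfl⟩ := Sm.exists_mk f
  rw [Φ.pullback_mk, LocalData.ev_δS, LocalData.ev_δS, LocalData.ev_δS, Φ.frameDeriv_comp hF y.2]
  simp only [Complex.real_smul]

/-- The change of frame of the algebraic data. -/
def frameChange : FrameChange L.dc L'.dc where
  T := Φ.pullback
  κ a := Sm.eq_of_ev fun y => by rw [ev_pullback, LocalData.ev_κ, LocalData.ev_κ]
  p := Sm.mk (fun y => (Φ.R y 0 0 : ℂ)) (smoothOn_ofReal (Φ.R_smooth 0 0))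
  q := Sm.mk (fun y => (Φ.R y 0 1 : ℂ)) (smoothOn_ofReal (Φ.R_smooth 0 1))
  unit := Sm.eq_of_ev fun y => by
    have h := congrArg (fun r : ℝ => (r : ℂ)) (Φ.unit y y.2)
    push_cast at h
    simp only [map_add, map_mul, map_one, LocalData.ev_κ, Sm.ev_mk]
    linear_combination h
  δ₀ f := Sm.eq_of_ev fun y => by
    rw [ev_pullback, ev_pullback_δ, map_add, map_mul, map_mul, Sm.ev_mk, Sm.ev_mk]
  δ₁ f := Sm.eq_of_ev fun y => by
    rw [ev_pullback, ev_pullback_δ, Φ.eq₁₁ y y.2, Φ.eq₁₀ y y.2]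
    simp only [map_add, map_mul, map_neg, LocalData.ev_κ, Sm.ev_mk]
    push_cast
    ring
  ext u v h := by
    -- A function whose differential in the first frame is the rotated `d` pulls back to one with
    -- differential `d` in the second, so pullbacks realize every covector at a point.
    have key : ∀ (y : L'.U) (d : Fin 2 → ℂ), Sm.ev y u * d 0 + Sm.ev y v * d 1 = 0 := by
      intro y d
      obtain ⟨f, hf⟩ := LocalData.exists_differential (L := L) ⟨Φ.τ y, Φ.maps y y.2⟩
        (fun a => Φ.R y a 0 * d 0 + Φ.R y a 1 * d 1)
      have h0 := hf 0
      have h1 := hf 1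
      rw [ev_pullback_δ] at h0 h1
      have h2 := congrArg (fun r : ℝ => (r : ℂ)) (Φ.unit y y.2)
      have h3 := congrArg (Sm.ev y) (h f)
      rw [Φ.eq₁₁ y y.2, Φ.eq₁₀ y y.2] at h1
      rw [map_add, map_mul, map_mul, map_zero] at h3
      push_cast at h1 h2
      have d0 : Sm.ev y (L'.dc.δ 0 (Φ.pullback f)) = d 0 := by
        linear_combination Φ.R y 0 0 * h0 - Φ.R y 0 1 * h1
          - (Sm.ev y (L'.dc.δ 0 (Φ.pullback f)) - d 0) * h2
      have d1 : Sm.ev y (L'.dc.δ 1 (Φ.pullback f)) = d 1 := by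
        linear_combination c.η 0 * c.η 1 * Φ.R y 0 1 * h0 + Φ.R y 0 0 * h1
          - (Sm.ev y (L'.dc.δ 1 (Φ.pullback f)) - d 1) * h2
      rw [← d0, ← d1, h3]
    exact ⟨Sm.eq_of_ev fun y => by simpa using key y ![1, 0],
      Sm.eq_of_ev fun y => by simpa using key y ![0, 1]⟩

theorem _root_.DiracSymmetry.LocalData.ev_curvature (L : LocalData c) (y : L.U) :
    (frameCurv c L.e y : ℂ) = -Sm.ev y (L.dc.κ 0 * L.dc.δ 0 (L.dc.C 1)
      - L.dc.κ 1 * L.dc.δ 1 (L.dc.C 0) - L.dc.κ 1 * L.dc.C 0 ^ 2 - L.dc.κ 0 * L.dc.C 1 ^ 2) := by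
  rw [frameCurv]
  simp only [map_sub, map_mul, map_pow, LocalData.ev_δ_structC, LocalData.ev_κ, LocalData.ev_C]
  push_cast
  ring

theorem frameCurv_eq {y : Coord} (hy : y ∈ L'.U) :
    frameCurv c L.e (Φ.τ y) = frameCurv c L'.e y := by
  have h := congrArg (Sm.ev ⟨y, hy⟩) Φ.frameChange.curvature_invariant
  have h1 := L'.ev_curvature ⟨y, hy⟩
  have h2 := L.ev_curvature ⟨Φ.τ y, Φ.maps y hy⟩
  rw [← h] at h1
  rw [← Φ.ev_pullback _ ⟨y, hy⟩] at h2
  exact Complex.ofReal_injective (h2.trans h1.symm)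

theorem frameDiv_eq {v v' : Fin 2 → Coord → ℂ} (hv : ∀ a, ContDiffOn ℝ ∞ (v a) L.U)
    (hv' : ∀ a, ContDiffOn ℝ ∞ (v' a) L'.U)
    (h : ∀ y ∈ L'.U, ∀ k, v' k y = Φ.R y 0 k * v 0 (Φ.τ y) + Φ.R y 1 k * v 1 (Φ.τ y))
    {y : Coord} (hy : y ∈ L'.U) : frameDiv L.e v (Φ.τ y) = frameDiv L'.e v' y := by
  have key := Φ.frameChange.divergence_invariant (v := fun a => Sm.mk (v a) (hv a))
    (v' := fun a => Sm.mk (v' a) (hv' a))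
    (Sm.eq_of_ev fun z => by
      rw [Sm.ev_mk, h z z.2, Φ.eq₁₀ z z.2]
      simp only [frameChange, map_sub, map_mul, Sm.ev_mk, ev_pullback, LocalData.ev_κ]
      push_cast
      ring)
    (Sm.eq_of_ev fun z => by
      rw [Sm.ev_mk, h z z.2, Φ.eq₁₁ z z.2]
      simp only [frameChange, map_add, map_mul, Sm.ev_mk, ev_pullback])
  have h1 := congrArg (Sm.ev ⟨y, hy⟩) key
  have h2 := Φ.ev_pullback (L.dc.δ 0 (Sm.mk (v 0) (hv 0)) + L.dc.δ 1 (Sm.mk (v 1) (hv 1))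
    + L.dc.C 0 * Sm.mk (v 1) (hv 1) - L.dc.C 1 * Sm.mk (v 0) (hv 0)) ⟨y, hy⟩
  have h3 := h2.symm.trans h1
  simp only [map_add, map_sub, map_mul, LocalData.ev_δS, LocalData.ev_C, Sm.ev_mk] at h3
  exact h3

/-- Conjugation by the spin transformation preserves the traces of the coefficients, and curvature
and divergence do not depend on the frame. -/
theorem reducedG_eq {G G' : Coord → Mat} {S : Coord → Mat}
    (hS : ∀ y ∈ L'.U, c.IsSpinRotation (S y) (Φ.R y))
    (hV : ∀ y ∈ L'.U, S y * L'.V y = L.V (Φ.τ y) * S y)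
    {y : Coord} (hy : y ∈ L'.U) (hG : S y * G' y = G (Φ.τ y) * S y) (l t : ℂ) :
    L.reducedG l t G (Φ.τ y) = L'.reducedG l t G' y := by
  have hVV : S y * (L'.V y * L'.V y) = (L.V (Φ.τ y) * L.V (Φ.τ y)) * S y := by
    rw [← mul_assoc, hV y hy, mul_assoc, hV y hy, mul_assoc]
  rw [LocalData.reducedG, LocalData.reducedG, (hS y hy).trace_eq hG,
    (hS y hy).trace_eq (hV y hy), (hS y hy).trace_eq hVV, Φ.frameCurv_eq hy,
    Φ.frameDiv_eq (fun a => L.V_smooth.trace_mul (c.ig a)) (fun a => L'.V_smooth.trace_mul (c.ig a))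
      (fun z hz k => (hS z hz).trace_ig_mul (hV z hz) k) hy]

end Transition

end DiracSymmetry

/-! ### Gluing over the manifold -/

namespace DiracSymmetry

open TopologicalSpace

variable {c : DiracMatrices} {M : Type*} [TopologicalSpace M] [ChartedSpace Coord M] {ι : Type*}
  {X : SpinManifold c M ι}

namespace SpinManifold

variable (X)

theorem isSpinRotation (i j : ι) {x : M} (hx : x ∈ (X.chart i).source ∩ (X.chart j).source) :
    c.IsSpinRotation (X.S i j x) (X.rot i j x) :=
  DiracMatrices.isSpinRotation_of_spin (X.S_mem i j x hx) (X.rot_spec i j x hx)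

end SpinManifold

namespace ExternalFields

variable (W : ExternalFields X)

/-- The local data of a trivialization. -/
def localData (i : ι) : LocalData c where
  U := ⟨(X.chart i).target, (X.chart i).open_target⟩
  e := X.frame i
  isFrame := ⟨(X.chart i).open_target, X.frame_smooth i, X.frame_det i⟩
  q := W.q
  A := W.A i
  A_smooth := W.A_smooth i
  V := W.V i
  V_smooth := W.V_smooth i

/-- The local data of the trivialization `j`, restricted to the overlap with `i`. -/
def overlapData (i j : ι) : LocalData c where
  U := ⟨((X.chart j).symm.trans (X.chart i)).source, ((X.chart j).symm.trans (X.chart i)).open_source⟩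
  e := X.frame j
  isFrame := ⟨((X.chart j).symm.trans (X.chart i)).open_source,
    fun a μ => (X.frame_smooth j a μ).mono fun _ hy => hy.1, fun y hy => X.frame_det j y hy.1⟩
  q := W.q
  A := W.A j
  A_smooth μ := (W.A_smooth j μ).mono fun _ hy => hy.1
  V := W.V j
  V_smooth r s := (W.V_smooth j r s).mono fun _ hy => hy.1

theorem mem_overlap {i j : ι} {y : Coord} (hy : y ∈ (W.overlapData i j).U) :
    (X.chart j).symm y ∈ (X.chart i).source ∩ (X.chart j).source :=
  ⟨hy.2, (X.chart j).map_target hy.1⟩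

/-- The change of coordinates and frame between two trivializations. -/
def transition (i j : ι) : Transition (W.localData i) (W.overlapData i j) where
  τ y := X.chart i ((X.chart j).symm y)
  smooth := by
    have h := StructureGroupoid.compatible_of_mem_maximalAtlas (X.chart_mem j) (X.chart_mem i)
    exact (contMDiffOn_of_mem_contDiffGroupoid h).contDiffOn
  maps y hy := (X.chart i).map_source hy.2
  R y := X.rot i j ((X.chart j).symm y)
  frame y hy a μ := by
    have h := X.frame_trans i j _ (W.mem_overlap hy) a μ
    have h1 : X.chart j ((X.chart j).symm y) = y := (X.chart j).right_inv hy.1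
    simp only [jacobian, h1] at h
    exact h
  eq₁₁ y hy := (X.isSpinRotation i j (W.mem_overlap hy)).eq₁₁
  eq₁₀ y hy := (X.isSpinRotation i j (W.mem_overlap hy)).eq₁₀
  unit y hy := (X.isSpinRotation i j (W.mem_overlap hy)).unit

theorem reducedG_invariant {G : ι → Coord → Mat}
    (hG : ∀ i j, ∀ x ∈ (X.chart i).source ∩ (X.chart j).source,
      X.S i j x * G j (X.chart j x) = G i (X.chart i x) * X.S i j x) (l t : ℂ) (i j : ι) {x : M}
    (hx : x ∈ (X.chart i).source ∩ (X.chart j).source) :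
    (W.localData i).reducedG l t (G i) (X.chart i x) =
      (W.localData j).reducedG l t (G j) (X.chart j x) := by
  have hl := (X.chart j).left_inv hx.2
  have hy : X.chart j x ∈ (W.overlapData i j).U :=
    ⟨(X.chart j).map_source hx.2, by
      change (X.chart j).symm (X.chart j x) ∈ (X.chart i).source
      rw [hl]
      exact hx.1⟩
  have h := (W.transition i j).reducedG_eq (G := G i) (G' := G j)
    (S := fun y => X.S i j ((X.chart j).symm y))
    (fun y hy => X.isSpinRotation i j (W.mem_overlap hy))
    (fun y hy => by
      have h := W.V_trans i j _ (W.mem_overlap hy)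
      rw [(X.chart j).right_inv hy.1] at h
      exact h.symm) hy (by
      have h := hG i j _ (W.mem_overlap hy)
      rw [(X.chart j).right_inv hy.1] at h
      exact h) l t
  have e : (W.transition i j).τ (X.chart j x) = X.chart i x :=
    congrArg (X.chart i) hl
  rw [e] at h
  exact h

end ExternalFields

theorem fderiv_eq_zero_of_pd {f : Coord → ℂ} {x : Coord} (h : ∀ μ, pd μ f x = 0) :
    fderiv ℝ f x = 0 := by
  refine ContinuousLinearMap.ext fun v => ?_
  have h3 : v = v 0 • EuclideanSpace.single 0 1 + v 1 • EuclideanSpace.single 1 1 := by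
    ext i
    fin_cases i <;> simp
  rw [h3, map_add, map_smul, map_smul]
  have h0 := h 0
  have h1 := h 1
  rw [pd] at h0 h1
  rw [h0, h1, smul_zero, smul_zero, add_zero]
  rfl

/-- A function on a connected manifold with vanishing derivatives is constant. -/
theorem SpinManifold.exists_const [ConnectedSpace M] (X : SpinManifold c M ι) {f : ι → Coord → ℂ}
    (hf : ∀ i, ContDiffOn ℝ ∞ (f i) (X.chart i).target)
    (hd : ∀ i, ∀ y ∈ (X.chart i).target, ∀ μ, pd μ (f i) y = 0)
    (h : ∀ i j, ∀ x ∈ (X.chart i).source ∩ (X.chart j).source,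
      f i (X.chart i x) = f j (X.chart j x)) :
    ∃ k, ∀ i, ∀ y ∈ (X.chart i).target, f i y = k := by
  choose ch hch using X.cover
  let F : M → ℂ := fun x => f (ch x) (X.chart (ch x) x)
  have hF : ∀ i, ∀ x ∈ (X.chart i).source, F x = f i (X.chart i x) := fun i x hx =>
    h _ _ x ⟨hch x, hx⟩
  have hloc : IsLocallyConstant F := by
    rw [IsLocallyConstant.iff_exists_open]
    intro x
    set i := ch x
    have hx : x ∈ (X.chart i).source := hch x
    -- A ball in the chart is connected, so vanishing derivatives make the function constant there.
    obtain ⟨r, hr, hball⟩ := Metric.isOpen_iff.1 (X.chart i).open_target _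
      ((X.chart i).map_source hx)
    refine ⟨(X.chart i).source ∩ X.chart i ⁻¹' Metric.ball (X.chart i x) r,
      (X.chart i).isOpen_inter_preimage Metric.isOpen_ball, ⟨hx, Metric.mem_ball_self hr⟩, ?_⟩
    intro z hz
    rw [hF i z hz.1, hF i x hx]
    exact Metric.isOpen_ball.is_const_of_fderiv_eq_zero (𝕜 := ℝ)
      (convex_ball (X.chart i x) r).isPreconnected
      (fun y hy => (differentiableAt_of_smoothOn (X.chart i).open_target (hf i)
        (hball hy)).differentiableWithinAt)
      (fun y hy => fderiv_eq_zero_of_pd (hd i y (hball hy))) hz.2 (Metric.mem_ball_self hr)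
  obtain ⟨x₀⟩ := (inferInstance : Nonempty M)
  refine ⟨F x₀, fun i y hy => ?_⟩
  have h1 := hF i _ ((X.chart i).map_target hy)
  rw [(X.chart i).right_inv hy] at h1
  rw [← h1]
  exact hloc.apply_eq_of_isPreconnected isPreconnected_univ (Set.mem_univ _) (Set.mem_univ _)

/-- The real part of a complex Killing tensor. -/
def KillingTensor.ofComplex (W : ExternalFields X) (z : ι → Fin 2 → Fin 2 → Coord → ℂ)
    (smooth : ∀ i a b, ContDiffOn ℝ ∞ (z i a b) (X.chart i).target)
    (symm : ∀ i a b, z i a b = z i b a)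
    (trans : ∀ i j, ∀ x ∈ (X.chart i).source ∩ (X.chart j).source, ∀ k l,
      z j k l (X.chart j x) =
        ∑ a, ∑ b, ((X.rot i j x a k * X.rot i j x b l : ℝ) : ℂ) * z i a b (X.chart i x))
    (killing : ∀ i, (W.localData i).IsKillingTensor (z i)) : KillingTensor X where
  t i a b y := (z i a b y).re
  smooth i a b := Complex.reCLM.contDiff.comp_contDiffOn (smooth i a b)
  symm i a b x _ := by rw [symm]
  trans i j x hx k l := by
    rw [trans i j x hx, Complex.re_sum]
    refine Finset.sum_congr rfl fun a _ => ?_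
    rw [Complex.re_sum]
    exact Finset.sum_congr rfl fun b _ => Complex.re_ofReal_mul _ _
  killing i x hx d a b := (killing i).nablaUp_re (smooth i) (symm i) hx d a b

end DiracSymmetry

/-! ### Without further Killing tensors every symmetry operator is trivial -/

namespace DiracSymmetry

open TopologicalSpace

variable {c : DiracMatrices} {M : Type*} [TopologicalSpace M] [ChartedSpace Coord M] {ι : Type*}
  {X : SpinManifold c M ι}

theorem KillingTensor.eq_of_proportional (W : ExternalFields X)
    (hT : ∀ T : KillingTensor X, T.ProportionalToMetric) {z : ι → Fin 2 → Fin 2 → Coord → ℂ}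
    (smooth : ∀ i a b, ContDiffOn ℝ ∞ (z i a b) (X.chart i).target)
    (symm : ∀ i a b, z i a b = z i b a)
    (trans : ∀ i j, ∀ x ∈ (X.chart i).source ∩ (X.chart j).source, ∀ k l,
      z j k l (X.chart j x) =
        ∑ a, ∑ b, ((X.rot i j x a k * X.rot i j x b l : ℝ) : ℂ) * z i a b (X.chart i x))
    (killing : ∀ i, (W.localData i).IsKillingTensor (z i)) (i : ι) {y : Coord}
    (hy : y ∈ (X.chart i).target) :
    ∃ s : ℝ, ∀ a b, (z i a b y).re = if a = b then s * c.η a else 0 :=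
  hT (KillingTensor.ofComplex W z smooth symm trans killing) i y hy

/-- The square w ⊗ w of a real Killing vector is a Killing tensor of rank at most one, and a
multiple of the nondegenerate metric has such rank only if it is zero. -/
theorem eq_zero_of_killingVector (W : ExternalFields X)
    (hT : ∀ T : KillingTensor X, T.ProportionalToMetric) {w : ι → Fin 2 → Coord → ℂ}
    (smooth : ∀ i a, ContDiffOn ℝ ∞ (w i a) (X.chart i).target)
    (trans : ∀ i j, ∀ x ∈ (X.chart i).source ∩ (X.chart j).source, ∀ k,
      w j k (X.chart j x) = X.rot i j x 0 k * w i 0 (X.chart i x)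
        + X.rot i j x 1 k * w i 1 (X.chart i x))
    (killing : ∀ i, (W.localData i).IsKillingVector (w i)) (i : ι) {y : Coord}
    (hy : y ∈ (X.chart i).target) (a : Fin 2) : w i a y = 0 := by
  have key : ∀ v : ι → Fin 2 → Coord → ℂ,
      (∀ i a, ContDiffOn ℝ ∞ (v i a) (X.chart i).target) →
      (∀ i j, ∀ x ∈ (X.chart i).source ∩ (X.chart j).source, ∀ k,
        v j k (X.chart j x) = X.rot i j x 0 k * v i 0 (X.chart i x)
          + X.rot i j x 1 k * v i 1 (X.chart i x)) →
      (∀ i, (W.localData i).IsKillingVector (v i)) → (v i a y).re = 0 := by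
    intro v smooth trans killing
    have hs : ∀ i a, ContDiffOn ℝ ∞ (fun y => ((v i a y).re : ℂ)) (X.chart i).target :=
      fun i a => smoothOn_ofReal (Complex.reCLM.contDiff.comp_contDiffOn (smooth i a))
    obtain ⟨s, h⟩ := KillingTensor.eq_of_proportional W hT
      (z := fun i a b y => ((v i a y).re : ℂ) * ((v i b y).re : ℂ))
      (fun i a b => (hs i a).mul (hs i b)) (fun i a b => funext fun y => mul_comm _ _)
      (fun i j x hx k l => by
        have h1 : ∀ k, ((v j k (X.chart j x)).re : ℂ) =
            X.rot i j x 0 k * (v i 0 (X.chart i x)).re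
              + X.rot i j x 1 k * (v i 1 (X.chart i x)).re := by
          intro k
          rw [trans i j x hx k, Complex.add_re, Complex.re_ofReal_mul, Complex.re_ofReal_mul]
          push_cast
          rfl
        simp only [h1, Fin.sum_univ_two]
        push_cast
        ring)
      (fun i => ((killing i).re (smooth i)).tensor (hs i)) i hy
    simp only [← Complex.ofReal_mul, Complex.ofReal_re] at h
    have h00 := h 0 0
    have h01 := h 0 1
    have h11 := h 1 1
    rw [if_pos rfl] at h00 h11
    rw [if_neg zero_ne_one] at h01
    have n0 : c.η 0 ≠ 0 := by exact_mod_cast c.η_ne_zero 0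
    have n1 : c.η 1 ≠ 0 := by exact_mod_cast c.η_ne_zero 1
    -- The off-diagonal entry vanishes, so one component of the vector is zero, and the
    -- corresponding diagonal entry gives s = 0.
    have hs : s = 0 := by
      rcases mul_eq_zero.1 h01 with h0 | h0
      · rw [h0, mul_zero] at h00
        exact (mul_eq_zero.1 h00.symm).resolve_right n0
      · rw [h0, mul_zero] at h11
        exact (mul_eq_zero.1 h11.symm).resolve_right n1
    have := h a a
    rw [if_pos rfl, hs, zero_mul] at this
    exact mul_self_eq_zero.1 this
  refine Complex.ext (key w smooth trans killing) ?_
  -- The imaginary part of w is the real part of -i w.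
  have h := key (fun i a y => -Complex.I * w i a y) (fun i a => contDiffOn_const.mul (smooth i a))
    (fun i j x hx k => by
      rw [trans i j x hx k]
      ring)
    (fun i => (killing i).const_mul (smooth i) _)
  simpa using h

/-- The real parts of z and of -i z are real Killing tensors, so z is a complex multiple of the
metric. -/
theorem eq_of_killingTensor (W : ExternalFields X)
    (hT : ∀ T : KillingTensor X, T.ProportionalToMetric) {z : ι → Fin 2 → Fin 2 → Coord → ℂ}
    (smooth : ∀ i a b, ContDiffOn ℝ ∞ (z i a b) (X.chart i).target)
    (symm : ∀ i a b, z i a b = z i b a)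
    (trans : ∀ i j, ∀ x ∈ (X.chart i).source ∩ (X.chart j).source, ∀ k l,
      z j k l (X.chart j x) =
        ∑ a, ∑ b, ((X.rot i j x a k * X.rot i j x b l : ℝ) : ℂ) * z i a b (X.chart i x))
    (killing : ∀ i, (W.localData i).IsKillingTensor (z i)) (i : ι) {y : Coord}
    (hy : y ∈ (X.chart i).target) : z i 0 1 y = 0 ∧ z i 1 1 y = c.η 0 * c.η 1 * z i 0 0 y := by
  obtain ⟨s, hs⟩ := KillingTensor.eq_of_proportional W hT smooth symm trans killing i hy
  obtain ⟨r, hr⟩ := KillingTensor.eq_of_proportional W hT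
    (z := fun i a b y => -Complex.I * z i a b y)
    (fun i a b => contDiffOn_const.mul (smooth i a b))
    (fun i a b => by simp only [symm i a b])
    (fun i j x hx k l => by
      rw [trans i j x hx k l, Finset.mul_sum]
      refine Finset.sum_congr rfl fun a _ => ?_
      rw [Finset.mul_sum]
      exact Finset.sum_congr rfl fun b _ => by ring)
    (fun i => (killing i).const_mul (smooth i) _) i hy
  have hi : ∀ a b, (z i a b y).im = if a = b then r * c.η a else 0 := by
    intro a b
    rw [← hr]
    simp
  have e : ∀ a b, z i a b y = if a = b then (s + r * Complex.I) * c.η a else 0 := by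
    intro a b
    rw [← Complex.re_add_im (z i a b y), hs, hi]
    split_ifs
    · push_cast; ring
    · simp
  refine ⟨by rw [e, if_neg zero_ne_one], ?_⟩
  rw [e, e, if_pos rfl, if_pos rfl]
  linear_combination -(s + r * Complex.I) * c.η 1 * c.ηC_mul_self 0

/-- The coefficient `l` of a conformal Killing tensor `l η` is locally constant. -/
theorem LocalData.IsKillingTensor.pd_eq_zero {L : LocalData c} {z : Fin 2 → Fin 2 → Coord → ℂ}
    (h : L.IsKillingTensor z) (h01 : ∀ y ∈ L.U, z 0 1 y = 0)
    (h11 : ∀ y ∈ L.U, z 1 1 y = c.η 0 * c.η 1 * z 0 0 y)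
    (hz : ContDiffOn ℝ ∞ (z 0 0) L.U) {y : Coord} (hy : y ∈ L.U) (μ : Fin 2) :
    pd μ (z 0 0) y = 0 := by
  refine LocalData.pd_eq_zero_of_frameDeriv (L := L) ⟨y, hy⟩ (fun a => ?_) μ
  -- At a coordinate covector the connection terms vanish for a multiple of η, and one frame
  -- derivative remains.
  have h0 := h y hy ![1, 0]
  have h1 := h y hy ![0, 1]
  have e : frameDeriv L.e 1 (z 1 1) y = c.η 0 * c.η 1 * frameDeriv L.e 1 (z 0 0) y := by
    rw [frameDeriv, pd_congr L.U.2 h11 0 hy, pd_congr L.U.2 h11 1 hy]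
    change frameDeriv L.e 1 (fun y => c.η 0 * c.η 1 * z 0 0 y) y = _
    rw [frameDeriv_mul L.e 1 (differentiableAt_const _) (differentiableAt_of_smoothOn L.U.2 hz hy),
      frameDeriv_const, mul_zero, add_zero]
  simp only [Matrix.cons_val_zero, Matrix.cons_val_one, h01 y hy, e] at h0 h1
  push_cast at h0 h1
  have n0 := c.η_ne_zero 0
  have k0 := c.ηC_mul_self 0
  have k1 := c.ηC_mul_self 1
  fin_cases a
  · simp only [Fin.zero_eta]
    linear_combination c.η 0 * h0 - frameDeriv L.e 0 (z 0 0) y * k0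
  · simp only [Fin.mk_one]
    linear_combination c.η 0 * h1 - frameDeriv L.e 1 (z 0 0) y * k0
      - c.η 0 * c.η 0 * frameDeriv L.e 1 (z 0 0) y * k1

variable (W : ExternalFields X)

theorem reducedF_trans {F : ι → Fin 2 → Coord → Mat}
    (hF : ∀ i j, ∀ x ∈ (X.chart i).source ∩ (X.chart j).source, ∀ k,
      X.S i j x * F j k (X.chart j x) =
        (∑ a, (X.rot i j x a k : ℂ) • F i a (X.chart i x)) * X.S i j x) (l : ℂ) (i j : ι) {x : M}
    (hx : x ∈ (X.chart i).source ∩ (X.chart j).source) (k : Fin 2) :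
    X.S i j x * (W.localData j).reducedF l (F j) k (X.chart j x) =
      (∑ a, (X.rot i j x a k : ℂ) • (W.localData i).reducedF l (F i) a (X.chart i x))
        * X.S i j x := by
  have hc := (X.isSpinRotation i j hx).conj k
  have hV := W.V_trans i j x hx
  have h1 : X.S i j x * (c.ig k * W.V j (X.chart j x)) =
      (∑ a, (X.rot i j x a k : ℂ) • c.ig a) * W.V i (X.chart i x) * X.S i j x := by
    rw [← mul_assoc, hc, mul_assoc, ← hV, mul_assoc]
  have h2 : X.S i j x * (W.V j (X.chart j x) * c.ig k) =
      W.V i (X.chart i x) * (∑ a, (X.rot i j x a k : ℂ) • c.ig a) * X.S i j x := by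
    rw [← mul_assoc, ← hV, mul_assoc, hc, mul_assoc]
  change X.S i j x * (F j k (X.chart j x) - l • (c.ig k * W.V j (X.chart j x)
    + W.V j (X.chart j x) * c.ig k)) = (∑ a, (X.rot i j x a k : ℂ) • (F i a (X.chart i x)
    - l • (c.ig a * W.V i (X.chart i x) + W.V i (X.chart i x) * c.ig a))) * X.S i j x
  rw [mul_sub, Matrix.mul_smul, mul_add, h1, h2, hF i j x hx k, ← add_mul, ← Matrix.smul_mul,
    ← sub_mul]
  congr 1
  simp only [Fin.sum_univ_two, add_mul, mul_add, Matrix.smul_mul, Matrix.mul_smul]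
  module

/-- The operator `t - l 𝔻`. -/
def diracPolynomial (l t : ℂ) : DiffOp X where
  E _ _ _ _ := 0
  F _ a _ := (-l) • c.ig a
  G i y := l • W.V i y + t • 1
  E_smooth _ _ _ := smoothMatOn_const _ _
  F_smooth _ _ := smoothMatOn_const _ _
  G_smooth i := ((W.V_smooth i).const_smul l).add (smoothMatOn_const _ _)
  E_trans i j x hx k m := by simp
  F_trans i j x hx k := by
    rw [Matrix.mul_smul, (X.isSpinRotation i j hx).conj k, ← Matrix.smul_mul, Finset.smul_sum]
    exact congrArg (· * X.S i j x) (Finset.sum_congr rfl fun a _ => smul_comm _ _ _)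
  G_trans i j x hx := by
    rw [mul_add, Matrix.mul_smul, Matrix.mul_smul, ← W.V_trans i j x hx, mul_one, add_mul,
      Matrix.smul_mul, Matrix.smul_mul, one_mul]

theorem diracPolynomial_act (l t : ℂ) (i : ι) (ψ : Coord → Spinor) (x : Coord) :
    (diracPolynomial W l t).act W i ψ x = (-l) • dirac W i ψ x + t • ψ x := by
  simp only [DiffOp.act, diracPolynomial, dirac, DiracMatrices.ig, Fin.sum_univ_two,
    Matrix.zero_mulVec, Matrix.smul_mulVec, Matrix.add_mulVec, Matrix.one_mulVec]
  module

/-- A polynomial in the Dirac operator commutes with it. Algebraic representatives serve to apply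
linearity to smooth spinors. -/
theorem diracPolynomial_isSymmetry (l t : ℂ) : (diracPolynomial W l t).IsSymmetry W := by
  intro i ψ hψ x hx
  have e : (diracPolynomial W l t).act W i ψ = fun y => (-l) • dirac W i ψ y + t • ψ y :=
    funext fun y => diracPolynomial_act W l t i ψ y
  rw [e, diracPolynomial_act]
  obtain ⟨Ψ, hΨ⟩ := LocalData.exists_rep (L := W.localData i) hψ
  have h1 := (hΨ.dirac.dirac.const_smul (-l)).add (hΨ.dirac.const_smul t)
  have h2 := ((hΨ.dirac.const_smul (-l)).add (hΨ.const_smul t)).dirac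
  rw [map_add, map_smul, map_smul] at h2
  exact h1.unique h2 x hx

theorem exists_killingTensor_of_not_isTrivial [ConnectedSpace M] (K : DiffOp X)
    (hK : K.IsSymmetry W) (hK' : ¬ K.IsTrivial W) :
    ∃ T : KillingTensor X, ¬ T.ProportionalToMetric := by
  by_contra! hT
  have hloc : ∀ i, ∀ ψ : Coord → Spinor, ContDiffOn ℝ ∞ ψ (W.localData i).U →
      ∀ x ∈ (W.localData i).U, (W.localData i).act (K.E i) (K.F i) (K.G i)
        ((W.localData i).dirac ψ) x =
        (W.localData i).dirac ((W.localData i).act (K.E i) (K.F i) (K.G i) ψ) x := hK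
  have h2 := fun i => LocalData.second_order_killing (L := W.localData i) (K.E_smooth i)
    (K.F_smooth i) (K.G_smooth i) (hloc i)
  have hsm : ∀ i a b, ContDiffOn ℝ ∞ (fun y => DiracMatrices.tenPart (fun a b => K.E i a b y) a b)
      (X.chart i).target := fun i a b => tenPart_smooth (K.E_smooth i) a b
  have hvec : ∀ i, ∀ y ∈ (X.chart i).target, ∀ a, c.vecPart₂ (fun a b => K.E i a b y) a = 0 :=
    fun i y hy a => eq_zero_of_killingVector W hT
      (w := fun i a y => c.vecPart₂ (fun a b => K.E i a b y) a)
      (fun i a => vecPart₂_smooth c (K.E_smooth i) a)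
      (fun i j x hx k => (X.isSpinRotation i j hx).vecPart₂_eq (K.E_trans i j x hx) k)
      (fun i => (h2 i).2.1) i hy a
  have hten : ∀ i, ∀ y ∈ (X.chart i).target,
      DiracMatrices.tenPart (fun a b => K.E i a b y) 0 1 = 0 ∧
      DiracMatrices.tenPart (fun a b => K.E i a b y) 1 1 =
        c.η 0 * c.η 1 * DiracMatrices.tenPart (fun a b => K.E i a b y) 0 0 :=
    fun i y hy => eq_of_killingTensor W hT
      (z := fun i a b y => DiracMatrices.tenPart (fun a b => K.E i a b y) a b) hsm
      (fun i a b => funext fun y => by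
        simp only [DiracMatrices.tenPart, add_comm (K.E i a b y)])
      (fun i j x hx k l => (X.isSpinRotation i j hx).tenPart_eq (K.E_trans i j x hx) k l)
      (fun i => (h2 i).2.2) i hy
  -- The (0, 0) component of a multiple of η is unchanged by an η-orthogonal rotation, so it defines
  -- a function on the manifold.
  obtain ⟨m, hm⟩ := X.exists_const (f := fun i y =>
      DiracMatrices.tenPart (fun a b => K.E i a b y) 0 0) (fun i => hsm i 0 0)
    (fun i y hy μ => (h2 i).2.2.pd_eq_zero (fun y hy => (hten i y hy).1)
      (fun y hy => (hten i y hy).2) (hsm i 0 0) hy μ)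
    (fun i j x hx => by
      have hr := X.isSpinRotation i j hx
      have h := hr.tenPart_eq (K.E_trans i j x hx) 0 0
      have ht := hten i _ ((X.chart i).map_source hx.1)
      have hs : DiracMatrices.tenPart (fun a b => K.E i a b (X.chart i x)) 1 0 = 0 := by
        rw [← ht.1]
        simp only [DiracMatrices.tenPart, add_comm (K.E i 1 0 _)]
      have hu := congrArg (fun r : ℝ => (r : ℂ)) hr.unit
      simp only [Fin.sum_univ_two, ht.1, ht.2, hs, hr.eq₁₀] at h
      refine Eq.trans ?_ h.symm
      push_cast at hu ⊢
      have k0 := c.ηC_mul_self 0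
      have k1 := c.ηC_mul_self 1
      set z := DiracMatrices.tenPart (fun a b => K.E i a b (X.chart i x)) 0 0
      linear_combination -z * hu - z * c.η 0 * c.η 1 * X.rot i j x 0 1 ^ 2 * k0
        - z * c.η 0 * c.η 0 * c.η 0 * c.η 1 * X.rot i j x 0 1 ^ 2 * k1)
  -- The tensor is `l` times η, and its (0, 0) component is `m`.
  set l : ℂ := c.η 0 * m with hl
  have k0 := c.ηC_mul_self 0
  have hlm : m = l * c.η 0 := by linear_combination -m * k0 + c.η 0 * hl
  have hE₀ : ∀ i, ∀ y ∈ (W.localData i).U, K.E i 0 0 y = (l * c.η 0) • (1 : Mat) := by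
    intro i y hy
    rw [((h2 i).1 y hy).1, hvec i y hy, hm i y hy, zero_smul, add_zero, hlm]
  have hE₁ : ∀ i, ∀ y ∈ (W.localData i).U, K.E i 1 1 y = (l * c.η 1) • (1 : Mat) := by
    intro i y hy
    rw [((h2 i).1 y hy).2.1, hvec i y hy, (hten i y hy).2, hm i y hy, zero_smul, add_zero]
    congr 1
    linear_combination -c.η 1 * hl
  have hQ : ∀ i, ∀ y ∈ (W.localData i).U, K.E i 0 1 y + K.E i 1 0 y = 0 := by
    intro i y hy
    rw [((h2 i).1 y hy).2.2, hvec i y hy, hvec i y hy, (hten i y hy).1]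
    simp
  have h1 := fun i => LocalData.first_order_killing (L := W.localData i) (K.E_smooth i)
    (K.F_smooth i) (K.G_smooth i) (hE₀ i) (hE₁ i) (hQ i) (hloc i)
  have hFs := fun i => LocalData.reducedF_smooth (L := W.localData i) l (K.F_smooth i)
  -- The Killing vector in the symbol of `K + l 𝔻²` vanishes as well, which leaves a constant
  -- multiple `t` of the symbol of the Dirac operator.
  have hw := fun i y (hy : y ∈ (X.chart i).target) a => eq_zero_of_killingVector W hT
    (w := fun i a y => DiracMatrices.vecPart₁ (fun a => (W.localData i).reducedF l (K.F i) a y) a)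
    (fun i a => vecPart₁_smooth (hFs i) a)
    (fun i j x hx k => (X.isSpinRotation i j hx).vecPart₁_eq
      (F := fun a => (W.localData i).reducedF l (K.F i) a (X.chart i x))
      (F' := fun a => (W.localData j).reducedF l (K.F j) a (X.chart j x))
      (reducedF_trans W K.F_trans l i j hx) k)
    (fun i => (h1 i).2.1) i hy a
  obtain ⟨t, ht⟩ := X.exists_const
    (f := fun i y => c.scalPart (fun a => (W.localData i).reducedF l (K.F i) a y))
    (fun i => scalPart_smooth c (hFs i)) (fun i => (h1 i).2.2)
    (fun i j x hx => ((X.isSpinRotation i j hx).scalPart_eq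
      (F := fun a => (W.localData i).reducedF l (K.F i) a (X.chart i x))
      (F' := fun a => (W.localData j).reducedF l (K.F j) a (X.chart j x))
      (reducedF_trans W K.F_trans l i j hx)).symm)
  have hFt : ∀ i, ∀ y ∈ (W.localData i).U, ∀ a,
      (W.localData i).reducedF l (K.F i) a y = t • c.ig a := by
    intro i y hy a
    rw [(h1 i).1 y hy a, hw i y hy a, ht i y hy, zero_smul, zero_add]
  have h0 := fun i => LocalData.zero_order_const (L := W.localData i) (K.E_smooth i)
    (K.F_smooth i) (K.G_smooth i) (hE₀ i) (hE₁ i) (hQ i) (hFt i) (hloc i)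
  obtain ⟨k, hk⟩ := X.exists_const (f := fun i => (W.localData i).reducedG l t (K.G i))
    (fun i => LocalData.reducedG_smooth (L := W.localData i) (K.G_smooth i) l t)
    (fun i => (h0 i).1)
    (fun i j x hx => W.reducedG_invariant K.G_trans l t i j hx)
  -- Here K = (t - l 𝔻) 𝔻 + k, contrary to the assumption that `K` is not trivial.
  refine hK' ⟨diracPolynomial W l t, fun i a b x _ => rfl, diracPolynomial_isSymmetry W l t, k,
    fun i ψ hψ x hx => ?_⟩
  rw [diracPolynomial_act, ← hk i x hx]
  exact (h0 i).2 ψ hψ x hx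

end DiracSymmetry

end

theorem mainTheorem3 (c : DiracSymmetry.DiracMatrices) {M : Type*} [TopologicalSpace M]
    [T2Space M] [ParacompactSpace M] [ConnectedSpace M]
    [ChartedSpace (EuclideanSpace ℝ (Fin 2)) M] [IsManifold (𝓡 2) ∞ M] {ι : Type*}
    (X : DiracSymmetry.SpinManifold c M ι) (W : DiracSymmetry.ExternalFields X)
    (K : DiracSymmetry.DiffOp X) (hK : K.IsSymmetry W) (hK' : ¬ K.IsTrivial W) :
    ∃ T : DiracSymmetry.KillingTensor X, ¬ T.ProportionalToMetric :=
  DiracSymmetry.exists_killingTensor_of_not_isTrivial W K hK hK'
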